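/- Let $p(y,z|x)$ be a discrete memoryless degraded wiretap channel with finite alphabets, i.e. $p(z|x)=\sum_y p(y|x)\,g(z|y)$ for some channel $g$. Put $C=\max_{p(x)}I(X;Y)$ and $R_s=\max_{p(x)}[I(X;Y)-I(X;Z)]$ (in bits), and assume $R_s>0$ and that $L=C/R_s$ is an integer. Scheme. A slot consists of $M+1$ minislots of $n$ channel uses. The source produces i.i.d. uniform messages of $b_n$ bits. In slot $k=0,1,2,\dots$ the message $\overline W_k$ consists of $1+m_k$ new source messages, $m_k=\min(k,LM)$. The first of them, $\overline W_{k,1}$, is sent in the first minislot by a (stochastic) wiretap code of block length $n$. The other $m_k$ messages are XORed with the $m_k$ oldest messages of a first-in-first-out key buffer, and the result (filled up with zeros if $m_k<LM$) is sent by a channel code in the other $M$ minislots. Used keys are discarded, all messages of slot $k$ are appended to the buffer at the end of the slot, and the buffer is empty before slot $0$. Bob decodes with the decoders of the two codes and removes the keys with his own decoded messages, which he stores in the same way; $\widehat W_k$ is the result. $\overline Z_k$ denotes everything Eve receives in slot $k$. The rate is $\frac{(1+LM)b_n}{(M+1)n}$, and the leakage in slot $k$ is $I(\overline W_k,\dots,\overline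 W_{k-N_1};\overline Z_0,\dots,\overline Z_k)$. Call the sequence (in $n$) of component codes a Wyner family if $b_n/n\to R_s$, the wiretap code has error probability $\epsilon_n\to0$ and leakage $\frac1n I(W;Z^n)\to0$ for a uniform message $W$, and the channel code has maximal error probability $\delta_n\to0$. Call it a strong family if moreover $I(W;Z^n)\to0$ (as provided by resolvability-based coding). Theorem. (1) For every $M\ge 0$, Wyner families and strong families exist. (2) For every $M$ and every Wyner family, the rate tends to $\frac{R_s+CM}{M+1}$ as $n\to\infty$; for every slot $k$, $\Pr(\overline W_k\ne\widehat W_k)\le (k+1)\epsilon_n+k\delta_n\to0$; and for every $N_1\ge0$ there is $k_0$ such that for every $\varepsilon>0$ there is $n_0$ such that for all $n\ge n_0$ and all $k\ge k_0$, $$\frac1n I(\overline W_k,\dots,\overline W_{k-N_1};\overline Z_0,\dots,\overline Z_k)\le(2N_1+1)\varepsilon .$$ (3) For every $M$, every strong family and every $N_1\ge0$ there is $k_0$ such that for every $\varepsilon>0$ there is $n_0$ such that $I(\overline W_k,\dots,\overline W_{k-N_1};\overline Z_0,\dots,\overline Z_k)\le\varepsilon$ for all $n\ge n_0$ and all $k\ge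 k_0$. (4) $\frac{R_s+CM}{M+1}\to C$ as $M\to\infty$. The secrecy capacity of the scheme is $C$: call $R$ achieved if for some $M$ and some sequence of component codes the rate tends to $R$ and, for every $N_1$ and all large enough $k$, $\Pr(\overline W_k\ne\widehat W_k)\to0$ and $\frac1n I(\overline W_k,\dots,\overline W_{k-N_1};\overline Z_0,\dots,\overline Z_k)\to0$ as $n\to\infty$; then the supremum of all achieved rates is $C$. The same holds if $\frac1n$ is omitted (strong secrecy). -/

import Mathlib

open Filter Topology

namespace WiretapKey

noncomputable section

/-! ### Finite probability and mutual information (in bits) -/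

/-- Probability of the event `E` under the mass function `μ` on a finite sample space. -/
def prob {Ω : Type*} [Fintype Ω] (μ : Ω → ℝ) (E : Set Ω) : ℝ :=
  ∑ ω, E.indicator μ ω

/-- The mass function of the random variable `f`. -/
def law {Ω A : Type*} [Fintype Ω] (μ : Ω → ℝ) (f : Ω → A) (a : A) : ℝ :=
  prob μ (f ⁻¹' {a})

/-- Mutual information `I(f; g)` in bits; a term with zero joint mass contributes zero. -/
def mutualInfo {Ω A B : Type*} [Fintype Ω] [Fintype A] [Fintype B]
    (μ : Ω → ℝ) (f : Ω → A) (g : Ω → B) : ℝ :=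
  ∑ a, ∑ b, law μ (fun ω => (f ω, g ω)) (a, b) *
    Real.logb 2 (law μ (fun ω => (f ω, g ω)) (a, b) / (law μ f a * law μ g b))

/-! ### The discrete memoryless wiretap channel

The channel is a transition matrix `p(y,z|x)`, written `ch x (y, z)`. -/

section Channel

variable {X Y Z : Type*} [Fintype X] [Fintype Y] [Fintype Z]

/-- The channel is degraded: Eve's channel is Bob's channel followed by a further channel
`p(z|y)` (stochastic degradedness, of which physical degradedness is a special case). -/
def IsDegraded (ch : X → stdSimplex ℝ (Y × Z)) : Prop :=
  ∃ g : Y → stdSimplex ℝ Z, ∀ x z,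
    ∑ y, ch x (y, z) = ∑ y, (∑ z', ch x (y, z')) * g y z

/-- The joint mass function of `(X, (Y, Z))` for the input distribution `p`. -/
def channelJoint (ch : X → stdSimplex ℝ (Y × Z)) (p : stdSimplex ℝ X) : X × (Y × Z) → ℝ :=
  fun ω => p ω.1 * ch ω.1 ω.2

/-- `I(X;Y)` for the input distribution `p`. -/
def infoBob (ch : X → stdSimplex ℝ (Y × Z)) (p : stdSimplex ℝ X) : ℝ :=
  mutualInfo (channelJoint ch p) (fun ω => ω.1) (fun ω => ω.2.1)

/-- `I(X;Z)` for the input distribution `p`. -/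
def infoEve (ch : X → stdSimplex ℝ (Y × Z)) (p : stdSimplex ℝ X) : ℝ :=
  mutualInfo (channelJoint ch p) (fun ω => ω.1) (fun ω => ω.2.2)

/-- The capacity `C = max_p I(X;Y)` of the main (Alice to Bob) channel. -/
def mainCapacity (ch : X → stdSimplex ℝ (Y × Z)) : ℝ :=
  ⨆ p : stdSimplex ℝ X, infoBob ch p

/-- The secrecy capacity `R_s = max_p [I(X;Y) - I(X;Z)]` of the wiretap channel. -/
def secrecyCapacity (ch : X → stdSimplex ℝ (Y × Z)) : ℝ :=
  ⨆ p : stdSimplex ℝ X, (infoBob ch p - infoEve ch p)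

/-- Memoryless use of the channel: the probability of the output block `o` given the input
block `x`. -/
def blockProb (ch : X → stdSimplex ℝ (Y × Z)) {ι : Type*} [Fintype ι]
    (x : ι → X) (o : ι → Y × Z) : ℝ :=
  ∏ i, ch (x i) (o i)

end Channel

/-- A source message of `b` bits; addition is bitwise XOR. -/
abbrev Bits (b : ℕ) : Type := Fin b → ZMod 2

/-! ### Bookkeeping of the slotted scheme

Slots are numbered `0, 1, 2, …`.  At most `q` messages per slot are sent under a key.
Slot `k` carries one message in its first minislot and `min k q` one-time-padded messages in
its other minislots.  The messages are taken in order from one source stream `W_0, W_1, …`. -/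

/-- Number of one-time-padded messages in slot `k`. -/
def keyed (q k : ℕ) : ℕ := min k q

/-- Stream index of the first message of slot `k`: this message is sent in the first minislot,
and the messages with indices `start q k + 1 + i`, `i < keyed q k`, are one-time-padded. -/
def start (q k : ℕ) : ℕ := ∑ j ∈ Finset.range k, (1 + keyed q j)

/-- The FIFO key buffer at the beginning of slot `k`, as the list of stream indices of the
messages it holds, oldest first.  In each slot the oldest `keyed q k` messages are removed
(they are the keys of this slot), and all messages sent in this slot are appended. -/
def buffer (q : ℕ) : ℕ → List ℕ
  | 0 => []
  | k + 1 => (buffer q k).drop (keyed q k) ++ List.range' (start q k) (1 + keyed q k)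

/-- Stream index of the old message that is the key of the `i`-th one-time-padded message of
slot `k`, that is, the `i`-th oldest entry of the buffer. -/
def keyIndex (q k i : ℕ) : ℕ := (buffer q k).getD i 0

/-- The buffer at the beginning of slot `k` holds exactly the `k` latest messages. -/
theorem buffer_eq (q k : ℕ) :
    k ≤ start q k ∧ buffer q k = List.range' (start q k - k) k := by
  induction k with
  | zero => simp [buffer, start]
  | succ k ih =>
    obtain ⟨h1, h2⟩ := ih
    have hm : keyed q k ≤ k := min_le_left _ _
    have hs : start q (k + 1) = start q k + (1 + keyed q k) := by
      simp [start, Finset.sum_range_succ]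
    refine ⟨by omega, ?_⟩
    rw [buffer, h2, hs, List.drop_range', mul_one]
    have e1 : start q k = (start q k - k + keyed q k) + (k - keyed q k) := by omega
    have e2 : start q k + (1 + keyed q k) - (k + 1) = start q k - k + keyed q k := by omega
    have e3 : k + 1 = (k - keyed q k) + (1 + keyed q k) := by omega
    have e4 := List.range'_append_1 (s := start q k - k + keyed q k)
      (m := k - keyed q k) (n := 1 + keyed q k)
    rw [← e1] at e4
    rw [e2, e4, ← e3]

/-- Every key that is used was sent in an earlier slot. -/
theorem keyIndex_eq (q k i : ℕ) (hi : i < keyed q k) :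
    keyIndex q k i = start q k - k + i ∧ keyIndex q k i < start q k := by
  have hm : keyed q k ≤ k := min_le_left _ _
  obtain ⟨h1, h2⟩ := buffer_eq q k
  have h : keyIndex q k i = start q k - k + i := by
    rw [keyIndex, h2, List.getD_eq_getElem _ _ (by simp; omega)]
    simp
  exact ⟨h, by omega⟩

/-- Extend a finite sequence by zero. -/
def ext {K : ℕ} {A : Type*} [Zero A] (f : Fin K → A) (j : ℕ) : A :=
  if h : j < K then f ⟨j, h⟩ else 0

/-- The encrypted messages of slot `k`: position `i < keyed q k` holds the `i`-th new message
XORed with its key; unused positions (during the start-up phase) hold zeros. -/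
def encrypt {b : ℕ} (q k : ℕ) (w : ℕ → Bits b) : Fin q → Bits b := fun i =>
  if (i : ℕ) < keyed q k then w (start q k + 1 + i) + w (keyIndex q k i) else 0

/-- Bob's estimates of the message stream after `k` slots: `v j` is the output of the wiretap
decoder and `t j` the output of the channel decoder in slot `j`.  Bob XORs the latter with his
own decoded versions of the keys. -/
def estimate {b : ℕ} (q : ℕ) (v : ℕ → Bits b) (t : ℕ → Fin q → Bits b) : ℕ → ℕ → Bits b
  | 0 => fun _ => 0
  | k + 1 => fun m =>
      if m < start q k then estimate q v t k m
      else if m = start q k then v k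
      else if h : m - (start q k + 1) < q then
        t k ⟨m - (start q k + 1), h⟩ +
          estimate q v t k (keyIndex q k (m - (start q k + 1)))
      else 0

/-! ### The codes and the scheme -/

/-- The component codes of the slotted scheme, for minislots of `n` channel uses, `M` keyed
minislots per slot and `L` messages per keyed minislot: a stochastic wiretap encoder `f_s` with
its decoder for the first minislot, and a usual channel code for the encrypted messages. -/
structure Scheme (X Y : Type*) [Fintype X] (L M n : ℕ) where
  /-- number of bits of one source message -/
  bits : ℕ
  /-- wiretap encoder of the first minislot -/
  wEnc : Bits bits → stdSimplex ℝ (Fin n → X)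
  /-- wiretap decoder of the first minislot -/
  wDec : (Fin n → Y) → Bits bits
  /-- channel encoder of the other `M` minislots -/
  cEnc : (Fin (L * M) → Bits bits) → (Fin M × Fin n → X)
  /-- channel decoder of the other `M` minislots -/
  cDec : (Fin M × Fin n → Y) → (Fin (L * M) → Bits bits)

namespace Scheme

variable {X Y Z : Type*} [Fintype X] [Fintype Y] [Fintype Z] {L M n : ℕ}

/-! #### Performance of the component codes -/

/-- One use of the wiretap code with a uniform message: message, codeword and outputs. -/
def wJoint (S : Scheme X Y L M n) (ch : X → stdSimplex ℝ (Y × Z)) :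
    Bits S.bits × (Fin n → X) × (Fin n → Y × Z) → ℝ := fun ω =>
  (1 / 2 ^ S.bits) * S.wEnc ω.1 ω.2.1 * blockProb ch ω.2.1 ω.2.2

/-- Error probability of the wiretap code at Bob. -/
def wError (S : Scheme X Y L M n) (ch : X → stdSimplex ℝ (Y × Z)) : ℝ :=
  prob (S.wJoint ch) {ω | S.wDec (fun i => (ω.2.2 i).1) ≠ ω.1}

/-- Leakage `I(W; Z^n)` of the wiretap code. -/
def wLeak (S : Scheme X Y L M n) (ch : X → stdSimplex ℝ (Y × Z)) : ℝ :=
  mutualInfo (S.wJoint ch) (fun ω => ω.1) (fun ω i => (ω.2.2 i).2)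

/-- Maximal error probability of the channel code at Bob. -/
def cError (S : Scheme X Y L M n) (ch : X → stdSimplex ℝ (Y × Z)) : ℝ :=
  ⨆ t : Fin (L * M) → Bits S.bits,
    prob (blockProb ch (S.cEnc t)) {o | S.cDec (fun i => (o i).1) ≠ t}

/-! #### The slotted transmission -/

/-- Outcomes of the first `K` slots: the source messages, the randomly chosen codewords of the
first minislots, the channel outputs `(y, z)` of the first minislots, and the channel outputs
of the other minislots. -/
abbrev Outcome (X Y Z : Type*) (L M n b K : ℕ) : Type _ :=
  (Fin (start (L * M) K) → Bits b) × (Fin K → Fin n → X) ×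
    (Fin K → Fin n → Y × Z) × (Fin K → Fin M × Fin n → Y × Z)

/-- The joint mass function of the first `K` slots: the messages are independent and uniform,
the codewords of the first minislots are chosen by the wiretap encoder, the other minislots
carry the encoded one-time-padded messages, and the channel is memoryless. -/
def joint (S : Scheme X Y L M n) (ch : X → stdSimplex ℝ (Y × Z)) (K : ℕ) :
    Outcome X Y Z L M n S.bits K → ℝ := fun ω =>
  (1 / 2 ^ S.bits) ^ start (L * M) K *
    ∏ j : Fin K,
      (S.wEnc (ext ω.1 (start (L * M) j)) (ω.2.1 j) *
        blockProb ch (ω.2.1 j) (ω.2.2.1 j) *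
        blockProb ch (S.cEnc (encrypt (L * M) j (ext ω.1))) (ω.2.2.2 j))

/-- Bob's estimates of the message stream after `K` slots. -/
def bob (S : Scheme X Y L M n) {K : ℕ} (ω : Outcome X Y Z L M n S.bits K) : ℕ → Bits S.bits :=
  estimate (L * M) (ext fun j => S.wDec (fun i => (ω.2.2.1 j i).1))
    (ext fun j => S.cDec (fun i => (ω.2.2.2 j i).1)) K

/-- Probability that some message of slot `k` is decoded wrongly by Bob at the end of slot
`k`. -/
def errorProb (S : Scheme X Y L M n) (ch : X → stdSimplex ℝ (Y × Z)) (k : ℕ) : ℝ :=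
  prob (S.joint ch (k + 1))
    {ω | ∃ m, start (L * M) k ≤ m ∧ m < start (L * M) (k + 1) ∧ S.bob ω m ≠ ext ω.1 m}

/-- The leakage in slot `k`: the mutual information between all messages of the slots
`k - N₁, …, k` and everything that Eve receives in the slots `0, …, k`. -/
def leakage (S : Scheme X Y L M n) (ch : X → stdSimplex ℝ (Y × Z)) (N₁ k : ℕ) : ℝ :=
  mutualInfo (S.joint ch (k + 1))
    (fun ω (i : Fin (start (L * M) (k + 1) - start (L * M) (k - N₁))) =>
      ext ω.1 (start (L * M) (k - N₁) + i))
    (fun ω => ((fun j i => (ω.2.2.1 j i).2 : Fin (k + 1) → Fin n → Z),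
      (fun j i => (ω.2.2.2 j i).2 : Fin (k + 1) → Fin M × Fin n → Z)))

/-- The rate in a full slot, in bits per channel use: `1 + L M` messages are sent in
`(M + 1) n` channel uses. -/
def rate (S : Scheme X Y L M n) : ℝ :=
  ((1 + L * M : ℕ) * (S.bits : ℝ)) / (((M + 1 : ℕ) : ℝ) * (n : ℝ))

end Scheme

section Families

variable {X Y Z : Type*} [Fintype X] [Fintype Y] [Fintype Z] {L M : ℕ}

/-- The channel codes are reliable, the wiretap codes are reliable, and the messages have
`n R_s` bits up to `o(n)`. -/
def IsReliableFamily (ch : X → stdSimplex ℝ (Y × Z)) (S : ∀ n, Scheme X Y L M n) : Prop :=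
  Tendsto (fun n => ((S n).bits : ℝ) / (n : ℝ)) atTop (𝓝 (secrecyCapacity ch)) ∧
  Tendsto (fun n => (S n).wError ch) atTop (𝓝 0) ∧
  Tendsto (fun n => (S n).cError ch) atTop (𝓝 0)

/-- The first minislots use wiretap coding in the sense of Wyner: the leakage rate vanishes. -/
def IsWynerFamily (ch : X → stdSimplex ℝ (Y × Z)) (S : ∀ n, Scheme X Y L M n) : Prop :=
  IsReliableFamily ch S ∧ Tendsto (fun n => (S n).wLeak ch / (n : ℝ)) atTop (𝓝 0)

/-- The first minislots use wiretap coding with strong secrecy, as resolvability-based coding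
provides it: the leakage itself vanishes. -/
def IsStrongFamily (ch : X → stdSimplex ℝ (Y × Z)) (S : ∀ n, Scheme X Y L M n) : Prop :=
  IsReliableFamily ch S ∧ Tendsto (fun n => (S n).wLeak ch) atTop (𝓝 0)

end Families

/-- `R` is a secrecy rate of the slotted scheme (for some number `M` of keyed minislots and some
component codes): the rate of a full slot tends to `R`, and for every `N₁` and all large enough
`k`, Bob's error probability in slot `k` and the leakage rate in slot `k` tend to zero as the
minislot length `n` tends to infinity. -/
def IsSchemeRate {X Y Z : Type*} [Fintype X] [Fintype Y] [Fintype Z]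
    (ch : X → stdSimplex ℝ (Y × Z)) (L : ℕ) (R : ℝ) : Prop :=
  ∃ (M : ℕ) (S : ∀ n, Scheme X Y L M n),
    Tendsto (fun n => (S n).rate) atTop (𝓝 R) ∧
    ∀ N₁ : ℕ, ∃ k₀ : ℕ, ∀ k ≥ k₀,
      Tendsto (fun n => (S n).errorProb ch k) atTop (𝓝 0) ∧
      Tendsto (fun n => (S n).leakage ch N₁ k / (n : ℝ)) atTop (𝓝 0)

/-- The same with strong secrecy: the leakage itself tends to zero. -/
def IsStrongSchemeRate {X Y Z : Type*} [Fintype X] [Fintype Y] [Fintype Z]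
    (ch : X → stdSimplex ℝ (Y × Z)) (L : ℕ) (R : ℝ) : Prop :=
  ∃ (M : ℕ) (S : ∀ n, Scheme X Y L M n),
    Tendsto (fun n => (S n).rate) atTop (𝓝 R) ∧
    ∀ N₁ : ℕ, ∃ k₀ : ℕ, ∀ k ≥ k₀,
      Tendsto (fun n => (S n).errorProb ch k) atTop (𝓝 0) ∧
      Tendsto (fun n => (S n).leakage ch N₁ k) atTop (𝓝 0)

end

end WiretapKey

open WiretapKey

namespace WiretapKey

noncomputable section

/-! Secrecy. Following keys backwards from a message ends at a message sent by the wiretap code in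
some first minislot, its root. The buffer after slot `k` consists of the `k + 1` latest messages,
and every key is used once, so messages still in the buffer have different roots (`exists_root`).
Adding the same bit string to all messages of one chain leaves every XOR unchanged (`encrypt_shift`)
and alters the input of a single first minislot, that of the root. Hence, if Eve's wiretap output in
the root slots of a window is replaced by its average over a uniform message, the window becomes
independent of everything Eve sees, while Eve's marginal law stays the same. The Gibbs bound
`mutualInfo_le_of_density` prices this replacement at the expected log-likelihood ratio, which is
one `wLeak` per message of the window (`mutualInfo_window_le`). The window of `N₁ + 1` slots has at
most `(N₁ + 1) * (1 + L * M)` messages and lies in the buffer once `k` reaches this number, so the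
bound is uniform in `k` (`leakage_le`). Reliability is a union bound over all decodings up to slot
`k` (`errorProb_le`).

Existence of codes. Take a random codebook indexed by message and randomization. Bob recovers both
indices by a likelihood threshold (`exists_decoder_error_le`). With slightly more than `n I(X;Z)`
randomization bits, Eve's output law for each message is close in divergence to that of independent
inputs (`expected_divergence_le`). Both bounds involve exponential moments of the information
density, which are multiplicative in the block length (`moment_prod`) and whose derivative at zero
is the mutual information; both therefore decay exponentially. The leakage itself vanishes, so the
codes are strongly secret, and Wyner families follow. Expurgation gives the channel code its maximal
error bound.

Capacity. The rates `(R_s + C M)/(M + 1)` tend to `C`. Conversely, in a full slot the `1 + L M` new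
messages are uniform given the past, and Bob learns them through `(M + 1) n` channel uses; the weak
converse `success_mul_logb_le` bounds the rate by `C`. -/

/-! ### Indicators and finite sums -/

/-- The indicator of a proposition, as a real number. -/
def ind (p : Prop) : ℝ := by
  classical exact if p then 1 else 0

@[simp] theorem ind_true {p : Prop} (h : p) : ind p = 1 := by simp [ind, h]

@[simp] theorem ind_false {p : Prop} (h : ¬p) : ind p = 0 := by simp [ind, h]

theorem ind_nonneg (p : Prop) : 0 ≤ ind p := by
  by_cases h : p <;> simp [h]

theorem ind_mono {p q : Prop} (h : p → q) : ind p ≤ ind q := by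
  by_cases hp : p
  · simp [hp, h hp]
  · simpa [hp] using ind_nonneg q

theorem ind_and (p q : Prop) : ind (p ∧ q) = ind p * ind q := by
  by_cases hp : p <;> by_cases hq : q <;> simp [hp, hq]

theorem ind_not (p : Prop) : ind (¬p) = 1 - ind p := by
  by_cases hp : p <;> simp [hp]

theorem ind_or_le (p q : Prop) : ind (p ∨ q) ≤ ind p + ind q := by
  by_cases hp : p <;> by_cases hq : q <;> simp [hp, hq]

theorem ind_exists_le {ι : Type*} (s : Finset ι) (p : ι → Prop) :
    ind (∃ i ∈ s, p i) ≤ ∑ i ∈ s, ind (p i) := by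
  by_cases h : ∃ i ∈ s, p i
  · obtain ⟨i, hi, hp⟩ := h
    rw [ind_true ⟨i, hi, hp⟩, ← ind_true hp]
    exact Finset.single_le_sum (f := fun i => ind (p i)) (fun i _ => ind_nonneg _) hi
  · rw [ind_false h]
    exact Finset.sum_nonneg fun i _ => ind_nonneg _

theorem sum_ind_mul {A : Type*} [Fintype A] (a : A) (F : A → ℝ) :
    ∑ b, ind (a = b) * F b = F a := by
  classical
  simp [ind]

theorem sum_ind {A : Type*} [Fintype A] (a : A) : ∑ b, ind (a = b) = 1 := by
  simpa using sum_ind_mul a fun _ => 1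

theorem ind_funext {K : Type*} [Fintype K] {B : Type*} (a b : K → B) :
    ind (a = b) = ∏ j, ind (a j = b j) := by
  by_cases h : a = b
  · simp [h]
  · rw [ind_false h]
    obtain ⟨j, hj⟩ := Function.ne_iff.mp h
    exact (Finset.prod_eq_zero (Finset.mem_univ j) (ind_false hj)).symm

theorem prob_eq_sum {Ω : Type*} [Fintype Ω] (μ : Ω → ℝ) (E : Set Ω) :
    prob μ E = ∑ ω, ind (ω ∈ E) * μ ω := by
  classical
  simp [prob, Set.indicator, ind]

theorem law_eq_sum {Ω A : Type*} [Fintype Ω] (μ : Ω → ℝ) (f : Ω → A) (a : A) :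
    law μ f a = ∑ ω, ind (f ω = a) * μ ω := by
  simp [law, prob_eq_sum]

theorem sum_law_mul {Ω A : Type*} [Fintype Ω] [Fintype A] (μ : Ω → ℝ) (f : Ω → A) (F : A → ℝ) :
    ∑ a, law μ f a * F a = ∑ ω, μ ω * F (f ω) := by
  simp_rw [law_eq_sum, Finset.sum_mul]
  rw [Finset.sum_comm]
  refine Finset.sum_congr rfl fun ω _ => ?_
  rw [← sum_ind_mul (f ω) F, Finset.mul_sum]
  exact Finset.sum_congr rfl fun a _ => by ring

theorem law_nonneg {Ω A : Type*} [Fintype Ω] {μ : Ω → ℝ} (hμ : ∀ ω, 0 ≤ μ ω) (f : Ω → A) (a : A) :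
    0 ≤ law μ f a := by
  rw [law_eq_sum]
  exact Finset.sum_nonneg fun ω _ => mul_nonneg (ind_nonneg _) (hμ ω)

theorem le_law {Ω A : Type*} [Fintype Ω] {μ : Ω → ℝ} (hμ : ∀ ω, 0 ≤ μ ω) (f : Ω → A) (ω : Ω) :
    μ ω ≤ law μ f (f ω) := by
  rw [law_eq_sum]
  have := Finset.single_le_sum (f := fun ω' => ind (f ω' = f ω) * μ ω')
    (fun ω' _ => mul_nonneg (ind_nonneg _) (hμ ω')) (Finset.mem_univ ω)
  simpa using this

theorem sum_law {Ω A : Type*} [Fintype Ω] [Fintype A] (μ : Ω → ℝ) (f : Ω → A) :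
    ∑ a, law μ f a = ∑ ω, μ ω := by
  simpa using sum_law_mul μ f fun _ => 1

theorem law_fst {Ω A B : Type*} [Fintype Ω] [Fintype A] [Fintype B] (μ : Ω → ℝ) (f : Ω → A)
    (g : Ω → B) (a : A) : law μ f a = ∑ b, law μ (fun ω => (f ω, g ω)) (a, b) := by
  simp_rw [law_eq_sum]
  rw [Finset.sum_comm]
  refine Finset.sum_congr rfl fun ω _ => ?_
  simp_rw [Prod.mk.injEq, ind_and, mul_assoc]
  rw [← Finset.mul_sum, sum_ind_mul (g ω) fun _ => μ ω]

theorem law_snd {Ω A B : Type*} [Fintype Ω] [Fintype A] [Fintype B] (μ : Ω → ℝ) (f : Ω → A)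
    (g : Ω → B) (b : B) : law μ g b = ∑ a, law μ (fun ω => (f ω, g ω)) (a, b) := by
  simp_rw [law_eq_sum]
  rw [Finset.sum_comm]
  refine Finset.sum_congr rfl fun ω _ => ?_
  simp_rw [Prod.mk.injEq, ind_and, mul_assoc]
  rw [sum_ind_mul (f ω) fun _ => ind (g ω = b) * μ ω]

/-! ### Sums over product spaces. -/

section Pi

variable {K A B : Type*} [Fintype K] [DecidableEq K] [Fintype A] [Fintype B]

theorem sum_pi_prod (κ : K → A → ℝ) :
    ∑ a : K → A, ∏ j, κ j (a j) = ∏ j, ∑ a, κ j a := by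
  rw [Finset.prod_univ_sum, Fintype.piFinset_univ]

/-- The image of a product measure under a coordinatewise map is a product measure. -/
theorem sum_pi_comp (κ : K → A → ℝ) (h : A → B) (F : (K → B) → ℝ) :
    ∑ a : K → A, (∏ j, κ j (a j)) * F (fun j => h (a j)) =
      ∑ b : K → B, (∏ j, ∑ a, ind (h a = b j) * κ j a) * F b := by
  simp_rw [← sum_pi_prod, Finset.prod_mul_distrib, Finset.sum_mul]
  rw [Finset.sum_comm]
  refine Finset.sum_congr rfl fun a _ => ?_
  rw [← sum_ind_mul (fun j => h (a j)) F, Finset.mul_sum]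
  exact Finset.sum_congr rfl fun b _ => by rw [ind_funext]; ring

/-- The coordinates other than `i` integrate to one. -/
theorem sum_pi_eval (κ : K → A → ℝ) (h : ∀ j, ∑ a, κ j a = 1) (i : K) (φ : A → ℝ) :
    ∑ a : K → A, (∏ j, κ j (a j)) * φ (a i) = ∑ a, κ i a * φ a := by
  have e : ∀ a : K → A, (∏ j, κ j (a j)) * φ (a i) =
      ∏ j, (κ j (a j) * if j = i then φ (a j) else 1) := fun a => by
    rw [Finset.prod_mul_distrib]; simp
  simp_rw [e, sum_pi_prod fun j a => κ j a * if j = i then φ a else 1]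
  rw [Finset.prod_eq_single i]
  · simp
  · intro j _ hj
    simp [hj, h]
  · simp

/-- Pairwise independence of coordinates; this is all the independence between codewords that the
random coding bounds need. -/
theorem sum_pi_eval₂ (κ : K → A → ℝ) (h : ∀ j, ∑ a, κ j a = 1) {i i' : K} (hi : i ≠ i')
    (φ ψ : A → ℝ) :
    ∑ a : K → A, (∏ j, κ j (a j)) * (φ (a i) * ψ (a i')) =
      (∑ a, κ i a * φ a) * ∑ a, κ i' a * ψ a := by
  have e : ∀ a : K → A, (∏ j, κ j (a j)) * (φ (a i) * ψ (a i')) =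
      ∏ j, (κ j (a j) * (if j = i then φ (a j) else 1) * if j = i' then ψ (a j) else 1) :=
    fun a => by
      rw [Finset.prod_mul_distrib, Finset.prod_mul_distrib]; simp [mul_assoc]
  simp_rw [e, sum_pi_prod fun j a => κ j a * (if j = i then φ a else 1) *
    if j = i' then ψ a else 1]
  rw [Finset.prod_eq_mul i i' hi]
  · simp [hi, hi.symm]
  · intro j _ hj
    simp [hj.1, hj.2, h]
  · simp
  · simp

end Pi

/-- If `T` is invariant under translations that shift the readout `R`, then summing `T` over a
fibre of `R` gives the same fraction of the total for every fibre. -/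
theorem sum_fiber_of_translation {V U : Type*} [AddGroup V] [Fintype V] [AddGroup U] [Fintype U]
    (τ : U → V) (R : V → U) (T : V → ℝ) (hR : ∀ w s, R (w + τ s) = R w + s)
    (hT : ∀ w s, T (w + τ s) = T w) (d : U) :
    ∑ w, ind (R w = d) * T w = (Fintype.card U : ℝ)⁻¹ * ∑ w, T w := by
  have key : ∀ s : U, ∑ w, ind (R w = d) * T w = ∑ w, ind (R w + s = d) * T w := fun s => by
    rw [← Equiv.sum_comp (Equiv.addRight (τ s))]
    simp [hR, hT]
  have hU : (Fintype.card U : ℝ) ≠ 0 := by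
    exact_mod_cast Fintype.card_ne_zero
  rw [eq_inv_mul_iff_mul_eq₀ hU]
  have : (Fintype.card U : ℝ) * ∑ w, ind (R w = d) * T w =
      ∑ s : U, ∑ w, ind (R w + s = d) * T w := by
    simp_rw [← key]
    simp
  rw [this, Finset.sum_comm]
  refine Finset.sum_congr rfl fun w _ => ?_
  rw [← Finset.sum_mul]
  -- For each `w` exactly one translation moves the readout to `d`.
  have e : ∀ s, ind (R w + s = d) = ind (-R w + d = s) := fun s => by
    congr 1
    rw [← eq_neg_add_iff_add_eq, eq_iff_iff, eq_comm]
  simp_rw [e, sum_ind, one_mul]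

/-! ### Mutual information -/

theorem mutualInfo_eq_sum {Ω A B : Type*} [Fintype Ω] [Fintype A] [Fintype B]
    (μ : Ω → ℝ) (f : Ω → A) (g : Ω → B) :
    mutualInfo μ f g = ∑ ω, μ ω * Real.logb 2 (law μ (fun ω => (f ω, g ω)) (f ω, g ω) /
      (law μ f (f ω) * law μ g (g ω))) := by
  rw [← sum_law_mul μ (fun ω => (f ω, g ω)) fun ab =>
    Real.logb 2 (law μ (fun ω => (f ω, g ω)) ab / (law μ f ab.1 * law μ g ab.2)),
    Fintype.sum_prod_type]
  rfl

theorem logb_two_le {t : ℝ} (ht : 0 < t) : Real.logb 2 t ≤ (t - 1) / Real.log 2 := by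
  rw [Real.logb]
  exact div_le_div_of_nonneg_right (Real.log_le_sub_one_of_pos ht) (Real.log_nonneg one_le_two)

/-- From `log t ≤ t - 1`, each term is at least the joint mass minus the product mass, divided by
`log 2`, also where the joint mass vanishes. Both masses have total one. -/
theorem mutualInfo_nonneg {Ω A B : Type*} [Fintype Ω] [Fintype A] [Fintype B]
    {μ : Ω → ℝ} (hμ : μ ∈ stdSimplex ℝ Ω) (f : Ω → A) (g : Ω → B) : 0 ≤ mutualInfo μ f g := by
  have hl := Real.log_pos one_lt_two
  have hJ : ∀ ab, 0 ≤ law μ (fun ω => (f ω, g ω)) ab := law_nonneg hμ.1 _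
  have hf : ∀ a, 0 ≤ law μ f a := law_nonneg hμ.1 _
  have hg : ∀ b, 0 ≤ law μ g b := law_nonneg hμ.1 _
  have term : ∀ a b, (law μ (fun ω => (f ω, g ω)) (a, b) - law μ f a * law μ g b) / Real.log 2 ≤
      law μ (fun ω => (f ω, g ω)) (a, b) *
        Real.logb 2 (law μ (fun ω => (f ω, g ω)) (a, b) / (law μ f a * law μ g b)) := by
    intro a b
    rcases (hJ (a, b)).eq_or_lt with h0 | h0
    · rw [← h0]
      simp only [zero_sub, zero_mul]
      exact div_nonpos_of_nonpos_of_nonneg (neg_nonpos.mpr (mul_nonneg (hf a) (hg b))) hl.le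
    · have ha : 0 < law μ f a := h0.trans_le (by
        rw [law_fst μ f g]
        exact Finset.single_le_sum (f := fun b => law μ (fun ω => (f ω, g ω)) (a, b))
          (fun b _ => hJ (a, b)) (Finset.mem_univ b))
      have hb : 0 < law μ g b := h0.trans_le (by
        rw [law_snd μ f g]
        exact Finset.single_le_sum (f := fun a => law μ (fun ω => (f ω, g ω)) (a, b))
          (fun a _ => hJ (a, b)) (Finset.mem_univ a))
      have h1 := logb_two_le (t := (law μ f a * law μ g b) / law μ (fun ω => (f ω, g ω)) (a, b))
        (by positivity)
      rw [← inv_div (law μ f a * law μ g b), Real.logb_inv]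
      have h2 := mul_le_mul_of_nonneg_left h1 h0.le
      have h3 : law μ (fun ω => (f ω, g ω)) (a, b) *
          ((law μ f a * law μ g b / law μ (fun ω => (f ω, g ω)) (a, b) - 1) / Real.log 2) =
          -((law μ (fun ω => (f ω, g ω)) (a, b) - law μ f a * law μ g b) / Real.log 2) := by
        field_simp
        ring
      linarith
  refine le_trans ?_ (Finset.sum_le_sum fun a _ => Finset.sum_le_sum fun b _ => term a b)
  simp_rw [← Finset.sum_div, Finset.sum_sub_distrib, ← Finset.mul_sum, ← law_fst]
  rw [← Finset.sum_mul, sum_law, sum_law, hμ.2]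
  simp

/-- Gibbs' inequality: an upper bound on the mutual information by change of measure. -/
theorem mutualInfo_le_of_density {Ω A B : Type*} [Fintype Ω] [Fintype A] [Fintype B]
    {μ : Ω → ℝ} (hμ : μ ∈ stdSimplex ℝ Ω) (f : Ω → A) (g : Ω → B) (ρ : Ω → ℝ) (R : B → ℝ)
    (hρ : ∀ ω, 0 < μ ω → 0 < ρ ω) (hR : ∀ b, 0 ≤ R b) (hR1 : ∑ b, R b ≤ 1)
    (h : ∀ a b, ∑ ω, ind (f ω = a ∧ g ω = b) * (μ ω * ρ ω) ≤ law μ f a * R b) :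
    mutualInfo μ f g ≤ -∑ ω, μ ω * Real.logb 2 (ρ ω) := by
  have hl := Real.log_pos one_lt_two
  set J := law μ (fun ω => (f ω, g ω)) with hJ
  have hJ0 : ∀ ab, 0 ≤ J ab := law_nonneg hμ.1 _
  have hf : ∀ a, 0 ≤ law μ f a := law_nonneg hμ.1 _
  have hg : ∀ b, 0 ≤ law μ g b := law_nonneg hμ.1 _
  -- `r` is the density of the joint law with respect to the product law. The claim becomes that `E
  -- log (r ρ)` is nonpositive, for which `E (r ρ) ≤ 1` suffices.
  set r : A → B → ℝ := fun a b => J (a, b) / (law μ f a * law μ g b) with hr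
  have hr0 : ∀ a b, 0 ≤ r a b := fun a b => div_nonneg (hJ0 _) (mul_nonneg (hf a) (hg b))
  rw [mutualInfo_eq_sum, le_neg_iff_add_nonpos_right, ← Finset.sum_add_distrib]
  have term : ∀ ω, μ ω * Real.logb 2 (J (f ω, g ω) / (law μ f (f ω) * law μ g (g ω))) +
      μ ω * Real.logb 2 (ρ ω) ≤ (μ ω * ρ ω * r (f ω) (g ω) - μ ω) / Real.log 2 := by
    intro ω
    rcases (hμ.1 ω).eq_or_lt with h0 | h0
    · simp [← h0]
    · have p1 : 0 < J (f ω, g ω) := h0.trans_le (le_law hμ.1 (fun ω => (f ω, g ω)) ω)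
      have p2 : 0 < law μ f (f ω) := h0.trans_le (le_law hμ.1 f ω)
      have p3 : 0 < law μ g (g ω) := h0.trans_le (le_law hμ.1 g ω)
      have p4 : 0 < r (f ω) (g ω) := by simp only [hr]; positivity
      have p5 := hρ ω h0
      rw [← mul_add, ← Real.logb_mul p4.ne' p5.ne']
      have := mul_le_mul_of_nonneg_left (logb_two_le (mul_pos p4 p5)) h0.le
      calc _ ≤ _ := this
        _ = _ := by ring
  refine (Finset.sum_le_sum fun ω _ => term ω).trans ?_
  rw [← Finset.sum_div, Finset.sum_sub_distrib, hμ.2]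
  refine div_nonpos_of_nonpos_of_nonneg ?_ hl.le
  rw [sub_nonpos]
  have e : ∑ ω, μ ω * ρ ω * r (f ω) (g ω) =
      ∑ a, ∑ b, (∑ ω, ind (f ω = a ∧ g ω = b) * (μ ω * ρ ω)) * r a b := by
    simp_rw [Finset.sum_mul]
    rw [← Fintype.sum_prod_type', Finset.sum_comm]
    refine Finset.sum_congr rfl fun ω _ => ?_
    rw [← sum_ind_mul (f ω, g ω) fun ab : A × B => μ ω * ρ ω * r ab.1 ab.2]
    refine Finset.sum_congr rfl fun ab _ => ?_
    rw [← Prod.mk.injEq]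
    ring
  rw [e]
  calc _ ≤ ∑ a, ∑ b, R b * (J (a, b) / law μ g b) := by
        refine Finset.sum_le_sum fun a _ => Finset.sum_le_sum fun b _ => ?_
        refine (mul_le_mul_of_nonneg_right (h a b) (hr0 a b)).trans ?_
        rcases (hf a).eq_or_lt with h0 | h0
        · rw [← h0]
          simp only [zero_mul]
          exact mul_nonneg (hR b) (div_nonneg (hJ0 _) (hg b))
        · simp only [hr]
          rw [div_mul_eq_div_div_swap]
          apply le_of_eq
          field_simp
    _ = ∑ b, R b * (law μ g b / law μ g b) := by
        rw [Finset.sum_comm]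
        refine Finset.sum_congr rfl fun b _ => ?_
        rw [← Finset.mul_sum, ← Finset.sum_div, law_snd μ f g b]
    _ ≤ ∑ b, R b := Finset.sum_le_sum fun b _ => mul_le_of_le_one_right (hR b) (div_self_le_one _)
    _ ≤ 1 := hR1

/-! ### Abstract channels -/

section Chan

variable {A B : Type*} [Fintype A] [Fintype B]

/-- Output mass function of the channel `V` for the input mass function `P`. -/
def outLaw (P : A → ℝ) (V : A → B → ℝ) (b : B) : ℝ := ∑ a, P a * V a b

/-- Mutual information (in bits) between the input and the output of the channel `V`. -/
def info (P : A → ℝ) (V : A → B → ℝ) : ℝ :=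
  ∑ a, ∑ b, P a * V a b * Real.logb 2 (V a b / outLaw P V b)

/-- The input mass `P a` cancels in the density unless it is zero, in which case the term has no
weight. -/
theorem mutualInfo_eq_info {Ω : Type*} [Fintype Ω] {μ : Ω → ℝ} {f : Ω → A} {g : Ω → B}
    {P : A → ℝ} {V : A → B → ℝ} (hV : ∀ a, ∑ b, V a b = 1)
    (h : ∀ a b, law μ (fun ω => (f ω, g ω)) (a, b) = P a * V a b) :
    mutualInfo μ f g = info P V := by
  have hf : ∀ a, law μ f a = P a := fun a => by
    rw [law_fst μ f g]; simp_rw [h, ← Finset.mul_sum, hV, mul_one]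
  have hg : ∀ b, law μ g b = outLaw P V b := fun b => by
    rw [law_snd μ f g]; simp_rw [h]; rfl
  refine Finset.sum_congr rfl fun a _ => Finset.sum_congr rfl fun b _ => ?_
  rw [h, hf, hg]
  by_cases h0 : P a = 0
  · simp [h0]
  · rw [mul_div_mul_left _ _ h0]

variable {P : A → ℝ} {V : A → B → ℝ}

theorem outLaw_nonneg (hP : P ∈ stdSimplex ℝ A) (hV : ∀ a, V a ∈ stdSimplex ℝ B) (b : B) :
    0 ≤ outLaw P V b :=
  Finset.sum_nonneg fun a _ => mul_nonneg (hP.1 a) ((hV a).1 b)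

theorem le_outLaw (hP : P ∈ stdSimplex ℝ A) (hV : ∀ a, V a ∈ stdSimplex ℝ B) (a : A) (b : B) :
    P a * V a b ≤ outLaw P V b :=
  Finset.single_le_sum (f := fun a => P a * V a b)
    (fun a _ => mul_nonneg (hP.1 a) ((hV a).1 b)) (Finset.mem_univ a)

theorem outLaw_pos (hP : P ∈ stdSimplex ℝ A) (hV : ∀ a, V a ∈ stdSimplex ℝ B) {a : A} {b : B}
    (h : 0 < P a * V a b) : 0 < outLaw P V b :=
  h.trans_le (le_outLaw hP hV a b)

theorem sum_outLaw (hP : P ∈ stdSimplex ℝ A) (hV : ∀ a, V a ∈ stdSimplex ℝ B) :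
    ∑ b, outLaw P V b = 1 := by
  simp_rw [outLaw]
  rw [Finset.sum_comm]
  simp_rw [← Finset.mul_sum, fun a => (hV a).2, mul_one, hP.2]

theorem info_nonneg (hP : P ∈ stdSimplex ℝ A) (hV : ∀ a, V a ∈ stdSimplex ℝ B) :
    0 ≤ info P V := by
  have hμ : (fun ab : A × B => P ab.1 * V ab.1 ab.2) ∈ stdSimplex ℝ (A × B) := by
    refine ⟨fun ab => mul_nonneg (hP.1 _) ((hV _).1 _), ?_⟩
    rw [Fintype.sum_prod_type]
    simp_rw [← Finset.mul_sum, fun a => (hV a).2, mul_one, hP.2]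
  have e : mutualInfo (fun ab : A × B => P ab.1 * V ab.1 ab.2) Prod.fst Prod.snd = info P V := by
    refine mutualInfo_eq_info (fun a => (hV a).2) fun a b => ?_
    rw [law_eq_sum]
    simp_rw [Prod.mk.eta, eq_comm (b := (a, b))]
    exact sum_ind_mul (a, b) fun ab : A × B => P ab.1 * V ab.1 ab.2
  rw [← e]
  exact mutualInfo_nonneg hμ _ _

end Chan

/-! ### Exponential moments of the information density -/

section Moment

variable {A B : Type*} [Fintype A] [Fintype B]

/-- Exponential moment of order `t` of the information density of input and output. -/
def moment (P : A → ℝ) (V : A → B → ℝ) (t : ℝ) : ℝ :=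
  ∑ a, ∑ b, P a * V a b * (V a b / outLaw P V b) ^ t

variable {P : A → ℝ} {V : A → B → ℝ}

theorem moment_nonneg (hP : P ∈ stdSimplex ℝ A) (hV : ∀ a, V a ∈ stdSimplex ℝ B) (t : ℝ) :
    0 ≤ moment P V t :=
  Finset.sum_nonneg fun a _ => Finset.sum_nonneg fun b _ =>
    mul_nonneg (mul_nonneg (hP.1 a) ((hV a).1 b))
      (Real.rpow_nonneg (div_nonneg ((hV a).1 b) (outLaw_nonneg hP hV b)) t)

theorem moment_zero (hP : P ∈ stdSimplex ℝ A) (hV : ∀ a, V a ∈ stdSimplex ℝ B) :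
    moment P V 0 = 1 := by
  simp [moment, ← Finset.mul_sum, (hV _).2, hP.2]

/-- At `t = 0` the derivative of `u ^ t` is `log u`, so the moment has as derivative the mutual
information in nats. Pairs of zero mass contribute a constant zero, which avoids powers of zero. -/
theorem hasDerivAt_moment (hP : P ∈ stdSimplex ℝ A) (hV : ∀ a, V a ∈ stdSimplex ℝ B) :
    HasDerivAt (moment P V) (info P V * Real.log 2) 0 := by
  have e : info P V * Real.log 2 =
      ∑ a, ∑ b, P a * V a b * Real.log (V a b / outLaw P V b) := by
    simp_rw [info, Finset.sum_mul]
    refine Finset.sum_congr rfl fun a _ => Finset.sum_congr rfl fun b _ => ?_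
    rw [Real.logb, mul_assoc, div_mul_cancel₀ _ (Real.log_pos one_lt_two).ne']
  rw [e]
  refine HasDerivAt.fun_sum fun a _ => HasDerivAt.fun_sum fun b _ => ?_
  rcases (mul_nonneg (hP.1 a) ((hV a).1 b)).eq_or_lt with h0 | h0
  · simp only [← h0, zero_mul]
    exact hasDerivAt_const _ _
  · have hv : 0 < V a b := pos_of_mul_pos_right h0 (hP.1 a)
    have hu : 0 < V a b / outLaw P V b := div_pos hv (outLaw_pos hP hV h0)
    have := ((hasDerivAt_id (0 : ℝ)).const_rpow hu).const_mul (P a * V a b)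
    simpa using this

theorem exists_lt_of_hasDerivAt_neg {h : ℝ → ℝ} {d : ℝ} (hd : d < 0) (hh : HasDerivAt h d 0) :
    ∃ t, 0 < t ∧ t ≤ 1 ∧ h t < h 0 := by
  have h1 := (hasDerivAt_iff_tendsto_slope.mp hh).eventually (gt_mem_nhds hd)
  have h2 : ∀ᶠ t in 𝓝[>] (0 : ℝ), slope h 0 t < 0 :=
    h1.filter_mono (nhdsWithin_mono _ fun t ht => ne_of_gt ht)
  obtain ⟨t, ht, ht2, ht3⟩ := (h2.and (Ioc_mem_nhdsGT (zero_lt_one (α := ℝ)))).exists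
  refine ⟨t, ht2, ht3, ?_⟩
  rw [slope_def_field, sub_zero, div_neg_iff] at ht
  rcases ht with ht | ht
  · linarith [ht.2]
  · linarith [ht.1]

/-- Chernoff exponent for Eve: the product equals one at `t = 0` and has derivative `(info - R) log
2` there, which is negative. The range `t ≤ 1` is what the resolvability bound requires. -/
theorem exists_moment_lt_of_info_lt (hP : P ∈ stdSimplex ℝ A) (hV : ∀ a, V a ∈ stdSimplex ℝ B)
    {R : ℝ} (hR : info P V < R) :
    ∃ t, 0 < t ∧ t ≤ 1 ∧ (2 : ℝ) ^ (-(t * R)) * moment P V t < 1 := by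
  have h1 : HasDerivAt (fun t : ℝ => (2 : ℝ) ^ (-(t * R))) (-(Real.log 2 * R)) 0 := by
    have := (((hasDerivAt_id (0 : ℝ)).mul_const R).neg).const_rpow (zero_lt_two (α := ℝ))
    simpa using this
  have h2 := h1.mul (hasDerivAt_moment hP hV)
  simp only [moment_zero hP hV, zero_mul, neg_zero, Real.rpow_zero, one_mul, mul_one] at h2
  obtain ⟨t, h3, h4, h5⟩ := exists_lt_of_hasDerivAt_neg
    (by nlinarith [Real.log_pos one_lt_two]) h2
  refine ⟨t, h3, h4, ?_⟩
  simpa [moment_zero hP hV] using h5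

/-- The same exponent for the lower tail, used for Bob: the derivative at zero is now `(R - info)
log 2`. -/
theorem exists_moment_lt_of_lt_info (hP : P ∈ stdSimplex ℝ A) (hV : ∀ a, V a ∈ stdSimplex ℝ B)
    {R : ℝ} (hR : R < info P V) :
    ∃ t, 0 < t ∧ t ≤ 1 ∧ (2 : ℝ) ^ (t * R) * moment P V (-t) < 1 := by
  have h1 : HasDerivAt (fun t : ℝ => (2 : ℝ) ^ (t * R)) (Real.log 2 * R) 0 := by
    have := ((hasDerivAt_id (0 : ℝ)).mul_const R).const_rpow (zero_lt_two (α := ℝ))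
    simpa using this
  have h0 : HasDerivAt (fun t : ℝ => moment P V (-t)) (-(info P V * Real.log 2)) 0 := by
    have := HasDerivAt.scomp (0 : ℝ) (g₁ := moment P V) (h := fun t => -t)
      (g₁' := info P V * Real.log 2) (by simpa using hasDerivAt_moment hP hV) (hasDerivAt_neg 0)
    simpa [Function.comp_def] using this
  have h2 := h1.mul h0
  simp only [moment_zero hP hV, zero_mul, neg_zero, Real.rpow_zero, one_mul, mul_one] at h2
  obtain ⟨t, h3, h4, h5⟩ := exists_lt_of_hasDerivAt_neg
    (by nlinarith [Real.log_pos one_lt_two]) h2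
  refine ⟨t, h3, h4, ?_⟩
  simpa [moment_zero hP hV] using h5

end Moment

/-! ### Product channels -/

section Prod

set_option linter.unusedSectionVars false

variable {ι X Y : Type*} [Fintype ι] [DecidableEq ι] [Fintype X] [Fintype Y]

/-- The law of independent inputs. -/
def prodLaw (p : X → ℝ) (x : ι → X) : ℝ := ∏ i, p (x i)

/-- The memoryless extension of a channel. -/
def prodChan (v : X → Y → ℝ) (x : ι → X) (y : ι → Y) : ℝ := ∏ i, v (x i) (y i)

theorem prodLaw_mem {p : X → ℝ} (hp : p ∈ stdSimplex ℝ X) :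
    (prodLaw p : (ι → X) → ℝ) ∈ stdSimplex ℝ (ι → X) := by
  refine ⟨fun x => Finset.prod_nonneg fun i _ => hp.1 _, ?_⟩
  simp_rw [prodLaw, sum_pi_prod fun _ : ι => p, hp.2, Finset.prod_const_one]

theorem prodChan_mem {v : X → Y → ℝ} (hv : ∀ x, v x ∈ stdSimplex ℝ Y) (x : ι → X) :
    prodChan v x ∈ stdSimplex ℝ (ι → Y) := by
  refine ⟨fun y => Finset.prod_nonneg fun i _ => (hv _).1 _, ?_⟩
  simp_rw [prodChan, sum_pi_prod fun i y => v (x i) y, fun x => (hv x).2, Finset.prod_const_one]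

theorem outLaw_prod (p : X → ℝ) (v : X → Y → ℝ) (y : ι → Y) :
    outLaw (prodLaw p) (prodChan v) y = ∏ i, outLaw p v (y i) := by
  simp_rw [outLaw, prodLaw, prodChan, ← Finset.prod_mul_distrib,
    sum_pi_prod fun i a => p a * v a (y i)]

/-- Independent inputs have a product output law, so the information density is a product over the
coordinates. -/
theorem moment_prod {p : X → ℝ} {v : X → Y → ℝ} (hp : p ∈ stdSimplex ℝ X)
    (hv : ∀ x, v x ∈ stdSimplex ℝ Y) (t : ℝ) :
    moment (prodLaw p : (ι → X) → ℝ) (prodChan v) t = moment p v t ^ Fintype.card ι := by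
  have e : ∀ (x : ι → X) (y : ι → Y),
      prodLaw p x * prodChan v x y * (prodChan v x y / outLaw (prodLaw p) (prodChan v) y) ^ t =
        ∏ i, (p (x i) * v (x i) (y i) * (v (x i) (y i) / outLaw p v (y i)) ^ t) := by
    intro x y
    rw [outLaw_prod, prodLaw, prodChan, ← Finset.prod_div_distrib,
      ← Real.finsetProd_rpow _ _ fun i _ =>
        div_nonneg ((hv _).1 _) (outLaw_nonneg hp hv _),
      ← Finset.prod_mul_distrib, ← Finset.prod_mul_distrib]
  simp_rw [moment, e,
    fun x : ι → X => sum_pi_prod fun i b => p (x i) * v (x i) b * (v (x i) b / outLaw p v b) ^ t,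
    sum_pi_prod fun (_ : ι) a => ∑ b, p a * v a b * (v a b / outLaw p v b) ^ t,
    Finset.prod_const, Finset.card_univ]

end Prod

/-! ### Random coding -/

section RandomCoding

variable {A B : Type*} [Fintype A] [Fintype B] {P : A → ℝ} {V : A → B → ℝ}

/-- Averaging over a random codebook: threshold decoding of a memoryless random code. -/
theorem exists_decoder_error_le {I : Type*} [Fintype I] [DecidableEq I] [Nonempty I]
    (hP : P ∈ stdSimplex ℝ A) (hV : ∀ a, V a ∈ stdSimplex ℝ B) {γ ρ : ℝ} (hγ : 0 < γ)
    (hρ : 0 < ρ) :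
    ∃ dec : (I → A) → B → I,
      ∑ c : I → A, prodLaw P c *
        ((Fintype.card I : ℝ)⁻¹ * ∑ i, ∑ b, V (c i) b * ind (dec c b ≠ i)) ≤
      γ ^ ρ * moment P V (-ρ) + Fintype.card I / γ := by
  classical
  -- The decoder picks any index above the threshold `γ * outLaw P V b`. An error then means that
  -- the true codeword misses the threshold or that another codeword passes it.
  have hdec : ∀ (c : I → A) (b : B), ∃ i : I, ∀ j : I, i ≠ j →
      V (c j) b ≤ γ * outLaw P V b ∨ ∃ j' ∈ Finset.univ.erase j, γ * outLaw P V b < V (c j') b := by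
    intro c b
    by_cases h : ∃ i, γ * outLaw P V b < V (c i) b
    · obtain ⟨i, hi⟩ := h
      exact ⟨i, fun j hij => Or.inr ⟨i, by simp [hij], hi⟩⟩
    · push Not at h
      exact ⟨Classical.arbitrary I, fun j _ => Or.inl (h j)⟩
  choose dec hdec using hdec
  refine ⟨dec, ?_⟩
  have hI : (0 : ℝ) < Fintype.card I := by exact_mod_cast Fintype.card_pos
  have hQ := outLaw_nonneg hP hV
  -- On this event `γ * outLaw P V b / V a b` is at least one, hence so is its power `ρ`.
  have hE1 : ∑ a, ∑ b, P a * (V a b * ind (V a b ≤ γ * outLaw P V b)) ≤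
      γ ^ ρ * moment P V (-ρ) := by
    simp_rw [moment, Finset.mul_sum]
    refine Finset.sum_le_sum fun a _ => Finset.sum_le_sum fun b _ => ?_
    rcases (mul_nonneg (hP.1 a) ((hV a).1 b)).eq_or_lt with h0 | h0
    · rw [← mul_assoc, ← h0]; simp
    · have hv : 0 < V a b := pos_of_mul_pos_right h0 (hP.1 a)
      have hq := outLaw_pos hP hV h0
      by_cases hle : V a b ≤ γ * outLaw P V b
      · rw [ind_true hle, mul_one, mul_left_comm]
        refine le_mul_of_one_le_right h0.le ?_
        rw [Real.rpow_neg (by positivity), ← Real.inv_rpow (by positivity), inv_div,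
          ← Real.mul_rpow hγ.le (by positivity)]
        refine Real.one_le_rpow ?_ hρ.le
        rw [← mul_div_assoc, one_le_div hv]
        exact hle
      · rw [ind_false hle]
        simp only [mul_zero]
        positivity
  -- A competing codeword is independent of the output. Above the threshold the output mass is at
  -- most `V a b / γ`.
  have hE2 : ∑ b, outLaw P V b * ∑ a, P a * ind (γ * outLaw P V b < V a b) ≤ 1 / γ := by
    calc _ ≤ ∑ b, ∑ a, P a * V a b / γ := by
          refine Finset.sum_le_sum fun b _ => ?_
          rw [Finset.mul_sum]
          refine Finset.sum_le_sum fun a _ => ?_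
          by_cases hlt : γ * outLaw P V b < V a b
          · rw [ind_true hlt, mul_one, mul_comm, mul_div_assoc]
            refine mul_le_mul_of_nonneg_left ?_ (hP.1 a)
            rw [le_div_iff₀ hγ, mul_comm]
            exact hlt.le
          · rw [ind_false hlt]
            simp only [mul_zero]
            exact div_nonneg (mul_nonneg (hP.1 a) ((hV a).1 b)) hγ.le
      _ = 1 / γ := by
          rw [← sum_outLaw hP hV, Finset.sum_div]
          simp_rw [outLaw, Finset.sum_div]
  have hone : ∀ i, ∑ c : I → A, prodLaw P c * ∑ b, V (c i) b * ind (dec c b ≠ i) ≤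
      γ ^ ρ * moment P V (-ρ) + ((Fintype.card I : ℝ) - 1) / γ := by
    intro i
    have step : ∀ c : I → A, ∑ b, V (c i) b * ind (dec c b ≠ i) ≤
        ∑ b, V (c i) b * ind (V (c i) b ≤ γ * outLaw P V b) +
        ∑ j ∈ Finset.univ.erase i, ∑ b, V (c i) b * ind (γ * outLaw P V b < V (c j) b) := by
      intro c
      rw [Finset.sum_comm, ← Finset.sum_add_distrib]
      refine Finset.sum_le_sum fun b _ => ?_
      rw [← Finset.mul_sum, ← mul_add]
      refine mul_le_mul_of_nonneg_left ?_ ((hV _).1 b)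
      exact (ind_mono (hdec c b i)).trans
        ((ind_or_le _ _).trans (add_le_add_right (ind_exists_le _ _) _))
    have h1 : ∑ c : I → A, prodLaw P c * ∑ b, V (c i) b * ind (V (c i) b ≤ γ * outLaw P V b) =
        ∑ a, ∑ b, P a * (V a b * ind (V a b ≤ γ * outLaw P V b)) := by
      simp_rw [← Finset.mul_sum]
      exact sum_pi_eval (fun _ => P) (fun _ => hP.2) i
        fun a => ∑ b, V a b * ind (V a b ≤ γ * outLaw P V b)
    have h2 : ∀ j ∈ Finset.univ.erase i, ∑ c : I → A, prodLaw P c *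
        ∑ b, V (c i) b * ind (γ * outLaw P V b < V (c j) b) =
        ∑ b, outLaw P V b * ∑ a, P a * ind (γ * outLaw P V b < V a b) := by
      intro j hj
      simp_rw [Finset.mul_sum (s := (Finset.univ : Finset B))]
      rw [Finset.sum_comm]
      refine Finset.sum_congr rfl fun b _ => ?_
      exact sum_pi_eval₂ (fun _ => P) (fun _ => hP.2) (Finset.ne_of_mem_erase hj).symm
        (fun a => V a b) fun a => ind (γ * outLaw P V b < V a b)
    calc _ ≤ ∑ c : I → A, prodLaw P c * (∑ b, V (c i) b * ind (V (c i) b ≤ γ * outLaw P V b) +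
          ∑ j ∈ Finset.univ.erase i, ∑ b, V (c i) b * ind (γ * outLaw P V b < V (c j) b)) :=
          Finset.sum_le_sum fun c _ => mul_le_mul_of_nonneg_left (step c) ((prodLaw_mem hP).1 c)
      _ = ∑ a, ∑ b, P a * (V a b * ind (V a b ≤ γ * outLaw P V b)) +
          ∑ j ∈ Finset.univ.erase i, ∑ b, outLaw P V b *
            ∑ a, P a * ind (γ * outLaw P V b < V a b) := by
          simp_rw [mul_add, Finset.sum_add_distrib, h1,
            Finset.mul_sum (s := Finset.univ.erase i)]
          rw [Finset.sum_comm (t := Finset.univ.erase i), Finset.sum_congr rfl h2]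
      _ ≤ _ := by
          refine add_le_add hE1 ?_
          rw [Finset.sum_const, Finset.card_erase_of_mem (Finset.mem_univ i), nsmul_eq_mul,
            Finset.card_univ, Nat.cast_pred Fintype.card_pos, div_eq_mul_one_div]
          refine mul_le_mul_of_nonneg_left hE2 ?_
          rw [sub_nonneg]
          exact_mod_cast Fintype.card_pos (α := I)
  calc _ = (Fintype.card I : ℝ)⁻¹ * ∑ i, ∑ c : I → A, prodLaw P c *
        ∑ b, V (c i) b * ind (dec c b ≠ i) := by
        rw [Finset.sum_comm, Finset.mul_sum]
        refine Finset.sum_congr rfl fun c _ => ?_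
        rw [← Finset.mul_sum]
        ring
    _ ≤ (Fintype.card I : ℝ)⁻¹ * ∑ i : I,
        (γ ^ ρ * moment P V (-ρ) + ((Fintype.card I : ℝ) - 1) / γ) := by
        gcongr with i _
        exact hone i
    _ = γ ^ ρ * moment P V (-ρ) + ((Fintype.card I : ℝ) - 1) / γ := by
        rw [Finset.sum_const, Finset.card_univ, nsmul_eq_mul, inv_mul_cancel_left₀ hI.ne']
    _ ≤ _ := by gcongr; linarith

/-- The output mass function of a channel whose input is uniform on the family `e`. -/
def avgChan {J : Type*} [Fintype J] (E : A → B → ℝ) (e : J → A) (z : B) : ℝ :=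
  (Fintype.card J : ℝ)⁻¹ * ∑ j, E (e j) z

/-- Channel resolvability in relative entropy, averaged over the random codebook. -/
theorem expected_divergence_le {W J : Type*} [Fintype W] [DecidableEq W] [Fintype J]
    [DecidableEq J] [Nonempty J] (hP : P ∈ stdSimplex ℝ A) (hV : ∀ a, V a ∈ stdSimplex ℝ B)
    {τ : ℝ} (hτ : 0 < τ) (hτ1 : τ ≤ 1) (w : W) :
    ∑ c : W × J → A, prodLaw P c * ∑ z, avgChan V (fun j => c (w, j)) z *
        Real.log (avgChan V (fun j => c (w, j)) z / outLaw P V z) ≤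
      1 / τ * ((Fintype.card J : ℝ) ^ (-τ) * moment P V τ) := by
  have hQ := outLaw_nonneg hP hV
  have hJ : (0 : ℝ) < Fintype.card J := by exact_mod_cast Fintype.card_pos
  set K : ℝ := (Fintype.card J : ℝ) with hK
  set u : A → B → ℝ := fun a z => V a z / (K * outLaw P V z) with hu
  have hu0 : ∀ a z, 0 ≤ u a z := fun a z => div_nonneg ((hV a).1 z) (mul_nonneg hJ.le (hQ z))
  have hratio : ∀ (c : W × J → A) z, avgChan V (fun j => c (w, j)) z / outLaw P V z =
      ∑ j, u (c (w, j)) z := by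
    intro c z
    rw [avgChan, ← Finset.sum_div, mul_comm K, ← div_div, inv_mul_eq_div, div_right_comm]
  have hPu : ∀ z, 0 < outLaw P V z → ∑ a, P a * u a z = K⁻¹ := by
    intro z hz
    simp_rw [hu, ← mul_div_assoc]
    rw [← Finset.sum_div]
    change outLaw P V z / _ = _
    field_simp
  -- Jensen's inequality over the other codewords in pointwise form: the logarithm lies below its
  -- tangent at `1 + u (c (w, j)) z`. The other codewords have expected total `(K - 1) / K ≤ 1`, so
  -- the linear correction has nonpositive mean.
  have tangent : ∀ (c : W × J → A) z, 0 < outLaw P V z → ∀ j,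
      V (c (w, j)) z * Real.log (∑ j', u (c (w, j')) z) ≤
        V (c (w, j)) z * Real.log (1 + u (c (w, j)) z) +
        (∑ j' ∈ Finset.univ.erase j, V (c (w, j)) z / (1 + u (c (w, j)) z) * u (c (w, j')) z -
          V (c (w, j)) z / (1 + u (c (w, j)) z)) := by
    intro c z hz j
    have hs := Finset.add_sum_erase Finset.univ (fun j' => u (c (w, j')) z) (Finset.mem_univ j)
    rcases ((hV (c (w, j))).1 z).eq_or_lt with h0 | h0
    · simp [← h0]
    · have hp : 0 < u (c (w, j)) z := div_pos h0 (mul_pos hJ hz)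
      have hr : 0 ≤ ∑ j' ∈ Finset.univ.erase j, u (c (w, j')) z :=
        Finset.sum_nonneg fun _ _ => hu0 _ _
      have ht : 0 < ∑ j', u (c (w, j')) z := by linarith
      have h1 : 0 < 1 + u (c (w, j)) z := by linarith
      have hlog := Real.log_le_sub_one_of_pos (div_pos ht h1)
      rw [Real.log_div ht.ne' h1.ne'] at hlog
      have := mul_le_mul_of_nonneg_left hlog h0.le
      have e : V (c (w, j)) z * ((∑ j', u (c (w, j')) z) / (1 + u (c (w, j)) z) - 1) =
          (∑ j' ∈ Finset.univ.erase j, V (c (w, j)) z / (1 + u (c (w, j)) z) * u (c (w, j')) z -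
          V (c (w, j)) z / (1 + u (c (w, j)) z)) := by
        rw [← Finset.mul_sum, ← hs]
        field_simp
        ring
      rw [e] at this
      linarith
  -- Combines subadditivity of `x ^ τ`, which needs `τ ≤ 1`, with `log x ≤ x - 1` at `x = (1 + u) ^
  -- τ`.
  have hlogle : ∀ a z, Real.log (1 + u a z) ≤ 1 / τ * u a z ^ τ := by
    intro a z
    have h1 : (1 + u a z) ^ τ ≤ 1 ^ τ + u a z ^ τ :=
      Real.rpow_add_le_add_rpow zero_le_one (hu0 a z) hτ.le hτ1
    rw [Real.one_rpow] at h1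
    have h2 : τ * Real.log (1 + u a z) ≤ u a z ^ τ := by
      rw [← Real.log_rpow (by linarith [hu0 a z])]
      have := Real.log_le_sub_one_of_pos
        (Real.rpow_pos_of_pos (by linarith [hu0 a z] : 0 < 1 + u a z) τ)
      linarith
    rw [one_div, ← div_eq_inv_mul, le_div_iff₀ hτ, mul_comm]
    exact h2
  have hz : ∀ z, ∑ c : W × J → A, prodLaw P c * (avgChan V (fun j => c (w, j)) z *
      Real.log (avgChan V (fun j => c (w, j)) z / outLaw P V z)) ≤
      ∑ a, P a * (V a z * (1 / τ * u a z ^ τ)) := by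
    intro z
    have hrhs : 0 ≤ ∑ a, P a * (V a z * (1 / τ * u a z ^ τ)) :=
      Finset.sum_nonneg fun a _ => mul_nonneg (hP.1 a) (mul_nonneg ((hV a).1 z)
        (mul_nonneg (by positivity) (Real.rpow_nonneg (hu0 a z) τ)))
    rcases (hQ z).eq_or_lt with h0 | h0
    · refine le_trans (le_of_eq ?_) hrhs
      simp [← h0]
    · have hj : ∀ j, ∑ c : W × J → A, prodLaw P c *
          (V (c (w, j)) z * Real.log (∑ j', u (c (w, j')) z)) ≤
          ∑ a, P a * (V a z * (1 / τ * u a z ^ τ)) := by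
        intro j
        have h1 : ∑ c : W × J → A, prodLaw P c *
            (V (c (w, j)) z * Real.log (1 + u (c (w, j)) z)) =
            ∑ a, P a * (V a z * Real.log (1 + u a z)) :=
          sum_pi_eval (fun _ => P) (fun _ => hP.2) (w, j) fun a => V a z * Real.log (1 + u a z)
        have h2 : ∑ c : W × J → A, prodLaw P c * (V (c (w, j)) z / (1 + u (c (w, j)) z)) =
            ∑ a, P a * (V a z / (1 + u a z)) :=
          sum_pi_eval (fun _ => P) (fun _ => hP.2) (w, j) fun a => V a z / (1 + u a z)
        have h3 : ∀ j' ∈ Finset.univ.erase j, ∑ c : W × J → A, prodLaw P c *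
            (V (c (w, j)) z / (1 + u (c (w, j)) z) * u (c (w, j')) z) =
            (∑ a, P a * (V a z / (1 + u a z))) * K⁻¹ := by
          intro j' hj'
          rw [← hPu z h0]
          exact sum_pi_eval₂ (fun _ : W × J => P) (fun _ => hP.2)
            (fun h => Finset.ne_of_mem_erase hj' (congrArg Prod.snd h).symm)
            (fun a => V a z / (1 + u a z)) fun a => u a z
        have hpos : 0 ≤ ∑ a, P a * (V a z / (1 + u a z)) :=
          Finset.sum_nonneg fun a _ => mul_nonneg (hP.1 a)
            (div_nonneg ((hV a).1 z) (by linarith [hu0 a z]))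
        calc _ ≤ ∑ c : W × J → A, prodLaw P c * (V (c (w, j)) z * Real.log (1 + u (c (w, j)) z) +
              (∑ j' ∈ Finset.univ.erase j,
                V (c (w, j)) z / (1 + u (c (w, j)) z) * u (c (w, j')) z -
              V (c (w, j)) z / (1 + u (c (w, j)) z))) :=
              Finset.sum_le_sum fun c _ =>
                mul_le_mul_of_nonneg_left (tangent c z h0 j) ((prodLaw_mem hP).1 c)
          _ = ∑ a, P a * (V a z * Real.log (1 + u a z)) +
              ((K - 1) * ((∑ a, P a * (V a z / (1 + u a z))) * K⁻¹) -
                ∑ a, P a * (V a z / (1 + u a z))) := by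
              simp_rw [mul_add, mul_sub, Finset.sum_add_distrib, Finset.sum_sub_distrib, h1, h2,
                Finset.mul_sum (s := Finset.univ.erase j)]
              rw [Finset.sum_comm (t := Finset.univ.erase j), Finset.sum_congr rfl h3,
                Finset.sum_const, Finset.card_erase_of_mem (Finset.mem_univ j), nsmul_eq_mul,
                Finset.card_univ, Nat.cast_pred Fintype.card_pos]
          _ ≤ ∑ a, P a * (V a z * Real.log (1 + u a z)) := by
              have : (K - 1) * ((∑ a, P a * (V a z / (1 + u a z))) * K⁻¹) =
                  (∑ a, P a * (V a z / (1 + u a z))) -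
                    (∑ a, P a * (V a z / (1 + u a z))) * K⁻¹ := by
                field_simp
              rw [this]
              have : 0 ≤ (∑ a, P a * (V a z / (1 + u a z))) * K⁻¹ :=
                mul_nonneg hpos (inv_nonneg.mpr hJ.le)
              linarith
          _ ≤ _ := Finset.sum_le_sum fun a _ => mul_le_mul_of_nonneg_left
              (mul_le_mul_of_nonneg_left (hlogle a z) ((hV a).1 z)) (hP.1 a)
      calc _ = K⁻¹ * ∑ j, ∑ c : W × J → A, prodLaw P c *
            (V (c (w, j)) z * Real.log (∑ j', u (c (w, j')) z)) := by
            rw [Finset.sum_comm, Finset.mul_sum]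
            refine Finset.sum_congr rfl fun c _ => ?_
            rw [hratio, avgChan, ← Finset.mul_sum, ← Finset.sum_mul]
            ring
        _ ≤ K⁻¹ * ∑ j : J, ∑ a, P a * (V a z * (1 / τ * u a z ^ τ)) := by
            gcongr with j _
            exact hj j
        _ = _ := by
            rw [Finset.sum_const, Finset.card_univ, nsmul_eq_mul, inv_mul_cancel_left₀ hJ.ne']
  calc _ = ∑ z, ∑ c : W × J → A, prodLaw P c * (avgChan V (fun j => c (w, j)) z *
      Real.log (avgChan V (fun j => c (w, j)) z / outLaw P V z)) := by
        rw [Finset.sum_comm]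
        simp_rw [Finset.mul_sum]
    _ ≤ ∑ z, ∑ a, P a * (V a z * (1 / τ * u a z ^ τ)) := Finset.sum_le_sum fun z _ => hz z
    _ = _ := by
        rw [Finset.sum_comm, moment]
        simp_rw [Finset.mul_sum]
        refine Finset.sum_congr rfl fun a _ => Finset.sum_congr rfl fun z _ => ?_
        have : u a z ^ τ = K ^ (-τ) * (V a z / outLaw P V z) ^ τ := by
          simp only [hu]
          rw [mul_comm K, ← div_div, Real.div_rpow (div_nonneg ((hV a).1 z) (hQ z)) hJ.le,
            Real.rpow_neg hJ.le]
          ring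
        rw [this]
        ring

/-- The positive mass of the chosen point is needed later: it makes every codeword have positive
probability, so that Eve's output law is absolutely continuous with respect to the reference law. -/
theorem exists_le_of_average_le {C : Type*} [Fintype C] {μ F : C → ℝ} {t : ℝ}
    (hμ : μ ∈ stdSimplex ℝ C) (h : ∑ c, μ c * F c ≤ t) : ∃ c, 0 < μ c ∧ F c ≤ t := by
  by_contra! hc
  have hs : ∑ c, μ c * t < ∑ c, μ c * F c := by
    obtain ⟨c, _, hpos⟩ : ∃ c ∈ Finset.univ, 0 < μ c := by
      by_contra! hn
      have := Finset.sum_nonpos hn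
      rw [hμ.2] at this
      linarith
    refine Finset.sum_lt_sum (fun c _ => ?_) ⟨c, Finset.mem_univ c, ?_⟩
    · rcases (hμ.1 c).eq_or_lt with h0 | h0
      · simp [← h0]
      · exact mul_le_mul_of_nonneg_left (hc c h0).le h0.le
    · exact mul_lt_mul_of_pos_left (hc c hpos) hpos
  rw [← Finset.sum_mul, hμ.2] at hs
  linarith

/-- A codebook with small average error for Bob whose subcodes all look like independent inputs to
Eve. -/
theorem exists_wiretap_codebook {Z W J : Type*} [Fintype Z] [Fintype W] [DecidableEq W]
    [Fintype J] [DecidableEq J] [Nonempty W] [Nonempty J] {E : A → Z → ℝ}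
    (hP : P ∈ stdSimplex ℝ A) (hV : ∀ a, V a ∈ stdSimplex ℝ B) (hE : ∀ a, E a ∈ stdSimplex ℝ Z)
    {γ ρ τ : ℝ} (hγ : 0 < γ) (hρ : 0 < ρ) (hτ : 0 < τ) (hτ1 : τ ≤ 1) :
    ∃ (c : W × J → A) (dec : B → W × J), (∀ i, 0 < P (c i)) ∧
      (Fintype.card (W × J) : ℝ)⁻¹ * ∑ i, ∑ b, V (c i) b * ind (dec b ≠ i) +
        (Fintype.card W : ℝ)⁻¹ * ∑ w, ∑ z, avgChan E (fun j => c (w, j)) z *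
          Real.log (avgChan E (fun j => c (w, j)) z / outLaw P E z) ≤
      γ ^ ρ * moment P V (-ρ) + Fintype.card (W × J) / γ +
        1 / τ * ((Fintype.card J : ℝ) ^ (-τ) * moment P E τ) := by
  obtain ⟨dec, hdec⟩ := exists_decoder_error_le (I := W × J) hP hV hγ hρ
  have hW : (Fintype.card W : ℝ) ≠ 0 := by exact_mod_cast Fintype.card_ne_zero
  have hdiv : ∑ c : W × J → A, prodLaw P c * ((Fintype.card W : ℝ)⁻¹ * ∑ w, ∑ z,
      avgChan E (fun j => c (w, j)) z *
        Real.log (avgChan E (fun j => c (w, j)) z / outLaw P E z)) ≤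
      1 / τ * ((Fintype.card J : ℝ) ^ (-τ) * moment P E τ) := by
    calc _ = (Fintype.card W : ℝ)⁻¹ * ∑ w, ∑ c : W × J → A, prodLaw P c * ∑ z,
          avgChan E (fun j => c (w, j)) z *
            Real.log (avgChan E (fun j => c (w, j)) z / outLaw P E z) := by
          rw [Finset.sum_comm, Finset.mul_sum]
          refine Finset.sum_congr rfl fun c _ => ?_
          rw [← Finset.mul_sum]
          ring
      _ ≤ (Fintype.card W : ℝ)⁻¹ * ∑ w : W,
          1 / τ * ((Fintype.card J : ℝ) ^ (-τ) * moment P E τ) := by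
          gcongr with w _
          exact expected_divergence_le hP hE hτ hτ1 w
      _ = _ := by
          rw [Finset.sum_const, Finset.card_univ, nsmul_eq_mul, inv_mul_cancel_left₀ hW]
  -- The two averages are added before a codebook is chosen, so a single codebook serves Bob and
  -- limits Eve.
  have hsum := add_le_add hdec hdiv
  simp_rw [← Finset.sum_add_distrib, ← mul_add] at hsum
  obtain ⟨c, hc, hle⟩ := exists_le_of_average_le (prodLaw_mem hP) hsum
  refine ⟨c, dec c, fun i => (hP.1 _).lt_of_ne fun h0 => hc.ne' ?_, hle⟩
  exact Finset.prod_eq_zero (Finset.mem_univ i) h0.symm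

/-- A deterministic code with small maximal error probability, by expurgation. -/
theorem exists_maximal_error_code {T : Type*} [Fintype T] [Nonempty T]
    (hP : P ∈ stdSimplex ℝ A) (hV : ∀ a, V a ∈ stdSimplex ℝ B) {γ ρ : ℝ} (hγ : 0 < γ)
    (hρ : 0 < ρ) :
    ∃ (enc : T → A) (dec : B → T), ∀ t, ∑ b, V (enc t) b * ind (dec b ≠ t) ≤
      2 * (γ ^ ρ * moment P V (-ρ) + 2 * Fintype.card T / γ) := by
  classical
  -- The factor `Bool` provides twice as many codewords as needed; the worse half is discarded.
  obtain ⟨dec, hdec⟩ := exists_decoder_error_le (I := T × Bool) hP hV hγ hρ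
  obtain ⟨c, -, hc⟩ := exists_le_of_average_le (prodLaw_mem hP) hdec
  set ε : ℝ := γ ^ ρ * moment P V (-ρ) + Fintype.card (T × Bool) / γ with hε
  have hcard : (Fintype.card (T × Bool) : ℝ) = 2 * Fintype.card T := by
    simp [mul_comm]
  have hT : (0 : ℝ) < Fintype.card T := by exact_mod_cast Fintype.card_pos
  set err : T × Bool → ℝ := fun i => ∑ b, V (c i) b * ind (dec c b ≠ i) with herr
  have herr0 : ∀ i, 0 ≤ err i := fun i =>
    Finset.sum_nonneg fun b _ => mul_nonneg ((hV _).1 b) (ind_nonneg _)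
  have hε0 : 0 < ε := by
    have := mul_nonneg (Real.rpow_nonneg hγ.le ρ) (moment_nonneg hP hV (-ρ))
    have : 0 < (Fintype.card (T × Bool) : ℝ) / γ := by rw [hcard]; positivity
    positivity
  -- Markov's inequality: if more than half of the codewords had error above `2 * ε`, the average
  -- would exceed `ε`.
  have hgood : Fintype.card T ≤ Fintype.card {i // err i ≤ 2 * ε} := by
    by_contra! hlt
    rw [Fintype.card_subtype] at hlt
    have hb : Fintype.card T < (Finset.univ.filter fun i => ¬err i ≤ 2 * ε).card := by
      have h1 := Finset.card_filter_add_card_filter_not (s := Finset.univ)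
        (fun i : T × Bool => err i ≤ 2 * ε)
      rw [Finset.card_univ, Fintype.card_prod, Fintype.card_bool] at h1
      omega
    have h2 : ((Finset.univ.filter fun i => ¬err i ≤ 2 * ε).card : ℝ) * (2 * ε) ≤
        ∑ i, err i := by
      rw [← nsmul_eq_mul, ← Finset.sum_const]
      refine (Finset.sum_le_sum fun i hi => ?_).trans
        (Finset.sum_le_sum_of_subset_of_nonneg (Finset.filter_subset _ _) fun i _ _ => herr0 i)
      exact (not_le.mp (Finset.mem_filter.mp hi).2).le
    have h3 : ∑ i, err i ≤ 2 * Fintype.card T * ε := by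
      rw [hcard, inv_mul_le_iff₀ (by positivity)] at hc
      exact hc
    have h4 : (Fintype.card T : ℝ) < (Finset.univ.filter fun i => ¬err i ≤ 2 * ε).card := by
      exact_mod_cast hb
    nlinarith
  obtain ⟨f⟩ := Function.Embedding.nonempty_of_card_le hgood
  refine ⟨fun t => c (f t).1, fun b => Function.invFun (fun t => (f t).1) (dec c b), fun t => ?_⟩
  have hinj : Function.Injective fun t => (f t).1 := Subtype.val_injective.comp f.injective
  refine le_trans (Finset.sum_le_sum fun b _ => mul_le_mul_of_nonneg_left
    (ind_mono (q := dec c b ≠ (f t).1) fun h h' => h ?_) ((hV _).1 b)) ?_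
  · simp only [h']
    exact Function.leftInverse_invFun hinj t
  · refine (f t).2.trans (le_of_eq ?_)
    rw [hε, hcard]

end RandomCoding

/-! ### Mutual information and divergence from a reference law. -/

section

variable {A B : Type*} [Fintype A] [Fintype B] {P : A → ℝ} {V : A → B → ℝ}

/-- Mutual information is at most the average divergence from any reference output law. -/
theorem info_le_divergence (hP : P ∈ stdSimplex ℝ A) (hV : ∀ a, V a ∈ stdSimplex ℝ B)
    {R : B → ℝ} (hR : R ∈ stdSimplex ℝ B) (hpos : ∀ a b, 0 < P a * V a b → 0 < R b) :
    info P V ≤ ∑ a, P a * ∑ b, V a b * Real.logb 2 (V a b / R b) := by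
  have hl := Real.log_pos one_lt_two
  have term : ∀ a b, P a * V a b * Real.logb 2 (V a b / outLaw P V b) -
      P a * V a b * Real.logb 2 (V a b / R b) ≤
      (P a * V a b * (R b / outLaw P V b) - P a * V a b) / Real.log 2 := by
    intro a b
    rcases (mul_nonneg (hP.1 a) ((hV a).1 b)).eq_or_lt with h0 | h0
    · simp [← h0]
    · have hv : 0 < V a b := pos_of_mul_pos_right h0 (hP.1 a)
      have hq := outLaw_pos hP hV h0
      have hr := hpos a b h0
      rw [← mul_sub, Real.logb_div hv.ne' hq.ne', Real.logb_div hv.ne' hr.ne']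
      have h1 := mul_le_mul_of_nonneg_left (logb_two_le (div_pos hr hq)) h0.le
      rw [Real.logb_div hr.ne' hq.ne'] at h1
      calc _ = P a * V a b * (Real.logb 2 (R b) - Real.logb 2 (outLaw P V b)) := by ring
        _ ≤ _ := h1
        _ = _ := by ring
  have hsum := Finset.sum_le_sum fun a (_ : a ∈ Finset.univ) =>
    Finset.sum_le_sum fun b (_ : b ∈ Finset.univ) => term a b
  simp_rw [Finset.sum_sub_distrib, ← Finset.sum_div, Finset.sum_sub_distrib,
    ← Finset.mul_sum, fun a => (hV a).2, mul_one] at hsum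
  rw [hP.2] at hsum
  have h2 : ∑ a, ∑ b, P a * V a b * (R b / outLaw P V b) ≤ 1 := by
    rw [Finset.sum_comm]
    simp_rw [← Finset.sum_mul]
    calc _ ≤ ∑ b, R b := Finset.sum_le_sum fun b _ => by
          change outLaw P V b * _ ≤ _
          rw [mul_div_left_comm]
          exact mul_le_of_le_one_right (hR.1 b) (div_self_le_one _)
      _ = 1 := hR.2
  have h3 : (∑ a, ∑ b, P a * V a b * (R b / outLaw P V b) - 1) / Real.log 2 ≤ 0 :=
    div_nonpos_of_nonpos_of_nonneg (by linarith) hl.le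
  simp_rw [Finset.mul_sum, ← mul_assoc]
  simp only [info]
  linarith

end

/-! ### The two marginal channels -/

section Channel

variable {X Y Z : Type*} [Fintype X] [Fintype Y] [Fintype Z] (ch : X → stdSimplex ℝ (Y × Z))

/-- The channel from Alice to Bob. -/
def bobChan (x : X) (y : Y) : ℝ := ∑ z, ch x (y, z)

/-- The channel from Alice to Eve. -/
def eveChan (x : X) (z : Z) : ℝ := ∑ y, ch x (y, z)

omit [Fintype X] in
theorem bobChan_mem (x : X) : bobChan ch x ∈ stdSimplex ℝ Y := by
  refine ⟨fun y => Finset.sum_nonneg fun z _ => (ch x).2.1 _, ?_⟩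
  rw [← (ch x).2.2, Fintype.sum_prod_type]
  rfl

omit [Fintype X] in
theorem eveChan_mem (x : X) : eveChan ch x ∈ stdSimplex ℝ Z := by
  refine ⟨fun y => Finset.sum_nonneg fun z _ => (ch x).2.1 _, ?_⟩
  rw [← (ch x).2.2, Fintype.sum_prod_type_right]
  rfl

omit [Fintype X] in
theorem sum_ind_fst (x : X) (y : Y) : ∑ o, ind (o.1 = y) * ch x o = bobChan ch x y := by
  rw [Fintype.sum_prod_type]
  simp_rw [← Finset.mul_sum, eq_comm (b := y)]
  exact sum_ind_mul y fun y => ∑ z, ch x (y, z)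

omit [Fintype X] in
theorem sum_ind_snd (x : X) (z : Z) : ∑ o, ind (o.2 = z) * ch x o = eveChan ch x z := by
  rw [Fintype.sum_prod_type_right]
  simp_rw [← Finset.mul_sum, eq_comm (b := z)]
  exact sum_ind_mul z fun z => ∑ y, ch x (y, z)

theorem infoBob_eq (p : stdSimplex ℝ X) : infoBob ch p = info p (bobChan ch) := by
  refine mutualInfo_eq_info (fun x => (bobChan_mem ch x).2) fun x y => ?_
  rw [law_eq_sum, Fintype.sum_prod_type, ← sum_ind_mul x fun x => p x * bobChan ch x y]
  refine Finset.sum_congr rfl fun x' _ => ?_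
  rw [← sum_ind_fst, Finset.mul_sum, Finset.mul_sum]
  refine Finset.sum_congr rfl fun o _ => ?_
  simp only [channelJoint, Prod.mk.injEq, ind_and, eq_comm (a := x)]
  ring

theorem infoEve_eq (p : stdSimplex ℝ X) : infoEve ch p = info p (eveChan ch) := by
  refine mutualInfo_eq_info (fun x => (eveChan_mem ch x).2) fun x z => ?_
  rw [law_eq_sum, Fintype.sum_prod_type, ← sum_ind_mul x fun x => p x * eveChan ch x z]
  refine Finset.sum_congr rfl fun x' _ => ?_
  rw [← sum_ind_snd, Finset.mul_sum, Finset.mul_sum]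
  refine Finset.sum_congr rfl fun o _ => ?_
  simp only [channelJoint, Prod.mk.injEq, ind_and, eq_comm (a := x)]
  ring

section Block

variable {ι : Type*} [Fintype ι]

omit [Fintype X] in
theorem blockProb_nonneg (x : ι → X) (o : ι → Y × Z) : 0 ≤ blockProb ch x o :=
  Finset.prod_nonneg fun i _ => (ch (x i)).2.1 _

variable [DecidableEq ι]

-- Bob's marginal of a memoryless block is again memoryless, so functions of his output can be
-- averaged with `bobChan` alone.
omit [Fintype X] in
theorem sum_blockProb_fst (x : ι → X) (F : (ι → Y) → ℝ) :
    ∑ o, blockProb ch x o * F (fun i => (o i).1) = ∑ y, prodChan (bobChan ch) x y * F y := by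
  simp_rw [blockProb, sum_pi_comp (fun i o => ch (x i) o) Prod.fst F, sum_ind_fst]
  rfl

omit [Fintype X] in
theorem sum_blockProb_snd (x : ι → X) (F : (ι → Z) → ℝ) :
    ∑ o, blockProb ch x o * F (fun i => (o i).2) = ∑ z, prodChan (eveChan ch) x z * F z := by
  simp_rw [blockProb, sum_pi_comp (fun i o => ch (x i) o) Prod.snd F, sum_ind_snd]
  rfl

omit [Fintype X] in
theorem sum_blockProb (x : ι → X) : ∑ o, blockProb ch x o = 1 := by
  simp_rw [blockProb, sum_pi_prod fun i o => ch (x i) o]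
  exact Finset.prod_eq_one fun i _ => (ch (x i)).2.2

end Block

/-! ### Component codes -/

variable {b n : ℕ}

theorem card_bits (b : ℕ) : Fintype.card (Bits b) = 2 ^ b := by
  simp

theorem uniform_bits_mem (b : ℕ) : (fun _ => 1 / 2 ^ b) ∈ stdSimplex ℝ (Bits b) := by
  refine ⟨fun _ => by positivity, ?_⟩
  rw [Finset.sum_const, Finset.card_univ, card_bits, nsmul_eq_mul]
  push_cast
  field_simp

/-- Error probability of a stochastic code at Bob, for a uniform message. -/
def encError (enc : Bits b → stdSimplex ℝ (Fin n → X)) (dec : (Fin n → Y) → Bits b) : ℝ :=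
  ∑ m, 1 / 2 ^ b * ∑ x, enc m x * ∑ y, prodChan (bobChan ch) x y * ind (dec y ≠ m)

/-- The channel from the message to Eve that is created by a stochastic encoder. -/
def encEve (enc : Bits b → stdSimplex ℝ (Fin n → X)) (m : Bits b) (z : Fin n → Z) : ℝ :=
  ∑ x, enc m x * prodChan (eveChan ch) x z

theorem encEve_mem (enc : Bits b → stdSimplex ℝ (Fin n → X)) (m : Bits b) :
    encEve ch enc m ∈ stdSimplex ℝ (Fin n → Z) := by
  refine ⟨fun z => Finset.sum_nonneg fun x _ => mul_nonneg ((enc m).2.1 x)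
    ((prodChan_mem (eveChan_mem ch) x).1 z), ?_⟩
  simp_rw [encEve]
  rw [Finset.sum_comm]
  simp_rw [← Finset.mul_sum, fun x : Fin n → X => (prodChan_mem (eveChan_mem ch) x).2, mul_one]
  exact (enc m).2.2

namespace Scheme

variable {L M : ℕ}

theorem wError_eq (S : Scheme X Y L M n) : S.wError ch = encError ch S.wEnc S.wDec := by
  rw [wError, prob_eq_sum, Fintype.sum_prod_type, encError]
  refine Finset.sum_congr rfl fun m _ => ?_
  rw [Fintype.sum_prod_type, Finset.mul_sum]
  refine Finset.sum_congr rfl fun x _ => ?_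
  rw [← sum_blockProb_fst ch x fun y => ind (S.wDec y ≠ m), Finset.mul_sum, Finset.mul_sum]
  refine Finset.sum_congr rfl fun o _ => ?_
  simp only [wJoint, Set.mem_ofPred_eq]
  ring

theorem wJoint_mem (S : Scheme X Y L M n) : S.wJoint ch ∈ stdSimplex ℝ _ := by
  refine ⟨fun ω => mul_nonneg (mul_nonneg (by positivity) ((S.wEnc _).2.1 _))
    (blockProb_nonneg ch _ _), ?_⟩
  simp_rw [Fintype.sum_prod_type, wJoint, ← Finset.mul_sum, sum_blockProb, mul_one]
  refine Eq.trans (Finset.sum_congr rfl fun m _ => ?_) (uniform_bits_mem S.bits).2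
  rw [← Finset.mul_sum]
  exact (congrArg (1 / 2 ^ S.bits * ·) (S.wEnc m).2.2).trans (mul_one _)

theorem law_wJoint (S : Scheme X Y L M n) (m : Bits S.bits) (z : Fin n → Z) :
    law (S.wJoint ch) (fun ω => (ω.1, fun i => (ω.2.2 i).2)) (m, z) =
      1 / 2 ^ S.bits * encEve ch S.wEnc m z := by
  rw [law_eq_sum, Fintype.sum_prod_type,
    ← sum_ind_mul m fun m => 1 / 2 ^ S.bits * encEve ch S.wEnc m z]
  refine Finset.sum_congr rfl fun m' _ => ?_
  rw [Fintype.sum_prod_type, encEve, Finset.mul_sum, Finset.mul_sum]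
  refine Finset.sum_congr rfl fun x _ => ?_
  rw [← sum_ind_mul z fun z => prodChan (eveChan ch) x z]
  have := sum_blockProb_snd ch x fun z' => ind (z' = z)
  simp_rw [eq_comm (a := z), mul_comm (ind (_ = z))]
  rw [← this, Finset.mul_sum, Finset.mul_sum, Finset.mul_sum]
  refine Finset.sum_congr rfl fun o _ => ?_
  simp only [wJoint, Prod.mk.injEq, ind_and, eq_comm (a := m)]
  ring

theorem wLeak_eq (S : Scheme X Y L M n) :
    S.wLeak ch = info (fun _ => 1 / 2 ^ S.bits) (encEve ch S.wEnc) :=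
  mutualInfo_eq_info (fun m => (encEve_mem ch S.wEnc m).2) (S.law_wJoint ch)

theorem wLeak_nonneg (S : Scheme X Y L M n) : 0 ≤ S.wLeak ch :=
  mutualInfo_nonneg (S.wJoint_mem ch) _ _

theorem wError_nonneg (S : Scheme X Y L M n) : 0 ≤ S.wError ch := by
  rw [wError, prob_eq_sum]
  exact Finset.sum_nonneg fun ω _ => mul_nonneg (ind_nonneg _) ((S.wJoint_mem ch).1 ω)

theorem prob_cDec (S : Scheme X Y L M n) (t t' : Fin (L * M) → Bits S.bits) :
    prob (blockProb ch (S.cEnc t)) {o | S.cDec (fun i => (o i).1) ≠ t'} =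
      ∑ y, prodChan (bobChan ch) (S.cEnc t) y * ind (S.cDec y ≠ t') := by
  rw [prob_eq_sum, ← sum_blockProb_fst ch (S.cEnc t) fun y => ind (S.cDec y ≠ t')]
  exact Finset.sum_congr rfl fun o _ => mul_comm _ _

theorem prob_le_cError (S : Scheme X Y L M n) (t : Fin (L * M) → Bits S.bits) :
    prob (blockProb ch (S.cEnc t)) {o | S.cDec (fun i => (o i).1) ≠ t} ≤ S.cError ch :=
  le_ciSup (f := fun t => prob (blockProb ch (S.cEnc t)) {o | S.cDec (fun i => (o i).1) ≠ t})
    (Set.finite_range _).bddAbove t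

theorem cError_nonneg (S : Scheme X Y L M n) : 0 ≤ S.cError ch := by
  refine le_trans ?_ (S.prob_le_cError ch 0)
  rw [prob_eq_sum]
  exact Finset.sum_nonneg fun ω _ => mul_nonneg (ind_nonneg _) (blockProb_nonneg ch _ _)

end Scheme

/-- The encoder that picks a uniformly random codeword of a subcode. -/
def uniformEnc {J : Type*} [Fintype J] [Nonempty J] (c : Bits b × J → Fin n → X) (m : Bits b) :
    stdSimplex ℝ (Fin n → X) :=
  ⟨fun x => (Fintype.card J : ℝ)⁻¹ * ∑ j, ind (c (m, j) = x),
    fun x => mul_nonneg (by positivity) (Finset.sum_nonneg fun j _ => ind_nonneg _), by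
      rw [← Finset.mul_sum, Finset.sum_comm]
      simp_rw [sum_ind]
      rw [Finset.sum_const, Finset.card_univ, nsmul_eq_mul, mul_one, inv_mul_cancel₀]
      exact_mod_cast Fintype.card_ne_zero⟩

theorem sum_uniformEnc {J : Type*} [Fintype J] [Nonempty J] (c : Bits b × J → Fin n → X)
    (m : Bits b) (F : (Fin n → X) → ℝ) :
    ∑ x, uniformEnc c m x * F x = (Fintype.card J : ℝ)⁻¹ * ∑ j, F (c (m, j)) := by
  change ∑ x, (Fintype.card J : ℝ)⁻¹ * (∑ j, ind (c (m, j) = x)) * F x = _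
  simp_rw [mul_assoc, Finset.sum_mul]
  rw [← Finset.mul_sum, Finset.sum_comm]
  simp_rw [sum_ind_mul]

/-- One-shot achievability for the wiretap channel with message length `b` and `r` bits of
randomization. -/
theorem exists_wiretap_code (p : stdSimplex ℝ X) (b r n : ℕ) {γ ρ τ : ℝ} (hγ : 0 < γ)
    (hρ : 0 < ρ) (hτ : 0 < τ) (hτ1 : τ ≤ 1) :
    ∃ (enc : Bits b → stdSimplex ℝ (Fin n → X)) (dec : (Fin n → Y) → Bits b),
      encError ch enc dec + Real.log 2 * info (fun _ => 1 / 2 ^ b) (encEve ch enc) ≤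
      γ ^ ρ * moment p (bobChan ch) (-ρ) ^ n + 2 ^ (b + r) / γ +
        1 / τ * (((2 : ℝ) ^ r) ^ (-τ) * moment p (eveChan ch) τ ^ n) := by
  obtain ⟨c, dec, hc, hle⟩ := exists_wiretap_codebook (W := Bits b) (J := Bits r)
    (prodLaw_mem (ι := Fin n) p.2) (prodChan_mem (bobChan_mem ch)) (prodChan_mem (eveChan_mem ch))
    hγ hρ hτ hτ1
  rw [moment_prod p.2 (bobChan_mem ch), moment_prod p.2 (eveChan_mem ch), Fintype.card_fin,
    Fintype.card_prod, card_bits, card_bits] at hle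
  push_cast at hle
  rw [pow_add]
  -- Bob's decoder also finds the randomization index, which is dropped; this can only lower the
  -- error.
  refine ⟨uniformEnc c, fun y => (dec y).1, le_trans (add_le_add ?_ ?_) hle⟩
  · rw [encError, Fintype.sum_prod_type, mul_inv, mul_assoc, Finset.mul_sum, Finset.mul_sum]
    refine Finset.sum_le_sum fun m _ => ?_
    rw [sum_uniformEnc c m fun x => ∑ y, prodChan (bobChan ch) x y * ind ((dec y).1 ≠ m),
      card_bits, one_div]
    push_cast
    gcongr with j _ y _
    · exact (prodChan_mem (bobChan_mem ch) _).1 y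
    · refine ind_mono fun h h' => h ?_
      rw [h']
  · have hE : ∀ m, encEve ch (uniformEnc c) m =
        avgChan (prodChan (eveChan ch)) fun j => c (m, j) := fun m => by
      funext z
      exact sum_uniformEnc c m fun x => prodChan (eveChan ch) x z
    have hQ : outLaw (prodLaw p) (prodChan (eveChan ch)) ∈ stdSimplex ℝ (Fin n → Z) :=
      ⟨outLaw_nonneg (prodLaw_mem p.2) (prodChan_mem (eveChan_mem ch)),
        sum_outLaw (prodLaw_mem p.2) (prodChan_mem (eveChan_mem ch))⟩
    -- The reference law is Eve's output for independent inputs. It is positive wherever needed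
    -- because every codeword has positive input probability.
    have := info_le_divergence (uniform_bits_mem b) (encEve_mem ch (uniformEnc c)) hQ (by
      intro m z h
      have h1 : encEve ch (uniformEnc c) m z ≠ 0 := fun h0 => by simp [h0] at h
      rw [hE, avgChan] at h1
      obtain ⟨j, -, hj⟩ := Finset.exists_ne_zero_of_sum_ne_zero (right_ne_zero_of_mul h1)
      refine outLaw_pos (prodLaw_mem p.2) (prodChan_mem (eveChan_mem ch)) (a := c (m, j)) ?_
      exact mul_pos (hc _) (((prodChan_mem (eveChan_mem ch) _).1 z).lt_of_ne hj.symm))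
    refine (mul_le_mul_of_nonneg_left this (Real.log_nonneg one_le_two)).trans (le_of_eq ?_)
    rw [Finset.mul_sum, Finset.mul_sum]
    refine Finset.sum_congr rfl fun m _ => ?_
    rw [hE, one_div, mul_left_comm, Finset.mul_sum]
    congr 1
    refine Finset.sum_congr rfl fun z _ => ?_
    rw [Real.logb, mul_left_comm, mul_div_cancel₀ _ (Real.log_pos one_lt_two).ne']
    rfl

/-- A real supremum over an empty family is zero. -/
theorem nonempty_of_secrecyCapacity_pos (h : 0 < secrecyCapacity ch) :
    Nonempty (stdSimplex ℝ X) := by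
  by_contra hn
  rw [not_nonempty_iff] at hn
  simp [secrecyCapacity, Real.iSup_of_isEmpty] at h

theorem eventually_wiretap_code {R ε : ℝ} (hR : 0 < R) (hRs : R < secrecyCapacity ch)
    (hε : 0 < ε) :
    ∀ᶠ n : ℕ in atTop, ∃ (enc : Bits ⌊(n : ℝ) * R⌋₊ → stdSimplex ℝ (Fin n → X))
      (dec : (Fin n → Y) → Bits ⌊(n : ℝ) * R⌋₊),
      encError ch enc dec ≤ ε ∧ info (fun _ => 1 / 2 ^ ⌊(n : ℝ) * R⌋₊) (encEve ch enc) ≤ ε := by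
  have := nonempty_of_secrecyCapacity_pos ch (hR.trans hRs)
  obtain ⟨p, hp⟩ := exists_lt_of_lt_ciSup hRs
  rw [infoBob_eq, infoEve_eq] at hp
  set IB := info p (bobChan ch)
  set IE := info p (eveChan ch)
  have hIE : 0 ≤ IE := info_nonneg p.2 (eveChan_mem ch)
  -- One third of the gap goes to Bob's threshold, one third to the randomization rate, and the last
  -- makes the union bound decay.
  set δ := (IB - IE - R) / 3 with hδ
  have hδ0 : 0 < δ := by rw [hδ]; linarith
  obtain ⟨ρ, hρ, -, hα⟩ := exists_moment_lt_of_lt_info p.2 (bobChan_mem ch)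
    (show IB - δ < IB by linarith)
  obtain ⟨τ, hτ, hτ1, hβ⟩ := exists_moment_lt_of_info_lt p.2 (eveChan_mem ch)
    (show IE < IE + δ by linarith)
  set α := (2 : ℝ) ^ (ρ * (IB - δ)) * moment p (bobChan ch) (-ρ)
  set β := (2 : ℝ) ^ (-(τ * (IE + δ))) * moment p (eveChan ch) τ
  have hα0 : 0 ≤ α := mul_nonneg (by positivity) (moment_nonneg p.2 (bobChan_mem ch) _)
  have hβ0 : 0 ≤ β := mul_nonneg (by positivity) (moment_nonneg p.2 (eveChan_mem ch) _)
  set κ := (2 : ℝ) ^ (-δ)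
  have hκ1 : κ < 1 := Real.rpow_lt_one_of_one_lt_of_neg one_lt_two (by linarith)
  have hlim : Tendsto (fun n : ℕ => α ^ n + 2 * κ ^ n + 1 / τ * β ^ n) atTop (𝓝 0) := by
    have := ((tendsto_pow_atTop_nhds_zero_of_lt_one hα0 hα).add
      ((tendsto_pow_atTop_nhds_zero_of_lt_one (by positivity) hκ1).const_mul 2)).add
      ((tendsto_pow_atTop_nhds_zero_of_lt_one hβ0 hβ).const_mul (1 / τ))
    simpa using this
  have hl2 := Real.log_pos one_lt_two
  have hl21 : Real.log 2 ≤ 1 := by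
    have := Real.log_le_sub_one_of_pos (zero_lt_two (α := ℝ))
    linarith
  filter_upwards [hlim.eventually (gt_mem_nhds (mul_pos hl2 hε))] with n hn
  set b := ⌊(n : ℝ) * R⌋₊
  -- The total `b + r` is at most `n (IB - 2δ) + 1`. Against the threshold `2 ^ (n (IB - δ))` this
  -- leaves `2 κ ^ n`, the factor 2 coming from the ceiling.
  set r := ⌈(n : ℝ) * (IE + δ)⌉₊
  have hb : (b : ℝ) ≤ n * R := Nat.floor_le (by positivity)
  have hr : (r : ℝ) < n * (IE + δ) + 1 := Nat.ceil_lt_add_one (by positivity)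
  have hr' : (n : ℝ) * (IE + δ) ≤ r := Nat.le_ceil _
  obtain ⟨enc, dec, h⟩ := exists_wiretap_code ch p b r n
    (γ := (2 : ℝ) ^ ((n : ℝ) * (IB - δ))) (by positivity) hρ hτ hτ1
  have t1 : ((2 : ℝ) ^ ((n : ℝ) * (IB - δ))) ^ ρ * moment p (bobChan ch) (-ρ) ^ n = α ^ n := by
    rw [mul_pow, ← Real.rpow_natCast ((2 : ℝ) ^ (ρ * (IB - δ))), ← Real.rpow_mul zero_le_two,
      ← Real.rpow_mul zero_le_two]
    ring_nf
  have t2 : (2 : ℝ) ^ (b + r) / (2 : ℝ) ^ ((n : ℝ) * (IB - δ)) ≤ 2 * κ ^ n := by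
    rw [← Real.rpow_natCast, ← Real.rpow_sub zero_lt_two, ← Real.rpow_natCast κ,
      ← Real.rpow_mul zero_le_two]
    nth_rw 2 [← Real.rpow_one (2 : ℝ)]
    rw [← Real.rpow_add zero_lt_two]
    refine Real.rpow_le_rpow_of_exponent_le one_le_two ?_
    push_cast
    have : R = IB - IE - 3 * δ := by rw [hδ]; ring
    rw [this] at hb
    nlinarith
  have t3 : ((2 : ℝ) ^ r) ^ (-τ) * moment p (eveChan ch) τ ^ n ≤ β ^ n := by
    rw [mul_pow]
    refine mul_le_mul_of_nonneg_right ?_ (pow_nonneg (moment_nonneg p.2 (eveChan_mem ch) _) n)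
    rw [← Real.rpow_natCast, ← Real.rpow_natCast, ← Real.rpow_mul zero_le_two,
      ← Real.rpow_mul zero_le_two]
    refine Real.rpow_le_rpow_of_exponent_le one_le_two ?_
    nlinarith
  have h4 : encError ch enc dec + Real.log 2 * info (fun _ => 1 / 2 ^ b) (encEve ch enc) ≤
      Real.log 2 * ε := by
    refine (h.trans ?_).trans hn.le
    rw [t1]
    gcongr
  have h5 : 0 ≤ encError ch enc dec :=
    Finset.sum_nonneg fun m _ => mul_nonneg (by positivity) (Finset.sum_nonneg fun x _ =>
      mul_nonneg ((enc m).2.1 x) (Finset.sum_nonneg fun y _ =>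
        mul_nonneg ((prodChan_mem (bobChan_mem ch) x).1 y) (ind_nonneg _)))
  -- Both parts of the sum are nonnegative, so each obeys the joint bound; `log 2 ≤ 1` removes the
  -- factor for the error.
  have h6 := info_nonneg (uniform_bits_mem b) (encEve_mem ch enc)
  refine ⟨enc, dec, ?_, ?_⟩
  · nlinarith
  · refine le_of_mul_le_mul_left ?_ hl2
    linarith

theorem eventually_channel_code {R ε : ℝ} (hR : 0 < R) (L M : ℕ)
    (hRC : L * R < mainCapacity ch) (hX : Nonempty (stdSimplex ℝ X)) (hε : 0 < ε) :
    ∀ᶠ n : ℕ in atTop, ∃ (enc : (Fin (L * M) → Bits ⌊(n : ℝ) * R⌋₊) → (Fin M × Fin n → X))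
      (dec : (Fin M × Fin n → Y) → (Fin (L * M) → Bits ⌊(n : ℝ) * R⌋₊)), ∀ t,
      ∑ y, prodChan (bobChan ch) (enc t) y * ind (dec y ≠ t) ≤ ε := by
  -- Without keyed minislots there is one empty message and no error. The case is separate because
  -- the exponents `M * n` must tend to infinity below.
  rcases Nat.eq_zero_or_pos M with hM | hM
  · subst hM
    refine Eventually.of_forall fun n => ⟨fun _ i => i.1.elim0, fun _ => 0, fun t => ?_⟩
    refine le_trans (le_of_eq (Finset.sum_eq_zero fun y _ => ?_)) hε.le
    rw [ind_false, mul_zero]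
    rw [not_not]
    funext i
    exact absurd i.2 (by simp)
  obtain ⟨p, hp⟩ := exists_lt_of_lt_ciSup hRC
  rw [infoBob_eq] at hp
  have hp2 : ⇑p ∈ stdSimplex ℝ X := p.2
  set IB := info p (bobChan ch)
  set δ := (IB - L * R) / 2 with hδ
  have hδ0 : 0 < δ := by rw [hδ]; linarith
  obtain ⟨ρ, hρ, -, hα⟩ := exists_moment_lt_of_lt_info hp2 (bobChan_mem ch)
    (show IB - δ < IB by linarith)
  set α := (2 : ℝ) ^ (ρ * (IB - δ)) * moment p (bobChan ch) (-ρ)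
  have hα0 : 0 ≤ α := mul_nonneg (by positivity) (moment_nonneg hp2 (bobChan_mem ch) _)
  set κ := (2 : ℝ) ^ (-δ)
  have hκ1 : κ < 1 := Real.rpow_lt_one_of_one_lt_of_neg one_lt_two (by linarith)
  have hlim : Tendsto (fun n : ℕ => 2 * (α ^ (M * n) + 2 * κ ^ (M * n))) atTop (𝓝 0) := by
    have hMn : Tendsto (fun n : ℕ => M * n) atTop atTop := tendsto_id.const_mul_atTop' hM
    have := (((tendsto_pow_atTop_nhds_zero_of_lt_one hα0 hα).add
      ((tendsto_pow_atTop_nhds_zero_of_lt_one (by positivity) hκ1).const_mul 2)).const_mul 2).comp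
      hMn
    simpa [Function.comp_def] using this
  filter_upwards [hlim.eventually (gt_mem_nhds hε)] with n hn
  set b := ⌊(n : ℝ) * R⌋₊
  have hb : (b : ℝ) ≤ n * R := Nat.floor_le (by positivity)
  obtain ⟨enc, dec, h⟩ := exists_maximal_error_code (T := Fin (L * M) → Bits b)
    (prodLaw_mem (ι := Fin M × Fin n) hp2) (prodChan_mem (bobChan_mem ch))
    (γ := (2 : ℝ) ^ (((M * n : ℕ) : ℝ) * (IB - δ))) (by positivity) hρ
  refine ⟨enc, dec, fun t => (h t).trans (le_trans ?_ hn.le)⟩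
  have t1 : ((2 : ℝ) ^ (((M * n : ℕ) : ℝ) * (IB - δ))) ^ ρ *
      moment p (bobChan ch) (-ρ) ^ (M * n) = α ^ (M * n) := by
    rw [mul_pow, ← Real.rpow_natCast ((2 : ℝ) ^ (ρ * (IB - δ))), ← Real.rpow_mul zero_le_two,
      ← Real.rpow_mul zero_le_two]
    ring_nf
  have t2 : (2 : ℝ) ^ (b * (L * M)) / (2 : ℝ) ^ (((M * n : ℕ) : ℝ) * (IB - δ)) ≤
      κ ^ (M * n) := by
    rw [← Real.rpow_natCast, ← Real.rpow_sub zero_lt_two, ← Real.rpow_natCast κ,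
      ← Real.rpow_mul zero_le_two]
    refine Real.rpow_le_rpow_of_exponent_le one_le_two ?_
    push_cast
    have h1 : (b : ℝ) * (L * M) ≤ n * R * (L * M) :=
      mul_le_mul_of_nonneg_right hb (by positivity)
    have h2 : L * R = IB - 2 * δ := by rw [hδ]; ring
    have h3 : (n : ℝ) * R * (L * M) = M * n * (IB - 2 * δ) := by rw [← h2]; ring
    rw [h3] at h1
    linarith
  rw [moment_prod hp2 (bobChan_mem ch), Fintype.card_prod, Fintype.card_fin, Fintype.card_fin, t1,
    Fintype.card_fun, card_bits, Fintype.card_fin]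
  push_cast
  rw [← pow_mul, mul_div_assoc]
  push_cast at t2
  linarith

/-- Component codes whose performance is `δ`-close to that of a strong family. -/
def IsGood (L M n : ℕ) (δ : ℝ) (S : Scheme X Y L M n) : Prop :=
  |(S.bits : ℝ) / n - secrecyCapacity ch| ≤ δ ∧ S.wError ch ≤ δ ∧ S.wLeak ch ≤ δ ∧ S.cError ch ≤ δ

theorem eventually_exists_isGood (hpos : 0 < secrecyCapacity ch) (L M : ℕ)
    (hL : mainCapacity ch = L * secrecyCapacity ch) {δ : ℝ} (hδ : 0 < δ) :
    ∀ᶠ n : ℕ in atTop, ∃ S : Scheme X Y L M n, IsGood ch L M n δ S := by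
  have hX := nonempty_of_secrecyCapacity_pos ch hpos
  set Rs := secrecyCapacity ch
  -- The back-off `δ'` keeps the rate positive and strictly below `R_s`; the other `δ / 2` absorbs
  -- the rounding error, at most `1 / n`.
  set δ' := min (δ / 2) (Rs / 2) with hδ'
  have h1 : δ' ≤ δ / 2 := min_le_left _ _
  have h2 : δ' ≤ Rs / 2 := min_le_right _ _
  have h3 : 0 < δ' := lt_min (by linarith) (by linarith)
  have hR : 0 < Rs - δ' := by linarith
  have hchan : ∀ᶠ n : ℕ in atTop,
      ∃ (enc : (Fin (L * M) → Bits ⌊(n : ℝ) * (Rs - δ')⌋₊) → (Fin M × Fin n → X))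
      (dec : (Fin M × Fin n → Y) → (Fin (L * M) → Bits ⌊(n : ℝ) * (Rs - δ')⌋₊)), ∀ t,
      ∑ y, prodChan (bobChan ch) (enc t) y * ind (dec y ≠ t) ≤ δ := by
    -- For `L = 0` the strict rate inequality for the channel code fails, but there is only the
    -- empty message to send.
    rcases Nat.eq_zero_or_pos L with h0 | h0
    · subst h0
      obtain ⟨x⟩ : Nonempty X := by
        obtain ⟨p⟩ := hX
        by_contra hn
        rw [not_nonempty_iff] at hn
        simpa using p.2.2
      refine Eventually.of_forall fun n => ⟨fun _ _ => x, fun _ => 0, fun t => ?_⟩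
      refine le_trans (le_of_eq (Finset.sum_eq_zero fun y _ => ?_)) hδ.le
      rw [ind_false, mul_zero]
      rw [not_not]
      funext i
      exact absurd i.2 (by simp)
    · refine eventually_channel_code ch hR L M ?_ hX hδ
      rw [hL]
      have : (0 : ℝ) < L := by exact_mod_cast h0
      exact mul_lt_mul_of_pos_left (by linarith) this
  filter_upwards [eventually_wiretap_code ch hR (by linarith : Rs - δ' < Rs) hδ, hchan,
    eventually_gt_atTop 0,
    (tendsto_inv_atTop_nhds_zero_nat (𝕜 := ℝ)).eventually (gt_mem_nhds (half_pos hδ))]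
    with n ⟨we, wd, hwe, hwl⟩ ⟨ce, cd, hc⟩ hn hinv
  refine ⟨⟨⌊(n : ℝ) * (Rs - δ')⌋₊, we, wd, ce, cd⟩, ?_, ?_, ?_, ?_⟩
  · have hn' : (0 : ℝ) < n := by exact_mod_cast hn
    have hf1 : (⌊(n : ℝ) * (Rs - δ')⌋₊ : ℝ) ≤ n * (Rs - δ') := Nat.floor_le (by positivity)
    have hf2 : (n : ℝ) * (Rs - δ') < ⌊(n : ℝ) * (Rs - δ')⌋₊ + 1 := Nat.lt_floor_add_one _
    have hone : (n : ℝ) * (n : ℝ)⁻¹ = 1 := mul_inv_cancel₀ hn'.ne'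
    have hlow : Rs - δ ≤ (⌊(n : ℝ) * (Rs - δ')⌋₊ : ℝ) / n := by
      rw [le_div_iff₀ hn']
      nlinarith
    have hupp : (⌊(n : ℝ) * (Rs - δ')⌋₊ : ℝ) / n ≤ Rs := by
      rw [div_le_iff₀ hn']
      nlinarith
    exact abs_sub_le_iff.mpr ⟨by linarith, by linarith⟩
  · rw [Scheme.wError_eq]
    exact hwe
  · rw [Scheme.wLeak_eq]
    exact hwl
  · refine ciSup_le fun t => ?_
    rw [Scheme.prob_cDec]
    exact hc t

/-- A diagonal choice: for each tolerance, good codes exist for all large `n`, and the tolerance is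
lowered as `n` grows. -/
theorem exists_isStrongFamily (hpos : 0 < secrecyCapacity ch) (L M : ℕ)
    (hL : mainCapacity ch = L * secrecyCapacity ch) :
    ∃ S : ∀ n, Scheme X Y L M n, IsStrongFamily ch S := by
  classical
  have hX := nonempty_of_secrecyCapacity_pos ch hpos
  have hne : ∀ n, Nonempty (Scheme X Y L M n) := fun n => by
    obtain ⟨x⟩ : Nonempty X := by
      obtain ⟨p⟩ := hX
      by_contra hn
      rw [not_nonempty_iff] at hn
      simpa using p.2.2
    exact ⟨⟨0, uniformEnc (J := Unit) fun _ _ => x, fun _ => 0, fun _ _ => x, fun _ => 0⟩⟩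
  set δ : ℕ → ℝ := fun j => 1 / ((j : ℝ) + 1) with hδ
  have hδ0 : Tendsto δ atTop (𝓝 0) := tendsto_one_div_add_atTop_nhds_zero_nat
  set good : ℕ → ℕ → Prop := fun n j => ∃ S : Scheme X Y L M n, IsGood ch L M n (δ j) S with hgood
  have hg : ∀ j, ∀ᶠ n in atTop, good n j := fun j =>
    eventually_exists_isGood ch hpos L M hL (by simp only [hδ]; positivity)
  -- The best tolerance index up to `n` that is attainable at block length `n`. The cap `n` keeps
  -- the maximum finite.
  set J : ℕ → ℕ := fun n => Nat.findGreatest (good n) n with hJ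
  have hJt : Tendsto J atTop atTop := by
    rw [tendsto_atTop]
    intro j
    filter_upwards [hg j, eventually_ge_atTop j] with n hn hj
    exact Nat.le_findGreatest hj hn
  have hJg : ∀ᶠ n in atTop, good n (J n) := by
    filter_upwards [hg 0] with n hn
    exact Nat.findGreatest_spec (Nat.zero_le n) hn
  have hS : ∀ n, ∃ S : Scheme X Y L M n, good n (J n) → IsGood ch L M n (δ (J n)) S := by
    intro n
    by_cases h : good n (J n)
    · obtain ⟨S, hS⟩ := h
      exact ⟨S, fun _ => hS⟩
    · obtain ⟨S⟩ := hne n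
      exact ⟨S, fun h' => absurd h' h⟩
  choose S hS using hS
  have hlim := hδ0.comp hJt
  have hev : ∀ᶠ n in atTop, IsGood ch L M n (δ (J n)) (S n) := hJg.mono fun n hn => hS n hn
  refine ⟨S, ⟨?_, ?_, ?_⟩, ?_⟩
  · rw [tendsto_iff_dist_tendsto_zero]
    refine squeeze_zero' (Eventually.of_forall fun n => dist_nonneg) ?_ hlim
    filter_upwards [hev] with n hn
    exact hn.1
  · refine squeeze_zero' (Eventually.of_forall fun n => (S n).wError_nonneg ch) ?_ hlim
    filter_upwards [hev] with n hn
    exact hn.2.1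
  · refine squeeze_zero' (Eventually.of_forall fun n => (S n).cError_nonneg ch) ?_ hlim
    filter_upwards [hev] with n hn
    exact hn.2.2.2
  · refine squeeze_zero' (Eventually.of_forall fun n => (S n).wLeak_nonneg ch) ?_ hlim
    filter_upwards [hev] with n hn
    exact hn.2.2.1

theorem IsStrongFamily.isWynerFamily {L M : ℕ} {S : ∀ n, Scheme X Y L M n}
    (h : IsStrongFamily ch S) : IsWynerFamily ch S := by
  refine ⟨h.1, ?_⟩
  have := h.2.mul (tendsto_inv_atTop_nhds_zero_nat (𝕜 := ℝ))
  simpa [div_eq_mul_inv] using this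

end Channel

/-! ### Bookkeeping -/

theorem start_succ (q k : ℕ) : start q (k + 1) = start q k + (1 + keyed q k) := by
  simp [start, Finset.sum_range_succ]

theorem start_strictMono (q : ℕ) : StrictMono (start q) :=
  strictMono_nat_of_lt_succ fun k => by rw [start_succ]; omega

theorem keyed_le_right (q k : ℕ) : keyed q k ≤ q := min_le_right _ _

theorem keyed_le_left (q k : ℕ) : keyed q k ≤ k := min_le_left _ _

theorem start_add_le (q k d : ℕ) : start q (k + d) ≤ start q k + d * (1 + q) := by
  induction d with
  | zero => simp
  | succ d ih =>
    rw [← add_assoc, start_succ, add_mul]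
    have := keyed_le_right q (k + d)
    omega

theorem ext_of_lt {K : ℕ} {A : Type*} [Zero A] (f : Fin K → A) {j : ℕ} (h : j < K) :
    ext f j = f ⟨j, h⟩ := dif_pos h

theorem ext_fin {K : ℕ} {A : Type*} [Zero A] (f : Fin K → A) (j : Fin K) : ext f j = f j :=
  ext_of_lt f j.2

/-- If all component codes are decoded correctly, then Bob recovers the message stream. -/
theorem estimate_eq {b q : ℕ} {v : ℕ → Bits b} {t : ℕ → Fin q → Bits b} {w : ℕ → Bits b} :
    ∀ K : ℕ, (∀ j < K, v j = w (start q j)) → (∀ j < K, 0 < j → t j = encrypt q j w) →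
      ∀ m < start q K, estimate q v t K m = w m
  | 0, _, _, m, hm => by simp [start] at hm
  | K + 1, hv, ht, m, hm => by
    have ih := estimate_eq K (fun j hj => hv j (by omega)) fun j hj => ht j (by omega)
    rw [start_succ] at hm
    have hq := keyed_le_right q K
    simp only [estimate]
    split_ifs with h1 h2 h3
    · exact ih m h1
    · rw [h2]
      exact hv K (by omega)
    · have hi : m - (start q K + 1) < keyed q K := by omega
      -- A keyed message exists only if the buffer is nonempty, so the channel decoder of slot `0`
      -- is never consulted.
      have hK : 0 < K := by
        have := keyed_le_left q K
        omega
      rw [ht K (by omega) hK, ih _ (keyIndex_eq q K _ hi).2, encrypt]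
      simp only [hi, if_true]
      have hm' : start q K + 1 + (m - (start q K + 1)) = m := by omega
      rw [hm', add_assoc, show ∀ x : Bits b, x + x = 0 from fun x => funext fun i =>
        CharTwo.add_self_eq_zero (x i), add_zero]
    · omega

namespace Scheme

variable {X Y Z : Type*} [Fintype X] [Fintype Y] [Fintype Z] {L M n : ℕ}
  (S : Scheme X Y L M n) (ch : X → stdSimplex ℝ (Y × Z))

/-! ### The joint law as a product of slots -/

/-- Outcome of one slot, given the messages. -/
abbrev Slot (X Y Z : Type*) (M n : ℕ) : Type _ :=
  (Fin n → X) × (Fin n → Y × Z) × (Fin M × Fin n → Y × Z)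

/-- Law of slot `j`, given the message stream. -/
def slotKernel (j : ℕ) (w : ℕ → Bits S.bits) (a : Slot X Y Z M n) : ℝ :=
  S.wEnc (w (start (L * M) j)) a.1 * blockProb ch a.1 a.2.1 *
    blockProb ch (S.cEnc (encrypt (L * M) j w)) a.2.2

theorem slotKernel_nonneg (j : ℕ) (w : ℕ → Bits S.bits) (a : Slot X Y Z M n) :
    0 ≤ S.slotKernel ch j w a :=
  mul_nonneg (mul_nonneg ((S.wEnc _).2.1 _) (blockProb_nonneg ch _ _)) (blockProb_nonneg ch _ _)

theorem sum_slotKernel_mul (j : ℕ) (w : ℕ → Bits S.bits) (φ : (Fin n → X) → (Fin n → Y × Z) → ℝ)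
    (ψ : (Fin M × Fin n → Y × Z) → ℝ) :
    ∑ a, S.slotKernel ch j w a * (φ a.1 a.2.1 * ψ a.2.2) =
      (∑ x, ∑ o, S.wEnc (w (start (L * M) j)) x * blockProb ch x o * φ x o) *
        ∑ o, blockProb ch (S.cEnc (encrypt (L * M) j w)) o * ψ o := by
  simp_rw [Fintype.sum_prod_type, Finset.sum_mul, Finset.mul_sum, slotKernel]
  refine Finset.sum_congr rfl fun x _ => Finset.sum_congr rfl fun o _ =>
    Finset.sum_congr rfl fun o' _ => by ring

theorem sum_wEnc_blockProb (m : Bits S.bits) :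
    ∑ x, ∑ o, S.wEnc m x * blockProb ch x o = 1 := by
  simp_rw [← Finset.mul_sum, sum_blockProb, mul_one]
  exact (S.wEnc m).2.2

theorem sum_slotKernel (j : ℕ) (w : ℕ → Bits S.bits) : ∑ a, S.slotKernel ch j w a = 1 := by
  have := S.sum_slotKernel_mul ch j w (fun _ _ => 1) fun _ => 1
  simpa [sum_wEnc_blockProb, sum_blockProb] using this

/-- Regrouping of an outcome by slots. -/
def outcomeEquiv (X Y Z : Type*) (L M n b K : ℕ) :
    (Fin (start (L * M) K) → Bits b) × (Fin K → Slot X Y Z M n) ≃ Outcome X Y Z L M n b K where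
  toFun ω := (ω.1, fun j => (ω.2 j).1, fun j => (ω.2 j).2.1, fun j => (ω.2 j).2.2)
  invFun ω := (ω.1, fun j => (ω.2.1 j, ω.2.2.1 j, ω.2.2.2 j))
  left_inv _ := rfl
  right_inv _ := rfl

theorem sum_joint {K : ℕ} (F : Outcome X Y Z L M n S.bits K → ℝ) :
    ∑ ω, S.joint ch K ω * F ω = ∑ w, (1 / 2 ^ S.bits) ^ start (L * M) K *
      ∑ a : Fin K → Slot X Y Z M n, (∏ j : Fin K, S.slotKernel ch j (ext w) (a j)) *
        F (w, fun j => (a j).1, fun j => (a j).2.1, fun j => (a j).2.2) := by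
  rw [← Equiv.sum_comp (outcomeEquiv X Y Z L M n S.bits K), Fintype.sum_prod_type]
  refine Finset.sum_congr rfl fun w _ => ?_
  rw [Finset.mul_sum]
  refine Finset.sum_congr rfl fun a _ => ?_
  rw [← mul_assoc]
  rfl

theorem sum_uniform_eval {N : ℕ} (i : Fin N) (b : ℕ) (φ : Bits b → ℝ) :
    ∑ w : Fin N → Bits b, (1 / 2 ^ b) ^ N * φ (w i) = ∑ m, 1 / 2 ^ b * φ m := by
  have := sum_pi_eval (fun (_ : Fin N) (_ : Bits b) => (1 / 2 ^ b : ℝ))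
    (fun _ => (uniform_bits_mem b).2) i φ
  simpa using this

theorem sum_uniform (N b : ℕ) : ∑ _w : Fin N → Bits b, (1 / 2 ^ b : ℝ) ^ N = 1 := by
  have := sum_pi_prod (fun (_ : Fin N) (_ : Bits b) => (1 / 2 ^ b : ℝ))
  simp only [(uniform_bits_mem b).2, Finset.prod_const, Finset.card_univ, Fintype.card_fin,
    one_pow] at this
  exact this

theorem joint_nonneg {K : ℕ} (ω : Outcome X Y Z L M n S.bits K) : 0 ≤ S.joint ch K ω :=
  mul_nonneg (by positivity) (Finset.prod_nonneg fun j _ => mul_nonneg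
    (mul_nonneg ((S.wEnc _).2.1 _) (blockProb_nonneg ch _ _)) (blockProb_nonneg ch _ _))

theorem joint_mem (K : ℕ) : S.joint ch K ∈ stdSimplex ℝ (Outcome X Y Z L M n S.bits K) := by
  refine ⟨S.joint_nonneg ch, ?_⟩
  have := S.sum_joint ch (K := K) fun _ => 1
  simp only [mul_one, fun w : ℕ → Bits S.bits => sum_pi_prod fun (j : Fin K) a =>
    S.slotKernel ch j w a, sum_slotKernel, Finset.prod_const_one, sum_uniform] at this
  exact this

/-- The first minislot of any slot is a use of the wiretap code with a uniform message. -/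
theorem sum_joint_first {K : ℕ} (j : Fin K)
    (φ : Bits S.bits → (Fin n → X) → (Fin n → Y × Z) → ℝ) :
    ∑ ω, S.joint ch K ω * φ (ext ω.1 (start (L * M) j)) (ω.2.1 j) (ω.2.2.1 j) =
      ∑ ω, S.wJoint ch ω * φ ω.1 ω.2.1 ω.2.2 := by
  rw [sum_joint]
  have hj : start (L * M) j < start (L * M) K := start_strictMono _ j.2
  have h1 : ∀ w : Fin (start (L * M) K) → Bits S.bits,
      ∑ a : Fin K → Slot X Y Z M n, (∏ i : Fin K, S.slotKernel ch i (ext w) (a i)) *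
        φ (ext w (start (L * M) j)) (a j).1 (a j).2.1 =
      (fun m => ∑ x, ∑ o, S.wEnc m x * blockProb ch x o * φ m x o) (w ⟨_, hj⟩) := by
    intro w
    rw [sum_pi_eval (fun (i : Fin K) a => S.slotKernel ch i (ext w) a)
      (fun i => S.sum_slotKernel ch i (ext w)) j
      fun a => φ (ext w (start (L * M) j)) a.1 a.2.1]
    have := S.sum_slotKernel_mul ch j (ext w) (φ (ext w (start (L * M) j))) fun _ => 1
    simp only [mul_one, sum_blockProb] at this
    rw [this, ext_of_lt w hj]
  simp_rw [h1]
  refine (sum_uniform_eval ⟨_, hj⟩ S.bits fun m =>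
    ∑ x, ∑ o, S.wEnc m x * blockProb ch x o * φ m x o).trans ?_
  simp_rw [Fintype.sum_prod_type, Finset.mul_sum, wJoint]
  refine Finset.sum_congr rfl fun m _ => Finset.sum_congr rfl fun x _ =>
    Finset.sum_congr rfl fun o _ => by ring

/-- Given the messages, the channel code carries one fixed block, so its maximal error applies. An
average error would not do: blocks padded with zeros during start-up need not be uniform. -/
theorem sum_joint_keyed_le {K : ℕ} (j : Fin K) :
    ∑ ω, S.joint ch K ω *
      ind (S.cDec (fun i => (ω.2.2.2 j i).1) ≠ encrypt (L * M) j (ext ω.1)) ≤ S.cError ch := by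
  rw [sum_joint]
  have h1 : ∀ w : Fin (start (L * M) K) → Bits S.bits,
      ∑ a : Fin K → Slot X Y Z M n, (∏ i : Fin K, S.slotKernel ch i (ext w) (a i)) *
        ind (S.cDec (fun i => ((a j).2.2 i).1) ≠ encrypt (L * M) j (ext w)) ≤ S.cError ch := by
    intro w
    rw [sum_pi_eval (fun (i : Fin K) a => S.slotKernel ch i (ext w) a)
      (fun i => S.sum_slotKernel ch i (ext w)) j
      fun a => ind (S.cDec (fun i => (a.2.2 i).1) ≠ encrypt (L * M) j (ext w))]
    have := S.sum_slotKernel_mul ch j (ext w) (fun _ _ => 1)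
      fun o => ind (S.cDec (fun i => (o i).1) ≠ encrypt (L * M) j (ext w))
    simp only [mul_one, one_mul, sum_wEnc_blockProb] at this
    rw [this]
    refine le_trans (le_of_eq ?_) (S.prob_le_cError ch (encrypt (L * M) j (ext w)))
    rw [prob_eq_sum]
    exact Finset.sum_congr rfl fun o _ => mul_comm _ _
  calc _ ≤ ∑ _w : Fin (start (L * M) K) → Bits S.bits,
        (1 / 2 ^ S.bits) ^ start (L * M) K * S.cError ch := by
        gcongr with w _
        exact h1 w
    _ = S.cError ch := by rw [← Finset.sum_mul, sum_uniform, one_mul]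

/-! ### Reliability -/

/-- If all `k + 1` wiretap decodings and the `k` channel decodings after slot `0` succeed, then
`estimate_eq` makes Bob's whole stream correct; the rest is a union bound. -/
theorem errorProb_le (k : ℕ) :
    S.errorProb ch k ≤ ((k : ℝ) + 1) * S.wError ch + (k : ℝ) * S.cError ch := by
  have hev : ∀ ω : Outcome X Y Z L M n S.bits (k + 1),
      ind (∃ m, start (L * M) k ≤ m ∧ m < start (L * M) (k + 1) ∧ S.bob ω m ≠ ext ω.1 m) ≤
      ∑ j : Fin (k + 1),
        ind (S.wDec (fun i => (ω.2.2.1 j i).1) ≠ ext ω.1 (start (L * M) j)) +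
      ∑ j ∈ Finset.univ.erase (0 : Fin (k + 1)),
        ind (S.cDec (fun i => (ω.2.2.2 j i).1) ≠ encrypt (L * M) j (ext ω.1)) := by
    intro ω
    refine le_trans (ind_mono (q := (∃ j ∈ Finset.univ,
        S.wDec (fun i => (ω.2.2.1 j i).1) ≠ ext ω.1 (start (L * M) j)) ∨
        ∃ j ∈ Finset.univ.erase (0 : Fin (k + 1)),
        S.cDec (fun i => (ω.2.2.2 j i).1) ≠ encrypt (L * M) j (ext ω.1)) ?_)
      ((ind_or_le _ _).trans (add_le_add (ind_exists_le _ _) (ind_exists_le _ _)))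
    rintro ⟨m, -, hm, hne⟩
    by_contra! hn
    refine hne (estimate_eq (k + 1) (fun j hj => ?_) (fun j hj h0 => ?_) m hm)
    · rw [ext_of_lt _ hj]
      exact hn.1 ⟨j, hj⟩ (Finset.mem_univ _)
    · rw [ext_of_lt _ hj]
      refine hn.2 ⟨j, hj⟩ (Finset.mem_erase.mpr ⟨?_, Finset.mem_univ _⟩)
      rw [Ne, Fin.ext_iff]
      exact h0.ne'
  have hw : ∀ j : Fin (k + 1), ∑ ω, S.joint ch (k + 1) ω *
      ind (S.wDec (fun i => (ω.2.2.1 j i).1) ≠ ext ω.1 (start (L * M) j)) = S.wError ch := by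
    intro j
    rw [S.sum_joint_first ch j fun m _ o => ind (S.wDec (fun i => (o i).1) ≠ m), wError,
      prob_eq_sum]
    exact Finset.sum_congr rfl fun ω _ => mul_comm _ _
  rw [errorProb, prob_eq_sum]
  calc _ ≤ ∑ ω, S.joint ch (k + 1) ω * (∑ j : Fin (k + 1),
        ind (S.wDec (fun i => (ω.2.2.1 j i).1) ≠ ext ω.1 (start (L * M) j)) +
      ∑ j ∈ Finset.univ.erase (0 : Fin (k + 1)),
        ind (S.cDec (fun i => (ω.2.2.2 j i).1) ≠ encrypt (L * M) j (ext ω.1))) := by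
        refine Finset.sum_le_sum fun ω _ => ?_
        rw [mul_comm]
        exact mul_le_mul_of_nonneg_left (hev ω) (S.joint_nonneg ch ω)
    _ = ∑ j : Fin (k + 1), ∑ ω, S.joint ch (k + 1) ω *
          ind (S.wDec (fun i => (ω.2.2.1 j i).1) ≠ ext ω.1 (start (L * M) j)) +
        ∑ j ∈ Finset.univ.erase (0 : Fin (k + 1)), ∑ ω, S.joint ch (k + 1) ω *
          ind (S.cDec (fun i => (ω.2.2.2 j i).1) ≠ encrypt (L * M) j (ext ω.1)) := by
        simp_rw [mul_add, Finset.sum_add_distrib, Finset.mul_sum]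
        congr 1 <;> exact Finset.sum_comm
    _ ≤ ∑ _j : Fin (k + 1), S.wError ch +
        ∑ _j ∈ Finset.univ.erase (0 : Fin (k + 1)), S.cError ch :=
        add_le_add (Finset.sum_le_sum fun j _ => (hw j).le)
          (Finset.sum_le_sum fun j _ => S.sum_joint_keyed_le ch j)
    _ = _ := by simp

theorem errorProb_nonneg (k : ℕ) : 0 ≤ S.errorProb ch k := by
  rw [errorProb, prob_eq_sum]
  exact Finset.sum_nonneg fun ω _ => mul_nonneg (ind_nonneg _) (S.joint_nonneg ch ω)

/-! ### What Eve receives -/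

/-- Law of Eve's observations in slot `j`, given the message stream. -/
def eveKernel (j : ℕ) (w : ℕ → Bits S.bits) (z : (Fin n → Z) × (Fin M × Fin n → Z)) : ℝ :=
  encEve ch S.wEnc (w (start (L * M) j)) z.1 *
    prodChan (eveChan ch) (S.cEnc (encrypt (L * M) j w)) z.2

theorem sum_ind_slotKernel (j : ℕ) (w : ℕ → Bits S.bits)
    (z : (Fin n → Z) × (Fin M × Fin n → Z)) :
    ∑ a : Slot X Y Z M n, ind (((fun i => (a.2.1 i).2), fun i => (a.2.2 i).2) = z) *
      S.slotKernel ch j w a = S.eveKernel ch j w z := by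
  have h := S.sum_slotKernel_mul ch j w (fun _ o => ind ((fun i => (o i).2) = z.1))
    fun o => ind ((fun i => (o i).2) = z.2)
  simp_rw [← ind_and] at h
  rw [eveKernel, encEve]
  have e1 : ∀ x : Fin n → X, ∑ o, S.wEnc (w (start (L * M) j)) x * blockProb ch x o *
      ind ((fun i => (o i).2) = z.1) =
      S.wEnc (w (start (L * M) j)) x * prodChan (eveChan ch) x z.1 := by
    intro x
    simp_rw [mul_assoc]
    rw [← Finset.mul_sum, sum_blockProb_snd ch x fun z' => ind (z' = z.1)]
    simp_rw [eq_comm (b := z.1), mul_comm _ (ind _)]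
    rw [sum_ind_mul]
  have e2 : ∑ o, blockProb ch (S.cEnc (encrypt (L * M) j w)) o * ind ((fun i => (o i).2) = z.2) =
      prodChan (eveChan ch) (S.cEnc (encrypt (L * M) j w)) z.2 := by
    rw [sum_blockProb_snd ch _ fun z' => ind (z' = z.2)]
    simp_rw [eq_comm (b := z.2), mul_comm _ (ind _)]
    rw [sum_ind_mul]
  simp_rw [e1, e2] at h
  rw [← h]
  refine Finset.sum_congr rfl fun a _ => ?_
  rw [mul_comm, Prod.ext_iff]

/-- Given the messages, Eve's observations in different slots are independent, since all codeword
choices and channel noise are. -/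
theorem sum_joint_eve {K : ℕ}
    (F : (Fin (start (L * M) K) → Bits S.bits) → (Fin K → (Fin n → Z) × (Fin M × Fin n → Z)) → ℝ) :
    ∑ ω, S.joint ch K ω *
      F ω.1 (fun j => ((fun i => (ω.2.2.1 j i).2), fun i => (ω.2.2.2 j i).2)) =
    ∑ w, (1 / 2 ^ S.bits) ^ start (L * M) K *
      ∑ z, (∏ j : Fin K, S.eveKernel ch j (ext w) (z j)) * F w z := by
  rw [sum_joint]
  refine Finset.sum_congr rfl fun w _ => ?_
  congr 1
  have := sum_pi_comp (fun (j : Fin K) a => S.slotKernel ch j (ext w) a)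
    (fun a => ((fun i => (a.2.1 i).2), fun i => (a.2.2 i).2)) (F w)
  simp_rw [S.sum_ind_slotKernel ch] at this
  exact this

end Scheme

/-! ### Chains of keys -/

/-- Every message is linked by its chain of keys to a message sent by the wiretap code, its root,
here given by the slot number.  Messages that have not yet been used as keys have different
roots. -/
theorem exists_root (q : ℕ) : ∀ K : ℕ, ∃ root : ℕ → ℕ,
    (∀ j < K, root (start q j) = j) ∧
    (∀ j < K, ∀ i < keyed q j, root (start q j + 1 + i) = root (keyIndex q j i)) ∧
    (∀ m < start q K, root m < K) ∧
    ∀ x y, start q K ≤ x + K → x < start q K → start q K ≤ y + K → y < start q K →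
      root x = root y → x = y
  | 0 => ⟨id, by simp [start], by simp, by simp [start], by simp [start]⟩
  | K + 1 => by
    obtain ⟨r, h1, h2, h3, h4⟩ := exists_root q K
    have hk := keyed_le_left q K
    have hs := (buffer_eq q K).1
    have hmono := (start_strictMono q).monotone
    set s := start q K with hsdef
    have hlast : ∀ m, s < m → m < start q (K + 1) → m - (s + 1) < keyed q K := by
      intro m hm hm'
      rw [start_succ] at hm'
      omega
    -- The first message of the new slot starts a chain with root `K`. A keyed message inherits the
    -- root of its key, the buffer entry at position `m - (s + 1)` counted from `s - K`. Used keys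
    -- leave the window of the `K + 1` latest messages, so roots stay distinct there.
    refine ⟨fun m => if m < s then r m else if m = s then K else r (s - K + (m - (s + 1))),
      fun j hj => ?_, fun j hj i hi => ?_, fun m hm => ?_, fun x y hx hx' hy hy' hxy => ?_⟩
    · dsimp only
      rcases Nat.lt_succ_iff_lt_or_eq.mp hj with hj | rfl
      · rw [if_pos (start_strictMono q hj), h1 j hj]
      · rw [if_neg (lt_irrefl _), if_pos rfl]
    · have hkey := keyIndex_eq q j i hi
      dsimp only
      rcases Nat.lt_succ_iff_lt_or_eq.mp hj with hj | rfl
      · have : start q (j + 1) ≤ s := hmono (by omega)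
        rw [start_succ] at this
        rw [if_pos (by omega), if_pos (by omega), h2 j hj i hi]
      · rw [if_neg (by omega), if_neg (by omega), if_pos hkey.2, hkey.1]
        congr 1
        omega
    · dsimp only
      split_ifs with c1 c2
      · exact (h3 m c1).trans (Nat.lt_succ_self K)
      · exact Nat.lt_succ_self K
      · have := hlast m (by omega) hm
        exact (h3 _ (by omega)).trans (Nat.lt_succ_self K)
    · rw [start_succ] at hx hy
      have lx := hlast x
      have ly := hlast y
      dsimp only at hxy
      split_ifs at hxy with c1 c2 c3 c4 c5 c6 c7
      · exact h4 x y (by omega) c1 (by omega) c2 hxy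
      · have := h3 x c1
        omega
      · have := ly (by omega) hy'
        have := h4 x _ (by omega) c1 (by omega) (by omega) hxy
        omega
      · have := h3 y c5
        omega
      · omega
      · have := ly (by omega) hy'
        have := h3 (s - K + (y - (s + 1))) (by omega)
        omega
      · have := lx (by omega) hx'
        have := h4 _ y (by omega) (by omega) (by omega) c7 hxy
        omega
      · have := lx (by omega) hx'
        have := h3 (s - K + (x - (s + 1))) (by omega)
        omega
      · have := lx (by omega) hx'
        have := ly (by omega) hy'
        have := h4 _ _ (by omega) (by omega) (by omega) (by omega) hxy
        omega

/-! ### Secrecy by shifts along key chains. -/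

namespace Scheme

variable {X Y Z : Type*} [Fintype X] [Fintype Y] [Fintype Z] {L M n : ℕ}
  (S : Scheme X Y L M n) (ch : X → stdSimplex ℝ (Y × Z))

theorem ext_add {N : ℕ} {b : ℕ} (w : Fin N → Bits b) (σ : ℕ → Bits b) {m : ℕ} (hm : m < N) :
    ext (w + fun i : Fin N => σ i) m = ext w m + σ m := by
  rw [ext_of_lt _ hm, ext_of_lt _ hm]
  rfl

/-- Shifting all messages of a chain by the same amount does not change the encrypted messages. -/
theorem encrypt_shift {b q K : ℕ} {root : ℕ → ℕ}
    (hroot : ∀ j < K, ∀ i < keyed q j, root (start q j + 1 + i) = root (keyIndex q j i))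
    (w : Fin (start q K) → Bits b) (σ : ℕ → Bits b) {j : ℕ} (hj : j < K) :
    encrypt q j (ext (w + fun i : Fin (start q K) => σ (root i))) = encrypt q j (ext w) := by
  funext i
  rw [encrypt, encrypt]
  split_ifs with hi
  · have h1 : start q (j + 1) ≤ start q K := (start_strictMono q).monotone hj
    rw [start_succ] at h1
    have h2 := (keyIndex_eq q j i hi).2
    rw [ext_add w (fun m => σ (root m)) (by omega), ext_add w (fun m => σ (root m)) (by omega)]
    simp only [hroot j hj i hi]
    rw [add_add_add_comm, show ∀ x : Bits b, x + x = 0 from fun x => funext fun i =>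
        CharTwo.add_self_eq_zero (x i), add_zero]
  · rfl

/-- The law of Eve's observations in a first minislot, averaged over the message. -/
def eveOut (z : Fin n → Z) : ℝ := outLaw (fun _ => 1 / 2 ^ S.bits) (encEve ch S.wEnc) z

theorem eveOut_nonneg (z : Fin n → Z) : 0 ≤ S.eveOut ch z :=
  outLaw_nonneg (uniform_bits_mem _) (encEve_mem ch S.wEnc) z

theorem sum_eveOut_shift (m : Bits S.bits) (z : Fin n → Z) :
    ∑ s, 1 / 2 ^ S.bits * encEve ch S.wEnc (m + s) z = S.eveOut ch z :=
  Equiv.sum_comp (Equiv.addLeft m) fun s => 1 / 2 ^ S.bits * encEve ch S.wEnc s z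

/-- The expected log-likelihood ratio against the averaged output law is the leakage; this is the
cost per root of the change of measure. -/
theorem sum_wJoint_log :
    ∑ ω, S.wJoint ch ω * Real.logb 2 (encEve ch S.wEnc ω.1 (fun i => (ω.2.2 i).2) /
      S.eveOut ch fun i => (ω.2.2 i).2) = S.wLeak ch := by
  rw [← sum_law_mul (S.wJoint ch) (fun ω => (ω.1, fun i => (ω.2.2 i).2)) fun mz =>
    Real.logb 2 (encEve ch S.wEnc mz.1 mz.2 / S.eveOut ch mz.2), Fintype.sum_prod_type, wLeak_eq]
  simp_rw [S.law_wJoint ch]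
  rfl

omit [Fintype X] in
theorem blockProb_le_prodChan (x : Fin n → X) (o : Fin n → Y × Z) :
    blockProb ch x o ≤ prodChan (eveChan ch) x fun i => (o i).2 :=
  Finset.prod_le_prod (fun i _ => (ch (x i)).2.1 _) fun i _ =>
    Finset.single_le_sum (f := fun y => ch (x i) (y, (o i).2)) (fun _ _ => (ch (x i)).2.1 _)
      (Finset.mem_univ (o i).1)

/-- Makes the likelihood ratios in the change of measure positive on the support of the joint law.
-/
theorem encEve_pos_of_joint_pos {K : ℕ} {ω : Outcome X Y Z L M n S.bits K}
    (h : 0 < S.joint ch K ω) (j : Fin K) :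
    0 < encEve ch S.wEnc (ext ω.1 (start (L * M) j)) fun i => (ω.2.2.1 j i).2 := by
  have h1 := Finset.prod_ne_zero_iff.mp (right_ne_zero_of_mul h.ne') j (Finset.mem_univ j)
  have h2 := left_ne_zero_of_mul h1
  have h3 : 0 < S.wEnc (ext ω.1 (start (L * M) j)) (ω.2.1 j) :=
    ((S.wEnc _).2.1 _).lt_of_ne (left_ne_zero_of_mul h2).symm
  have h4 : 0 < blockProb ch (ω.2.1 j) (ω.2.2.1 j) :=
    (blockProb_nonneg ch _ _).lt_of_ne (right_ne_zero_of_mul h2).symm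
  refine (mul_pos h3 (h4.trans_le (blockProb_le_prodChan ch _ _))).trans_le ?_
  exact Finset.single_le_sum (f := fun x => S.wEnc (ext ω.1 (start (L * M) j)) x *
    prodChan (eveChan ch) x fun i => (ω.2.2.1 j i).2)
    (fun x _ => mul_nonneg ((S.wEnc _).2.1 _) ((prodChan_mem (eveChan_mem ch) x).1 _))
    (Finset.mem_univ (ω.2.1 j))

theorem eveOut_pos {m : Bits S.bits} {z : Fin n → Z} (h : 0 < encEve ch S.wEnc m z) :
    0 < S.eveOut ch z :=
  outLaw_pos (uniform_bits_mem _) (encEve_mem ch S.wEnc) (a := m) (mul_pos (by positivity) h)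

/-- Secrecy of a set of messages that have not been used as keys: the leakage is at most the
number of messages times the leakage of the wiretap code. -/
theorem mutualInfo_window_le {K A : ℕ} (win : Fin A → ℕ) (hinj : Function.Injective win)
    (hlt : ∀ i, win i < start (L * M) K) (hge : ∀ i, start (L * M) K ≤ win i + K) :
    mutualInfo (S.joint ch K) (fun ω i => ext ω.1 (win i))
      (fun ω => ((fun j i => (ω.2.2.1 j i).2 : Fin K → Fin n → Z),
        (fun j i => (ω.2.2.2 j i).2 : Fin K → Fin M × Fin n → Z))) ≤ A * S.wLeak ch := by
  classical
  obtain ⟨root, hr1, hr2, hr3, hr4⟩ := exists_root (L * M) K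
  set q := L * M
  set N := start q K
  set b := S.bits
  set V : Bits b → (Fin n → Z) → ℝ := encEve ch S.wEnc with hV
  have hV0 : ∀ m z, 0 ≤ V m z := fun m z => (encEve_mem ch S.wEnc m).1 z
  have hstart : ∀ j : Fin K, start q j < N := fun j => start_strictMono q j.2
  set c : ℝ := (1 / 2 ^ b) ^ N with hc
  have hc0 : 0 ≤ c := by positivity
  -- The roots of the window. They are distinct because the window lies among the `K` latest
  -- messages.
  set rt : Fin A → Fin K := fun i => ⟨root (win i), hr3 _ (hlt i)⟩ with hrt
  have hrtinj : Function.Injective rt := fun i i' h =>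
    hinj (hr4 _ _ (hge i) (hlt i) (hge i') (hlt i') (congrArg Fin.val h))
  set roots : Finset (Fin K) := Finset.univ.image rt with hroots
  have hcardroots : roots.card = A := by
    rw [hroots, Finset.card_image_of_injective _ hrtinj, Finset.card_univ, Fintype.card_fin]
  -- Eve's law after averaging over the roots
  set G : (Fin N → Bits b) → Fin K → (Fin M × Fin n → Z) → ℝ := fun w j z =>
    prodChan (eveChan ch) (S.cEnc (encrypt q j (ext w))) z with hG
  have hG0 : ∀ w j z, 0 ≤ G w j z := fun w j z => (prodChan_mem (eveChan_mem ch) _).1 z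
  -- Eve's conditional law after the change of measure: in the root slots the first minislot no
  -- longer depends on the message.
  set T : (Fin N → Bits b) → (Fin K → (Fin n → Z) × (Fin M × Fin n → Z)) → ℝ := fun w z =>
    ∏ j, ((if j ∈ roots then S.eveOut ch (z j).1 else V (ext w (start q j)) (z j).1) *
      G w j (z j).2) with hT
  set shift : (ℕ → Bits b) → (Fin N → Bits b) := fun σ i => σ (root i) with hshift
  have hext : ∀ w σ m, m < N → ext (w + shift σ) m = ext w m + σ (root m) := fun w σ m hm =>
    ext_add w (fun m => σ (root m)) hm
  have hGshift : ∀ w σ j z, G (w + shift σ) j z = G w j z := fun w σ j z => by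
    simp only [hG, hshift]
    rw [encrypt_shift hr2 w σ j.2]
  have hstartshift : ∀ w σ (j : Fin K), ext (w + shift σ) (start q j) = ext w (start q j) + σ j :=
    fun w σ j => by rw [hext w σ _ (hstart j), hr1 j j.2]
  -- Eve's marginal is unaffected by the replacement. Reindexing the messages by any shift along the
  -- chains preserves the sum; averaging over independent shifts at the roots turns `V` into
  -- `S.eveOut ch` there.
  have hfirst : ∀ z, ∑ w : Fin N → Bits b, ∏ j : Fin K, S.eveKernel ch j (ext w) (z j) = ∑ w, T w z := by
    intro z
    have h1 : ∀ s : Fin K → Bits b, ∑ w : Fin N → Bits b, ∏ j : Fin K, S.eveKernel ch j (ext w) (z j) =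
        ∑ w, ∏ j : Fin K, (V (ext w (start q j) + if j ∈ roots then s j else 0) (z j).1 *
          G w j (z j).2) := by
      intro s
      rw [← Equiv.sum_comp (Equiv.addRight
        (shift (ext fun j => if j ∈ roots then s j else 0)))]
      refine Finset.sum_congr rfl fun w _ => Finset.prod_congr rfl fun j _ => ?_
      have := hGshift w (ext fun j => if j ∈ roots then s j else 0) j (z j).2
      simp only [Equiv.coe_addRight]
      rw [eveKernel, hstartshift, ext_fin]
      congr 1
    have h2 : ∑ w : Fin N → Bits b, ∏ j : Fin K, S.eveKernel ch j (ext w) (z j) =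
        ∑ s : Fin K → Bits b, (1 / 2 ^ b) ^ K *
          ∑ w, ∏ j : Fin K, (V (ext w (start q j) + if j ∈ roots then s j else 0) (z j).1 *
          G w j (z j).2) := by
      simp_rw [← h1]
      rw [← Finset.sum_mul, sum_uniform, one_mul]
    rw [h2]
    simp_rw [Finset.mul_sum]
    rw [Finset.sum_comm]
    refine Finset.sum_congr rfl fun w _ => ?_
    have h3 : ∀ s : Fin K → Bits b, (1 / 2 ^ b : ℝ) ^ K *
        ∏ j : Fin K, (V (ext w (start q j) + if j ∈ roots then s j else 0) (z j).1 *
          G w j (z j).2) =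
        ∏ j : Fin K, (1 / 2 ^ b * (V (ext w (start q j) + if j ∈ roots then s j else 0) (z j).1 *
          G w j (z j).2)) := fun s => by
      rw [Finset.prod_mul_distrib (f := fun _ => (1 / 2 ^ b : ℝ))]
      simp
    simp_rw [h3]
    rw [sum_pi_prod fun (j : Fin K) s => 1 / 2 ^ b *
      (V (ext w (start q j) + if j ∈ roots then s else 0) (z j).1 * G w j (z j).2)]
    refine Finset.prod_congr rfl fun j _ => ?_
    simp_rw [← mul_assoc]
    rw [← Finset.sum_mul]
    congr 1
    split_ifs with hj
    · exact S.sum_eveOut_shift ch _ _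
    · rw [← Finset.sum_mul, (uniform_bits_mem b).2, one_mul, add_zero]
  -- the window is uniform given what is invariant under the shifts along its chains
  set U := Fin A → Bits b
  set readout : (Fin N → Bits b) → U := fun w i => ext w (win i) with hreadout
  -- A window value is realized as a shift by placing its entries at the roots and zero elsewhere;
  -- such shifts translate the readout.
  have hfiber : ∀ (a : U) (H : (Fin N → Bits b) → ℝ),
      (∀ w σ, (∀ j : Fin K, j ∉ roots → σ j = 0) → H (w + shift σ) = H w) →
      ∑ w, ind (readout w = a) * H w = (Fintype.card U : ℝ)⁻¹ * ∑ w, H w := by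
    intro a H hH
    refine sum_fiber_of_translation
      (fun s : U => shift (ext (Function.extend rt s 0))) readout H (fun w s => ?_)
      (fun w s => ?_) a
    · funext i
      simp only [hreadout]
      rw [hext w _ _ (hlt i), ext_of_lt _ (hr3 _ (hlt i))]
      congr 1
      exact hrtinj.extend_apply s 0 i
    · refine hH w _ fun j hj => ?_
      rw [ext_fin, Function.extend_apply']
      · rfl
      · rintro ⟨i, rfl⟩
        exact hj (Finset.mem_image_of_mem _ (Finset.mem_univ i))
  have hTshift : ∀ z w σ, (∀ j : Fin K, j ∉ roots → σ j = 0) → T (w + shift σ) z = T w z := by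
    intro z w σ hσ
    refine Finset.prod_congr rfl fun j _ => ?_
    rw [hGshift, hstartshift]
    split_ifs with hj
    · rfl
    · rw [hσ j hj, add_zero]
  -- the two marginal laws
  set eve : Outcome X Y Z L M n b K → (Fin K → Fin n → Z) × (Fin K → Fin M × Fin n → Z) :=
    fun ω => ((fun j i => (ω.2.2.1 j i).2), (fun j i => (ω.2.2.2 j i).2)) with heve
  have hlawf : ∀ a : U, law (S.joint ch K) (fun ω i => ext ω.1 (win i)) a =
      (Fintype.card U : ℝ)⁻¹ := by
    intro a
    have h1 := S.sum_joint_eve ch (K := K) fun w _ => ind (readout w = a)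
    rw [law_eq_sum]
    simp_rw [mul_comm (ind _)]
    refine h1.trans ?_
    have h2 : ∀ w : Fin N → Bits b, ∑ z : Fin K → (Fin n → Z) × (Fin M × Fin n → Z),
        ∏ j : Fin K, S.eveKernel ch j (ext w) (z j) = 1 := by
      intro w
      rw [sum_pi_prod fun (j : Fin K) z => S.eveKernel ch j (ext w) z]
      refine Finset.prod_eq_one fun j _ => ?_
      simp_rw [Fintype.sum_prod_type, eveKernel, ← Finset.mul_sum,
        fun x : Fin M × Fin n → X => (prodChan_mem (eveChan_mem ch) x).2, mul_one]
      exact (encEve_mem ch S.wEnc _).2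
    simp_rw [← Finset.sum_mul, h2, one_mul]
    have h3 := hfiber a (fun _ => c) fun _ _ _ => rfl
    simp_rw [mul_comm (ind _)] at h3
    refine h3.trans ?_
    rw [hc, sum_uniform, mul_one]
  have hlawg : ∀ zF zG, law (S.joint ch K) eve (zF, zG) = c * ∑ w, T w fun j => (zF j, zG j) := by
    intro zF zG
    have h1 := S.sum_joint_eve ch (K := K) fun _ z => ind ((fun j => (zF j, zG j)) = z)
    rw [law_eq_sum]
    have h2 : ∀ ω : Outcome X Y Z L M n b K, ind (eve ω = (zF, zG)) =
        ind ((fun j => (zF j, zG j)) = fun j : Fin K =>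
          ((fun i => (ω.2.2.1 j i).2 : Fin n → Z), (fun i => (ω.2.2.2 j i).2 : _ → Z))) := by
      intro ω
      congr 1
      simp only [heve, Prod.mk.injEq, funext_iff, forall_and, eq_iff_iff]
      simp only [eq_comm]
    simp_rw [h2, mul_comm (ind _)]
    refine h1.trans ?_
    simp_rw [mul_comm _ (ind _), sum_ind_mul]
    rw [← Finset.mul_sum, hfirst]
  -- change of measure
  set ρ : Outcome X Y Z L M n b K → ℝ := fun ω => ∏ j, if j ∈ roots then
    S.eveOut ch (fun i => (ω.2.2.1 j i).2) /
      V (ext ω.1 (start q j)) (fun i => (ω.2.2.1 j i).2) else 1 with hρ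
  have hbound := mutualInfo_le_of_density (S.joint_mem ch K) (fun ω i => ext ω.1 (win i)) eve ρ
    (law (S.joint ch K) eve) (fun ω hω => by
      refine Finset.prod_pos fun j _ => ?_
      have := S.encEve_pos_of_joint_pos ch hω j
      split_ifs
      · exact div_pos (S.eveOut_pos ch this) this
      · exact one_pos) (law_nonneg (S.joint_nonneg ch) _)
    (by rw [sum_law, (S.joint_mem ch K).2]) (by
      rintro a ⟨zF, zG⟩
      set z : Fin K → (Fin n → Z) × (Fin M × Fin n → Z) := fun j => (zF j, zG j) with hz
      have h1 := S.sum_joint_eve ch (K := K) fun w z' => ind (readout w = a) * (ind (z = z') *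
        ∏ j : Fin K, if j ∈ roots then
          S.eveOut ch (z' j).1 / V (ext w (start q j)) (z' j).1 else 1)
      have h2 : ∀ ω : Outcome X Y Z L M n b K,
          ind ((fun i => ext ω.1 (win i)) = a ∧ eve ω = (zF, zG)) = ind (readout ω.1 = a) *
          ind (z = fun j : Fin K =>
            ((fun i => (ω.2.2.1 j i).2 : Fin n → Z), (fun i => (ω.2.2.2 j i).2 : _ → Z))) := by
        intro ω
        rw [← ind_and]
        congr 2
        simp only [heve, hz, Prod.mk.injEq, funext_iff, forall_and, eq_iff_iff]
        simp only [eq_comm]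
      rw [hlawf, hlawg]
      calc _ = _ := Finset.sum_congr rfl fun ω _ => by
            rw [h2, mul_left_comm, mul_assoc]
        _ = _ := h1
        _ = ∑ w, c * (ind (readout w = a) * ((∏ j : Fin K, S.eveKernel ch j (ext w) (z j)) *
            ∏ j : Fin K, if j ∈ roots then
              S.eveOut ch (z j).1 / V (ext w (start q j)) (z j).1 else 1)) := by
            refine Finset.sum_congr rfl fun w _ => ?_
            rw [← sum_ind_mul z fun z' => ind (readout w = a) *
              ((∏ j : Fin K, S.eveKernel ch j (ext w) (z' j)) * ∏ j : Fin K, if j ∈ roots then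
              S.eveOut ch (z' j).1 / V (ext w (start q j)) (z' j).1 else 1)]
            congr 1
            exact Finset.sum_congr rfl fun z' _ => by ring
        -- Only an inequality, because `V` may vanish at a root; the quotient is then zero.
        _ ≤ ∑ w, c * (ind (readout w = a) * T w z) := by
            refine Finset.sum_le_sum fun w _ => mul_le_mul_of_nonneg_left
              (mul_le_mul_of_nonneg_left ?_ (ind_nonneg _)) hc0
            rw [← Finset.prod_mul_distrib]
            refine Finset.prod_le_prod (fun j _ => ?_) fun j _ => ?_
            · refine mul_nonneg (mul_nonneg (hV0 _ _) (hG0 w j _)) ?_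
              split_ifs
              · exact div_nonneg (S.eveOut_nonneg ch _) (hV0 _ _)
              · exact zero_le_one
            · rw [eveKernel, mul_right_comm]
              refine mul_le_mul_of_nonneg_right ?_ (hG0 w j _)
              split_ifs
              · rw [mul_div_left_comm]
                exact mul_le_of_le_one_right (S.eveOut_nonneg ch _) (div_self_le_one _)
              · rw [mul_one]
        _ = _ := by
            rw [← Finset.mul_sum, hfiber a (fun w => T w z) (hTshift z)]
            ring)
  refine hbound.trans (le_of_eq ?_)
  have hlog : ∀ ω, S.joint ch K ω * Real.logb 2 (ρ ω) = -∑ j ∈ roots, S.joint ch K ω *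
      Real.logb 2 (V (ext ω.1 (start q j)) (fun i => (ω.2.2.1 j i).2) /
        S.eveOut ch fun i => (ω.2.2.1 j i).2) := by
    intro ω
    rcases (S.joint_nonneg ch ω).eq_or_lt with h0 | h0
    · simp [← h0]
    · have hpos : ∀ j ∈ roots, S.eveOut ch (fun i => (ω.2.2.1 j i).2) /
          V (ext ω.1 (start q j)) (fun i => (ω.2.2.1 j i).2) ≠ 0 := fun j _ =>
        have := S.encEve_pos_of_joint_pos ch h0 j
        (div_pos (S.eveOut_pos ch this) this).ne'
      simp only [hρ]
      rw [← Finset.mul_sum, ← mul_neg, ← Finset.sum_neg_distrib, Finset.prod_ite_mem,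
        Finset.univ_inter, Real.logb_prod _ _ hpos]
      congr 1
      refine Finset.sum_congr rfl fun j _ => ?_
      rw [← Real.logb_inv, inv_div]
  simp_rw [hlog]
  rw [Finset.sum_neg_distrib, neg_neg, Finset.sum_comm]
  have hj : ∀ j ∈ roots, ∑ ω, S.joint ch K ω *
      Real.logb 2 (V (ext ω.1 (start q j)) (fun i => (ω.2.2.1 j i).2) /
        S.eveOut ch fun i => (ω.2.2.1 j i).2) = S.wLeak ch := by
    intro j _
    rw [← S.sum_wJoint_log ch]
    exact S.sum_joint_first ch j fun m _ o => Real.logb 2 (V m (fun i => (o i).2) /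
      S.eveOut ch fun i => (o i).2)
  rw [Finset.sum_congr rfl hj, Finset.sum_const, hcardroots, nsmul_eq_mul]

theorem leakage_nonneg (N₁ k : ℕ) : 0 ≤ S.leakage ch N₁ k :=
  mutualInfo_nonneg (S.joint_mem ch (k + 1)) _ _

/-- Once the keys in use are older than the window, the leakage is bounded by that of the wiretap
code, uniformly in the slot number. -/
theorem leakage_le {N₁ k : ℕ} (hk : (N₁ + 1) * (1 + L * M) ≤ k) :
    S.leakage ch N₁ k ≤ ((N₁ + 1) * (1 + L * M) : ℕ) * S.wLeak ch := by
  have hN : N₁ ≤ k := by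
    have := Nat.le_mul_of_pos_right (N₁ + 1) (show 0 < 1 + L * M by omega)
    omega
  -- The window has at most `(N₁ + 1) * (1 + L * M) ≤ k` messages, so it fits into the `k + 1`
  -- latest ones, none of which has yet served as a key.
  have h1 := start_add_le (L * M) (k - N₁) (N₁ + 1)
  have h2 : k - N₁ + (N₁ + 1) = k + 1 := by omega
  rw [h2] at h1
  have h3 := (start_strictMono (L * M)).monotone (show k - N₁ ≤ k + 1 by omega)
  refine (S.mutualInfo_window_le ch
    (fun i : Fin (start (L * M) (k + 1) - start (L * M) (k - N₁)) =>
      start (L * M) (k - N₁) + (i : ℕ)) (fun i i' h => by simpa [Fin.ext_iff] using h)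
    (fun i => by have := i.2; omega) (fun i => by omega)).trans ?_
  refine mul_le_mul_of_nonneg_right ?_ (S.wLeak_nonneg ch)
  exact_mod_cast (by omega : start (L * M) (k + 1) - start (L * M) (k - N₁) ≤
    (N₁ + 1) * (1 + L * M))

end Scheme

/-! ### Weak converse for Bob's channel. -/

section Converse

variable {X Y Z : Type*} [Fintype X] [Fintype Y] [Fintype Z] (ch : X → stdSimplex ℝ (Y × Z))

/-- Needed because a real supremum carries no information without a bound. Here `log t ≤ t - 1` and
the fact that a posterior probability is at most one bound each term by `bobChan ch x y / log 2`. -/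
theorem bddAbove_infoBob : BddAbove (Set.range fun p : stdSimplex ℝ X => infoBob ch p) := by
  have hl := Real.log_pos one_lt_two
  refine ⟨∑ x, ∑ y, bobChan ch x y / Real.log 2, ?_⟩
  rintro _ ⟨p, rfl⟩
  have hp : ⇑p ∈ stdSimplex ℝ X := p.2
  simp only [infoBob_eq]
  refine Finset.sum_le_sum fun x _ => Finset.sum_le_sum fun y _ => ?_
  have hW := (bobChan_mem ch x).1 y
  rcases (mul_nonneg (hp.1 x) hW).eq_or_lt with h0 | h0
  · rw [← h0, zero_mul]
    exact div_nonneg hW hl.le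
  · have hw : 0 < bobChan ch x y := pos_of_mul_pos_right h0 (hp.1 x)
    have hq := outLaw_pos hp (bobChan_mem ch) h0
    have h1 := mul_le_mul_of_nonneg_left (logb_two_le (div_pos hw hq)) h0.le
    refine h1.trans ?_
    rw [← mul_div_assoc]
    refine div_le_div_of_nonneg_right ?_ hl.le
    have h2 : p x * bobChan ch x y / outLaw p (bobChan ch) y ≤ 1 :=
      (div_le_one hq).mpr (le_outLaw hp (bobChan_mem ch) x y)
    calc p x * bobChan ch x y * (bobChan ch x y / outLaw p (bobChan ch) y - 1)
        ≤ bobChan ch x y * (p x * bobChan ch x y / outLaw p (bobChan ch) y) := by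
          have : p x * bobChan ch x y * (bobChan ch x y / outLaw p (bobChan ch) y) =
            bobChan ch x y * (p x * bobChan ch x y / outLaw p (bobChan ch) y) := by ring
          rw [mul_sub, this]
          linarith
      _ ≤ bobChan ch x y := mul_le_of_le_one_right hw.le h2

theorem info_bobChan_le {p : X → ℝ} (hp : p ∈ stdSimplex ℝ X) :
    info p (bobChan ch) ≤ mainCapacity ch := by
  have : infoBob ch ⟨p, hp⟩ ≤ mainCapacity ch := le_ciSup (bddAbove_infoBob ch) ⟨p, hp⟩
  rw [infoBob_eq] at this
  exact this

/-- Weak converse for the memoryless channel to Bob: if the success event has probability at most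
`1 / N` whenever the output is independent of the input, then its probability is at most about
`|ι| C / log N`. -/
theorem success_mul_logb_le {T ι : Type*} [Fintype T] [Fintype ι] [DecidableEq ι] {P : T → ℝ}
    (hP : P ∈ stdSimplex ℝ T) (x : T → ι → X) (succ : T → (ι → Y) → Prop) {N : ℝ} (hN : 1 ≤ N)
    (h : ∀ y, ∑ t, P t * ind (succ t y) ≤ 1 / N) :
    (∑ t, P t * ∑ y, prodChan (bobChan ch) (x t) y * ind (succ t y)) * Real.logb 2 N ≤
      Fintype.card ι * mainCapacity ch + 1 := by
  have hl := Real.log_pos one_lt_two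
  set W := bobChan ch with hW
  have hWm := bobChan_mem ch
  -- The marginal output laws. Comparing with their product rather than with the true output law
  -- splits the divergence into single-letter informations directly.
  set q : ι → Y → ℝ := fun i y => ∑ t, P t * W (x t i) y with hq
  have hq0 : ∀ i y, 0 ≤ q i y := fun i y =>
    Finset.sum_nonneg fun t _ => mul_nonneg (hP.1 t) ((hWm _).1 y)
  have hq1 : ∀ i, ∑ y, q i y = 1 := fun i => by
    simp only [hq]
    rw [Finset.sum_comm]
    simp_rw [← Finset.mul_sum, hW, fun x => (hWm x).2, mul_one, hP.2]
  have hle : ∀ t i y, P t * W (x t i) y ≤ q i y := fun t i y =>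
    Finset.single_le_sum (f := fun t => P t * W (x t i) y)
      (fun t _ => mul_nonneg (hP.1 t) ((hWm _).1 y)) (Finset.mem_univ t)
  have hWn : ∀ t y, 0 ≤ prodChan W (x t) y := fun t y => (prodChan_mem hWm _).1 y
  have hsumW : ∀ t, ∑ y, prodChan W (x t) y = 1 := fun t => (prodChan_mem hWm _).2
  have term : ∀ t y, P t * (prodChan W (x t) y * ind (succ t y)) * Real.logb 2 N ≤
      P t * (prodChan W (x t) y * ∑ i, Real.logb 2 (W (x t i) (y i) / q i (y i))) +
      P t * prodChan W (x t) y +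
      (P t * ((∏ i, q i (y i)) * ((1 + N * ind (succ t y)) / 2)) -
        P t * prodChan W (x t) y) / Real.log 2 := by
    intro t y
    have hQ0 : 0 ≤ ∏ i, q i (y i) := Finset.prod_nonneg fun i _ => hq0 _ _
    rcases (mul_nonneg (hP.1 t) (hWn t y)).eq_or_lt with h0 | h0
    · have e1 : P t * (prodChan W (x t) y * ind (succ t y)) = 0 := by
        rw [← mul_assoc, ← h0, zero_mul]
      have e2 : P t * (prodChan W (x t) y *
          ∑ i, Real.logb 2 (W (x t i) (y i) / q i (y i))) = 0 := by
        rw [← mul_assoc, ← h0, zero_mul]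
      rw [e1, e2, ← h0, zero_mul, zero_add, zero_add, sub_zero]
      exact div_nonneg (mul_nonneg (hP.1 t) (mul_nonneg hQ0
        (by have := mul_nonneg (zero_le_one.trans hN) (ind_nonneg (succ t y)); linarith))) hl.le
    · have hPt : 0 < P t := pos_of_mul_pos_left h0 (hWn t y)
      have hw : 0 < prodChan W (x t) y := pos_of_mul_pos_right h0 (hP.1 t)
      have hwi : ∀ i, 0 < W (x t i) (y i) := fun i =>
        ((hWm _).1 _).lt_of_ne (Finset.prod_ne_zero_iff.mp hw.ne' i (Finset.mem_univ i)).symm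
      have hqi : ∀ i, 0 < q i (y i) := fun i => (mul_pos hPt (hwi i)).trans_le (hle t i (y i))
      have hQ : 0 < ∏ i, q i (y i) := Finset.prod_pos fun i _ => hqi i
      have hlogsum : ∑ i, Real.logb 2 (W (x t i) (y i) / q i (y i)) =
          Real.logb 2 (prodChan W (x t) y) - Real.logb 2 (∏ i, q i (y i)) := by
        rw [← Real.logb_div hw.ne' hQ.ne', prodChan, ← Finset.prod_div_distrib,
          Real.logb_prod _ _ fun i _ => (div_pos (hwi i) (hqi i)).ne']
      -- The tilt `e` is `N` on success and one otherwise, so `log e` is the quantity to be bounded.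
      -- It is halved so that the tilted reference measure has mass at most one, which causes the
      -- additive `1`.
      set e : ℝ := 1 + (N - 1) * ind (succ t y) with he
      have hee : ind (succ t y) * Real.logb 2 N = Real.logb 2 e := by
        by_cases hs : succ t y <;> simp [he, hs]
      have he0 : 0 < e := by
        have := mul_nonneg (sub_nonneg.mpr hN) (ind_nonneg (succ t y))
        linarith
      have he1 : e ≤ 1 + N * ind (succ t y) := by
        have := ind_nonneg (succ t y)
        rw [he]
        linarith
      have hlog := logb_two_le (t := (∏ i, q i (y i)) * (e / 2) / prodChan W (x t) y)
        (by positivity)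
      rw [Real.logb_div (by positivity) hw.ne', Real.logb_mul hQ.ne' (by positivity),
        Real.logb_div he0.ne' two_ne_zero, Real.logb_self_eq_one one_lt_two] at hlog
      have h1 := mul_le_mul_of_nonneg_left hlog h0.le
      have h2 : P t * prodChan W (x t) y *
          (((∏ i, q i (y i)) * (e / 2) / prodChan W (x t) y - 1) / Real.log 2) =
          (P t * ((∏ i, q i (y i)) * (e / 2)) - P t * prodChan W (x t) y) / Real.log 2 := by
        field_simp
      have h3 : (P t * ((∏ i, q i (y i)) * (e / 2)) - P t * prodChan W (x t) y) / Real.log 2 ≤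
          (P t * ((∏ i, q i (y i)) * ((1 + N * ind (succ t y)) / 2)) -
            P t * prodChan W (x t) y) / Real.log 2 := by
        gcongr
      rw [hlogsum]
      rw [h2] at h1
      calc P t * (prodChan W (x t) y * ind (succ t y)) * Real.logb 2 N
          = P t * prodChan W (x t) y * Real.logb 2 e := by rw [← hee]; ring
        _ ≤ _ := by linarith
  have hsum := Finset.sum_le_sum fun t (_ : t ∈ Finset.univ) =>
    Finset.sum_le_sum fun y (_ : y ∈ Finset.univ) => term t y
  simp_rw [Finset.sum_add_distrib, ← Finset.sum_div, Finset.sum_sub_distrib, ← Finset.sum_mul,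
    ← Finset.mul_sum, hsumW, mul_one, hP.2] at hsum
  -- Under the reference law the output is independent of `t`, so success has probability at most `1
  -- / N`.
  have hQ1 : ∑ t, P t * ∑ y, (∏ i, q i (y i)) * ((1 + N * ind (succ t y)) / 2) ≤ 1 := by
    simp_rw [Finset.mul_sum]
    rw [Finset.sum_comm]
    have hN0 : 0 < N := by linarith
    calc _ = ∑ y, (∏ i, q i (y i)) * ((∑ t, P t + N * ∑ t, P t * ind (succ t y)) / 2) := by
          refine Finset.sum_congr rfl fun y _ => ?_
          rw [Finset.mul_sum, ← Finset.sum_add_distrib, Finset.sum_div, Finset.mul_sum]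
          exact Finset.sum_congr rfl fun t _ => by ring
      _ ≤ ∑ y : ι → Y, ∏ i, q i (y i) := by
          refine Finset.sum_le_sum fun y _ =>
            mul_le_of_le_one_right (Finset.prod_nonneg fun i _ => hq0 _ _) ?_
          have := mul_le_mul_of_nonneg_left (h y) hN0.le
          rw [mul_one_div_cancel hN0.ne'] at this
          rw [hP.2]
          linarith
      _ = 1 := by rw [sum_pi_prod q]; exact Finset.prod_eq_one fun i _ => hq1 i
  -- Coordinate `i` contributes the mutual information for the law of the `i`-th input, at most `C`.
  have hinfo : ∑ t, P t * ∑ y, prodChan W (x t) y *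
      ∑ i, Real.logb 2 (W (x t i) (y i) / q i (y i)) ≤ Fintype.card ι * mainCapacity ch := by
    have e1 : ∀ t, ∑ y, prodChan W (x t) y *
        ∑ i, Real.logb 2 (W (x t i) (y i) / q i (y i)) =
        ∑ i, ∑ y, W (x t i) y * Real.logb 2 (W (x t i) y / q i y) := by
      intro t
      simp_rw [Finset.mul_sum]
      rw [Finset.sum_comm]
      exact Finset.sum_congr rfl fun i _ => sum_pi_eval (fun i y => W (x t i) y)
        (fun i => (hWm (x t i)).2) i fun y => Real.logb 2 (W (x t i) y / q i y)
    simp_rw [e1, Finset.mul_sum (s := (Finset.univ : Finset ι))]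
    rw [Finset.sum_comm, ← nsmul_eq_mul, ← Finset.card_univ, ← Finset.sum_const]
    refine Finset.sum_le_sum fun i _ => ?_
    have hpi : law P (fun t => x t i) ∈ stdSimplex ℝ X :=
      ⟨law_nonneg hP.1 _, by rw [sum_law, hP.2]⟩
    have hout : ∀ y, outLaw (law P fun t => x t i) W y = q i y := fun y =>
      sum_law_mul P (fun t => x t i) fun a => W a y
    refine le_trans (le_of_eq ?_) (info_bobChan_le ch hpi)
    rw [← sum_law_mul P (fun t => x t i) fun a => ∑ y, W a y * Real.logb 2 (W a y / q i y), info]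
    simp_rw [← hW, hout, Finset.mul_sum, mul_assoc]
  have h4 : (∑ t, P t * ∑ y, (∏ i, q i (y i)) * ((1 + N * ind (succ t y)) / 2) - 1) /
      Real.log 2 ≤ 0 := div_nonpos_of_nonpos_of_nonneg (by linarith) hl.le
  linarith

end Converse

/-! ### The last slot as a transmission to Bob over a memoryless channel. -/

namespace Scheme

variable {X Y Z : Type*} [Fintype X] [Fintype Y] [Fintype Z] {L M n : ℕ}
  (S : Scheme X Y L M n) (ch : X → stdSimplex ℝ (Y × Z))

/-- Causality: keys come from earlier slots, so slot `j` involves no message of a later slot. -/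
theorem slotKernel_congr {j : ℕ} {w w' : ℕ → Bits S.bits}
    (h : ∀ m < start (L * M) (j + 1), w m = w' m) (a : Slot X Y Z M n) :
    S.slotKernel ch j w a = S.slotKernel ch j w' a := by
  have hs := start_succ (L * M) j
  have henc : encrypt (L * M) j w = encrypt (L * M) j w' := by
    funext i
    rw [encrypt, encrypt]
    split_ifs with hi
    · have hkey := (keyIndex_eq (L * M) j i hi).2
      rw [h _ (by omega), h _ (by omega)]
    · rfl
  rw [slotKernel, slotKernel, h _ (by omega), henc]

/-- Channel input of the two parts of a slot. -/
def slotInput (j : ℕ) (w : ℕ → Bits S.bits) (x : Fin n → X) : Fin n ⊕ (Fin M × Fin n) → X :=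
  Sum.elim x (S.cEnc (encrypt (L * M) j w))

/-- Summing out Eve merges the two parts of a slot into one memoryless block, as the converse
requires. -/
theorem sum_slotKernel_bob (j : ℕ) (w : ℕ → Bits S.bits)
    (F : (Fin n ⊕ (Fin M × Fin n) → Y) → ℝ) :
    ∑ a, S.slotKernel ch j w a * F (Sum.elim (fun i => (a.2.1 i).1) fun i => (a.2.2 i).1) =
      ∑ x, S.wEnc (w (start (L * M) j)) x *
        ∑ y, prodChan (bobChan ch) (S.slotInput j w x) y * F y := by
  rw [Fintype.sum_prod_type]
  refine Finset.sum_congr rfl fun x _ => ?_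
  rw [← Equiv.sum_comp (Equiv.sumArrowEquivProdArrow _ _ Y).symm, Fintype.sum_prod_type,
    Fintype.sum_prod_type]
  have h1 := sum_blockProb_fst ch x fun y => ∑ y', prodChan (bobChan ch)
    (S.cEnc (encrypt (L * M) j w)) y' * F (Sum.elim y y')
  have h2 : ∀ (y : Fin n → Y), _ := fun y =>
    sum_blockProb_fst ch (S.cEnc (encrypt (L * M) j w)) fun y' => F (Sum.elim y y')
  have h3 : ∀ (y : Fin n → Y) (y' : Fin M × Fin n → Y),
      prodChan (bobChan ch) (S.slotInput j w x) ((Equiv.sumArrowEquivProdArrow _ _ Y).symm (y, y')) =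
      prodChan (bobChan ch) x y *
        prodChan (bobChan ch) (S.cEnc (encrypt (L * M) j w)) y' := by
    intro y y'
    rw [prodChan, Fintype.prod_sum_type]
    rfl
  simp_rw [h3, mul_assoc, ← Finset.mul_sum]
  simp_rw [← h2] at h1
  refine Eq.trans ?_ (congrArg (S.wEnc (w (start (L * M) j)) x * ·) (h1.trans ?_))
  · rw [Finset.mul_sum]
    refine Finset.sum_congr rfl fun o _ => ?_
    rw [Finset.mul_sum, Finset.mul_sum]
    refine Finset.sum_congr rfl fun o' _ => ?_
    rw [slotKernel]
    ring
  · exact Finset.sum_congr rfl fun y _ => congrArg _ (h2 y)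

/-- Bob's estimates after `k + 1` slots, from the first `k` slots and the output of the last. -/
def bobLast {k : ℕ} (a : Fin k → Slot X Y Z M n) (y : Fin n ⊕ (Fin M × Fin n) → Y) :
    ℕ → Bits S.bits :=
  estimate (L * M)
    (ext (Fin.snoc (α := fun _ => Bits S.bits) (fun j => S.wDec fun i => ((a j).2.1 i).1)
      (S.wDec fun i => y (Sum.inl i))))
    (ext (Fin.snoc (α := fun _ => Fin (L * M) → Bits S.bits)
      (fun j => S.cDec fun i => ((a j).2.2 i).1) (S.cDec fun i => y (Sum.inr i)))) (k + 1)

/-- What precedes the channel output of the last slot: messages, past slots, and the codeword of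
the first minislot. -/
abbrev Latent (X Y Z : Type*) (L M n b k : ℕ) : Type _ :=
  (Fin (start (L * M) (k + 1)) → Bits b) × (Fin k → Slot X Y Z M n) × (Fin n → X)

/-- The joint law of everything that precedes the channel output of the last slot. -/
def latentLaw (k : ℕ) (t : Latent X Y Z L M n S.bits k) : ℝ :=
  (1 / 2 ^ S.bits) ^ start (L * M) (k + 1) *
    ((∏ j : Fin k, S.slotKernel ch j (ext t.1) (t.2.1 j)) *
      S.wEnc (ext t.1 (start (L * M) k)) t.2.2)

theorem sum_latentLaw_mul (k : ℕ)
    (F : (Fin (start (L * M) (k + 1)) → Bits S.bits) → (Fin k → Slot X Y Z M n) → ℝ) :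
    ∑ t, S.latentLaw ch k t * F t.1 t.2.1 = ∑ a, ∑ w, F w a *
      ((1 / 2 ^ S.bits) ^ start (L * M) (k + 1) *
        ∏ j : Fin k, S.slotKernel ch j (ext w) (a j)) := by
  rw [Finset.sum_comm, Fintype.sum_prod_type]
  refine Finset.sum_congr rfl fun w _ => ?_
  rw [Fintype.sum_prod_type]
  refine Finset.sum_congr rfl fun a _ => ?_
  simp_rw [latentLaw]
  rw [← Finset.sum_mul, ← Finset.mul_sum, ← Finset.mul_sum,
    show ∑ x, S.wEnc (ext w (start (L * M) k)) x = 1 from (S.wEnc _).2.2]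
  ring

theorem sum_messages_past (k : ℕ) :
    ∑ a : Fin k → Slot X Y Z M n, ∑ w : Fin (start (L * M) (k + 1)) → Bits S.bits,
    ((1 / 2 ^ S.bits) ^ start (L * M) (k + 1) *
      ∏ j : Fin k, S.slotKernel ch j (ext w) (a j)) = 1 := by
  rw [Finset.sum_comm]
  refine (Finset.sum_congr rfl fun w _ => ?_).trans (sum_uniform (start (L * M) (k + 1)) S.bits)
  rw [← Finset.mul_sum, sum_pi_prod fun (j : Fin k) a => S.slotKernel ch j (ext w) a]
  simp_rw [sum_slotKernel, Finset.prod_const_one, mul_one]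

theorem latentLaw_mem (k : ℕ) :
    S.latentLaw ch k ∈ stdSimplex ℝ (Latent X Y Z L M n S.bits k) := by
  refine ⟨fun t => mul_nonneg (by positivity) (mul_nonneg
    (Finset.prod_nonneg fun j _ => S.slotKernel_nonneg ch _ _ _) ((S.wEnc _).2.1 _)), ?_⟩
  have := S.sum_latentLaw_mul ch k fun _ _ => 1
  simpa only [mul_one, one_mul, sum_messages_past] using this

/-- The success probability in the form of `success_mul_logb_le`: the past slots belong to the
latent variable and act as side information for Bob, and only the last channel output is averaged
inside. -/
theorem one_sub_errorProb (k : ℕ) :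
    1 - S.errorProb ch k = ∑ t, S.latentLaw ch k t * ∑ y,
      prodChan (bobChan ch) (S.slotInput k (ext t.1) t.2.2) y *
        ind (∀ m, start (L * M) k ≤ m → m < start (L * M) (k + 1) →
          S.bobLast t.2.1 y m = ext t.1 m) := by
  have h1 : 1 - S.errorProb ch k = ∑ ω, S.joint ch (k + 1) ω *
      ind (∀ m, start (L * M) k ≤ m → m < start (L * M) (k + 1) → S.bob ω m = ext ω.1 m) := by
    rw [errorProb, prob_eq_sum, ← (S.joint_mem ch (k + 1)).2, ← Finset.sum_sub_distrib]
    refine Finset.sum_congr rfl fun ω _ => ?_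
    have : (∀ m, start (L * M) k ≤ m → m < start (L * M) (k + 1) → S.bob ω m = ext ω.1 m) =
        ¬(ω ∈ {ω : Outcome X Y Z L M n S.bits (k + 1) | ∃ m, start (L * M) k ≤ m ∧
          m < start (L * M) (k + 1) ∧ S.bob ω m ≠ ext ω.1 m}) := by
      simp
    rw [this, ind_not]
    ring
  rw [h1, sum_joint, Fintype.sum_prod_type]
  refine Finset.sum_congr rfl fun w _ => ?_
  rw [← Equiv.sum_comp (Fin.snocEquiv fun _ : Fin (k + 1) => Slot X Y Z M n),
    Fintype.sum_prod_type_right, Fintype.sum_prod_type, Finset.mul_sum]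
  refine Finset.sum_congr rfl fun a _ => ?_
  have h2 := S.sum_slotKernel_bob ch k (ext w) fun y =>
    ind (∀ m, start (L * M) k ≤ m → m < start (L * M) (k + 1) → S.bobLast a y m = ext w m)
  refine Eq.trans (congrArg _ ?_) (Eq.trans (congrArg (fun r => (1 / 2 ^ S.bits) ^
    start (L * M) (k + 1) * ((∏ j : Fin k, S.slotKernel ch j (ext w) (a j)) * r)) h2) ?_)
  swap
  · rw [Finset.mul_sum, Finset.mul_sum]
    refine Finset.sum_congr rfl fun x _ => ?_
    rw [latentLaw]
    ring
  rw [Finset.mul_sum]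
  refine Finset.sum_congr rfl fun s _ => ?_
  rw [Fin.prod_univ_castSucc]
  simp only [Fin.snocEquiv_apply, Fin.snoc_castSucc, Fin.snoc_last, Fin.val_castSucc,
    Fin.val_last, mul_assoc]
  congr 3
  rw [eq_iff_iff]
  refine forall_congr' fun m => imp_congr_right fun _ => imp_congr_right fun _ => ?_
  rw [bob, bobLast]
  have e1 : (fun j : Fin (k + 1) => S.wDec fun i =>
      ((Fin.snoc (α := fun _ => Slot X Y Z M n) a s j).2.1 i).1) =
      Fin.snoc (α := fun _ => Bits S.bits) (fun j => S.wDec fun i => ((a j).2.1 i).1)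
        (S.wDec fun i => (s.2.1 i).1) := by
    funext j
    refine Fin.lastCases ?_ (fun j => ?_) j <;> simp
  have e2 : (fun j : Fin (k + 1) => S.cDec fun i =>
      ((Fin.snoc (α := fun _ => Slot X Y Z M n) a s j).2.2 i).1) =
      Fin.snoc (α := fun _ => Fin (L * M) → Bits S.bits)
        (fun j => S.cDec fun i => ((a j).2.2 i).1) (S.cDec fun i => (s.2.2 i).1) := by
    funext j
    refine Fin.lastCases ?_ (fun j => ?_) j <;> simp
  simp only [e1, e2, Sum.elim_inl, Sum.elim_inr]

/-- The converse for a full slot. -/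
theorem success_mul_bits_le {k : ℕ} (hk : L * M ≤ k) :
    (1 - S.errorProb ch k) * (((1 + L * M : ℕ) : ℝ) * S.bits) ≤
      ((n + M * n : ℕ) : ℝ) * mainCapacity ch + 1 := by
  have hs : start (L * M) (k + 1) = start (L * M) k + (1 + L * M) := by
    rw [start_succ, keyed, min_eq_right hk]
  set U := Fin (1 + L * M) → Bits S.bits with hU
  have hcard : (Fintype.card U : ℝ) = 2 ^ ((1 + L * M) * S.bits) := by
    rw [Fintype.card_fun, card_bits, Fintype.card_fin]
    push_cast
    rw [← pow_mul, mul_comm]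
  have hconv := success_mul_logb_le ch (S.latentLaw_mem ch k)
    (fun t => S.slotInput k (ext t.1) t.2.2)
    (fun t y => ∀ m, start (L * M) k ≤ m → m < start (L * M) (k + 1) →
      S.bobLast t.2.1 y m = ext t.1 m) (N := Fintype.card U)
    (by exact_mod_cast Fintype.card_pos (α := U)) (fun y => ?_)
  · rw [← one_sub_errorProb, hcard, Real.logb_pow, Real.logb_self_eq_one one_lt_two, mul_one,
      Fintype.card_sum, Fintype.card_prod, Fintype.card_fin, Fintype.card_fin] at hconv
    rw [Nat.cast_mul] at hconv
    exact hconv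
  -- With `y` and the past fixed, Bob's estimate is fixed, while the messages of the last slot are
  -- still uniform: changing them does not affect the law of earlier slots. A correct guess has
  -- probability at most one over their number.
  · set readout : (Fin (start (L * M) (k + 1)) → Bits S.bits) → U :=
      fun w i => ext w (start (L * M) k + i) with hread
    set τ : U → (Fin (start (L * M) (k + 1)) → Bits S.bits) := fun s m =>
      if start (L * M) k ≤ m then ext s (m - start (L * M) k) else 0 with hτ
    have hext : ∀ w s m, m < start (L * M) (k + 1) → ext (w + τ s) m = ext w m +
        if start (L * M) k ≤ m then ext s (m - start (L * M) k) else 0 := fun w s m hm => by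
      rw [ext_of_lt _ hm, ext_of_lt _ hm]
      rfl
    have hfiber : ∀ (a : Fin k → Slot X Y Z M n) (d : U), ∑ w, ind (readout w = d) *
        ((1 / 2 ^ S.bits) ^ start (L * M) (k + 1) *
          ∏ j : Fin k, S.slotKernel ch j (ext w) (a j)) =
        (Fintype.card U : ℝ)⁻¹ * ∑ w : Fin (start (L * M) (k + 1)) → Bits S.bits,
          ((1 / 2 ^ S.bits) ^ start (L * M) (k + 1) *
            ∏ j : Fin k, S.slotKernel ch j (ext w) (a j)) := fun a =>
      sum_fiber_of_translation τ readout
      (fun w => (1 / 2 ^ S.bits) ^ start (L * M) (k + 1) *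
        ∏ j : Fin k, S.slotKernel ch j (ext w) (a j))
      (fun w s => by
        funext i
        have := i.2
        simp only [hread]
        rw [hext _ _ _ (by omega), if_pos (by omega), Nat.add_sub_cancel_left, ext_fin]
        rfl)
      (fun w s => by
        congr 1
        refine Finset.prod_congr rfl fun j _ => S.slotKernel_congr ch (fun m hm => ?_) _
        have hle : start (L * M) (j + 1) ≤ start (L * M) k :=
          (start_strictMono (L * M)).monotone j.2
        rw [hext _ _ _ (by omega), if_neg (by omega), add_zero])
    rw [S.sum_latentLaw_mul ch k fun w a => ind (∀ m, start (L * M) k ≤ m →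
      m < start (L * M) (k + 1) → S.bobLast a y m = ext w m)]
    calc _ ≤ ∑ a, ∑ w, ind (readout w = fun i : Fin (1 + L * M) =>
          S.bobLast a y (start (L * M) k + (i : ℕ))) *
          ((1 / 2 ^ S.bits) ^ start (L * M) (k + 1) *
            ∏ j : Fin k, S.slotKernel ch j (ext w) (a j)) := by
          refine Finset.sum_le_sum fun a _ => Finset.sum_le_sum fun w _ =>
            mul_le_mul_of_nonneg_right (ind_mono fun h => ?_) (mul_nonneg (by positivity)
              (Finset.prod_nonneg fun j _ => S.slotKernel_nonneg ch _ _ _))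
          funext i
          have := i.2
          change ext w (start (L * M) k + (i : ℕ)) = S.bobLast a y (start (L * M) k + (i : ℕ))
          have h' := h (start (L * M) k + (i : ℕ)) (by omega) (by omega)
          exact h'.symm
      _ = ∑ a, (Fintype.card U : ℝ)⁻¹ * ∑ w : Fin (start (L * M) (k + 1)) → Bits S.bits,
          ((1 / 2 ^ S.bits) ^ start (L * M) (k + 1) *
            ∏ j : Fin k, S.slotKernel ch j (ext w) (a j)) :=
          Finset.sum_congr rfl fun a _ =>
            hfiber a fun i : Fin (1 + L * M) => S.bobLast a y (start (L * M) k + (i : ℕ))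
      _ = 1 / Fintype.card U := by
          rw [← Finset.mul_sum, sum_messages_past, mul_one, one_div]
      _ ≤ _ := le_rfl

end Scheme

/-! ### Asymptotics for families of codes. -/

section Families

variable {X Y Z : Type*} [Fintype X] [Fintype Y] [Fintype Z] {ch : X → stdSimplex ℝ (Y × Z)}
  {L M : ℕ} {S : ∀ n, Scheme X Y L M n}

/-- The rate is a constant times `bits / n`, and `C = L R_s` turns `(1 + L M) R_s` into `R_s + C M`.
-/
theorem IsReliableFamily.tendsto_rate (h : IsReliableFamily ch S)
    (hL : mainCapacity ch = (L : ℝ) * secrecyCapacity ch) :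
    Tendsto (fun n => (S n).rate) atTop
      (𝓝 ((secrecyCapacity ch + mainCapacity ch * (M : ℝ)) / ((M : ℝ) + 1))) := by
  have h1 := h.1.const_mul (((1 + L * M : ℕ) : ℝ) / ((M + 1 : ℕ) : ℝ))
  have e : ((1 + L * M : ℕ) : ℝ) / ((M + 1 : ℕ) : ℝ) * secrecyCapacity ch =
      (secrecyCapacity ch + mainCapacity ch * (M : ℝ)) / ((M : ℝ) + 1) := by
    rw [hL]
    push_cast
    ring
  rw [e] at h1
  refine h1.congr fun n => ?_
  rw [Scheme.rate, mul_div_mul_comm]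

theorem IsReliableFamily.tendsto_errorProb (h : IsReliableFamily ch S) (k : ℕ) :
    Tendsto (fun n => (S n).errorProb ch k) atTop (𝓝 0) := by
  refine squeeze_zero (fun n => (S n).errorProb_nonneg ch k)
    (fun n => (S n).errorProb_le ch k) ?_
  simpa using (h.2.1.const_mul ((k : ℝ) + 1)).add (h.2.2.const_mul (k : ℝ))

/-- The threshold for `k` precedes `ε`, and `n₀` serves all such `k`, because the multiple of
`wLeak` in the bound depends on neither `n` nor `k`. -/
theorem IsStrongFamily.leakage_le (h : IsStrongFamily ch S) (N₁ : ℕ) {ε : ℝ} (hε : 0 < ε) :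
    ∃ n₀ : ℕ, ∀ n ≥ n₀, ∀ k ≥ (N₁ + 1) * (1 + L * M), (S n).leakage ch N₁ k ≤ ε := by
  have h1 := h.2.const_mul (((N₁ + 1) * (1 + L * M) : ℕ) : ℝ)
  rw [mul_zero] at h1
  obtain ⟨n₀, hn₀⟩ := eventually_atTop.mp (h1.eventually (gt_mem_nhds hε))
  exact ⟨n₀, fun n hn k hk => ((S n).leakage_le ch hk).trans (hn₀ n hn).le⟩

theorem IsWynerFamily.leakage_le (h : IsWynerFamily ch S) (N₁ : ℕ) {ε : ℝ} (hε : 0 < ε) :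
    ∃ n₀ : ℕ, ∀ n ≥ n₀, ∀ k ≥ (N₁ + 1) * (1 + L * M),
      (1 / (n : ℝ)) * (S n).leakage ch N₁ k ≤ ε := by
  have h1 := h.2.const_mul (((N₁ + 1) * (1 + L * M) : ℕ) : ℝ)
  rw [mul_zero] at h1
  obtain ⟨n₀, hn₀⟩ := eventually_atTop.mp (h1.eventually (gt_mem_nhds hε))
  refine ⟨n₀, fun n hn k hk => le_trans ?_ (hn₀ n hn).le⟩
  refine (mul_le_mul_of_nonneg_left ((S n).leakage_le ch hk) (by positivity)).trans
    (le_of_eq ?_)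
  ring

theorem IsStrongFamily.isStrongSchemeRate (h : IsStrongFamily ch S)
    (hL : mainCapacity ch = (L : ℝ) * secrecyCapacity ch) :
    IsStrongSchemeRate ch L
      ((secrecyCapacity ch + mainCapacity ch * (M : ℝ)) / ((M : ℝ) + 1)) := by
  refine ⟨M, S, h.1.tendsto_rate hL, fun N₁ => ⟨(N₁ + 1) * (1 + L * M), fun k hk =>
    ⟨h.1.tendsto_errorProb k, ?_⟩⟩⟩
  rw [Metric.tendsto_atTop]
  intro ε hε
  obtain ⟨n₀, hn₀⟩ := h.leakage_le N₁ (half_pos hε)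
  refine ⟨n₀, fun n hn => ?_⟩
  rw [Real.dist_0_eq_abs, abs_of_nonneg ((S n).leakage_nonneg ch N₁ k)]
  exact (hn₀ n hn k hk).trans_lt (half_lt_self hε)

end Families

/-! ### Achieved rates and the capacity of the scheme. -/

section Capacity

variable {X Y Z : Type*} [Fintype X] [Fintype Y] [Fintype Z] {ch : X → stdSimplex ℝ (Y × Z)}
  {L : ℕ} {R : ℝ}

theorem IsStrongSchemeRate.isSchemeRate (h : IsStrongSchemeRate ch L R) :
    IsSchemeRate ch L R := by
  obtain ⟨M, S, hrate, hS⟩ := h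
  refine ⟨M, S, hrate, fun N₁ => ?_⟩
  obtain ⟨k₀, hk₀⟩ := hS N₁
  refine ⟨k₀, fun k hk => ⟨(hk₀ k hk).1, ?_⟩⟩
  have := (hk₀ k hk).2.mul (tendsto_inv_atTop_nhds_zero_nat (𝕜 := ℝ))
  simpa [div_eq_mul_inv] using this

/-- Converse: no scheme rate exceeds the main capacity. -/
theorem IsSchemeRate.le_mainCapacity (h : IsSchemeRate ch L R) : R ≤ mainCapacity ch := by
  obtain ⟨M, S, hrate, hS⟩ := h
  obtain ⟨k₀, hk₀⟩ := hS 0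
  -- One slot beyond the start-up phase suffices: reliability there already forces the bound.
  set k := max k₀ (L * M)
  have herr := (hk₀ k (le_max_left _ _)).1
  have h1 : Tendsto (fun n => (1 - (S n).errorProb ch k) * (S n).rate) atTop (𝓝 R) := by
    simpa using (herr.const_sub 1).mul hrate
  have h2 : Tendsto (fun n : ℕ => mainCapacity ch + 1 / ((M : ℝ) + 1) * (n : ℝ)⁻¹) atTop
      (𝓝 (mainCapacity ch)) := by
    simpa using ((tendsto_inv_atTop_nhds_zero_nat (𝕜 := ℝ)).const_mul
      (1 / ((M : ℝ) + 1))).const_add (mainCapacity ch)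
  refine le_of_tendsto_of_tendsto h1 h2 ?_
  filter_upwards [eventually_gt_atTop 0] with n hn
  have hn' : (0 : ℝ) < n := by exact_mod_cast hn
  have h3 := (S n).success_mul_bits_le ch (le_max_right k₀ (L * M))
  rw [Scheme.rate, ← mul_div_assoc, div_le_iff₀ (by positivity)]
  refine h3.trans (le_of_eq ?_)
  push_cast
  field_simp
  ring

theorem tendsto_fullRate (ch : X → stdSimplex ℝ (Y × Z)) :
    Tendsto (fun M : ℕ =>
        (secrecyCapacity ch + mainCapacity ch * (M : ℝ)) / ((M : ℝ) + 1))
      atTop (𝓝 (mainCapacity ch)) := by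
  have h1 : Tendsto (fun M : ℕ => mainCapacity ch +
      (secrecyCapacity ch - mainCapacity ch) * (1 / ((M : ℝ) + 1))) atTop
      (𝓝 (mainCapacity ch)) := by
    simpa using ((tendsto_one_div_add_atTop_nhds_zero_nat (𝕜 := ℝ)).const_mul
      (secrecyCapacity ch - mainCapacity ch)).const_add (mainCapacity ch)
  refine h1.congr fun M => ?_
  have : (M : ℝ) + 1 ≠ 0 := by positivity
  field_simp
  ring

end Capacity

end

end WiretapKey

theorem theorem1 {X Y Z : Type*} [Fintype X] [Fintype Y] [Fintype Z]
    (ch : X → stdSimplex ℝ (Y × Z))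
    (hdeg : IsDegraded ch)
    (hpos : 0 < secrecyCapacity ch)
    (L : ℕ) (hL : mainCapacity ch = (L : ℝ) * secrecyCapacity ch) :
    -- component codes as the scheme needs them exist, even with strong secrecy
    (∀ M : ℕ, ∃ S : ∀ n, Scheme X Y L M n, IsWynerFamily ch S) ∧
    (∀ M : ℕ, ∃ S : ∀ n, Scheme X Y L M n, IsStrongFamily ch S) ∧
    -- rate, reliability and secrecy of the scheme built from any Wyner codes
    (∀ (M : ℕ) (S : ∀ n, Scheme X Y L M n), IsWynerFamily ch S →
      Tendsto (fun n => (S n).rate) atTop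
        (𝓝 ((secrecyCapacity ch + mainCapacity ch * (M : ℝ)) / ((M : ℝ) + 1))) ∧
      (∀ k : ℕ, Tendsto (fun n => (S n).errorProb ch k) atTop (𝓝 0) ∧
        ∀ n, (S n).errorProb ch k ≤
          ((k : ℝ) + 1) * (S n).wError ch + (k : ℝ) * (S n).cError ch) ∧
      ∀ N₁ : ℕ, ∃ k₀ : ℕ, ∀ ε : ℝ, 0 < ε → ∃ n₀ : ℕ, ∀ n ≥ n₀, ∀ k ≥ k₀,
        (1 / (n : ℝ)) * (S n).leakage ch N₁ k ≤ (2 * (N₁ : ℝ) + 1) * ε) ∧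
    -- with strongly secret codes in the first minislots the leakage itself vanishes
    (∀ (M : ℕ) (S : ∀ n, Scheme X Y L M n), IsStrongFamily ch S →
      ∀ N₁ : ℕ, ∃ k₀ : ℕ, ∀ ε : ℝ, 0 < ε → ∃ n₀ : ℕ, ∀ n ≥ n₀, ∀ k ≥ k₀,
        (S n).leakage ch N₁ k ≤ ε) ∧
    -- the rate approaches the main capacity for large `M`
    Tendsto (fun M : ℕ =>
        (secrecyCapacity ch + mainCapacity ch * (M : ℝ)) / ((M : ℝ) + 1))
      atTop (𝓝 (mainCapacity ch)) ∧
    -- the secrecy capacity of the scheme is the main capacity, weakly and strongly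
    IsLUB {R : ℝ | IsSchemeRate ch L R} (mainCapacity ch) ∧
    IsLUB {R : ℝ | IsStrongSchemeRate ch L R} (mainCapacity ch) := by
  have hstrong := fun M => exists_isStrongFamily ch hpos L M hL
  have hrates : ∀ M : ℕ, IsStrongSchemeRate ch L
      ((secrecyCapacity ch + mainCapacity ch * (M : ℝ)) / ((M : ℝ) + 1)) := fun M =>
    (hstrong M).choose_spec.isStrongSchemeRate hL
  refine ⟨fun M => ?_, hstrong, fun M S hS => ⟨hS.1.tendsto_rate hL, fun k =>
    ⟨hS.1.tendsto_errorProb k, fun n => (S n).errorProb_le ch k⟩, fun N₁ =>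
    ⟨(N₁ + 1) * (1 + L * M), fun ε hε => ?_⟩⟩, fun M S hS N₁ =>
    ⟨(N₁ + 1) * (1 + L * M), fun ε hε => hS.leakage_le N₁ hε⟩, tendsto_fullRate ch, ?_, ?_⟩
  · obtain ⟨S, hS⟩ := hstrong M
    exact ⟨S, hS.isWynerFamily⟩
  -- The family bound allows any positive tolerance, here `(2 * N₁ + 1) * ε`.
  · exact hS.leakage_le N₁ (by positivity)
  · refine ⟨fun R hR => IsSchemeRate.le_mainCapacity hR, fun u hu => ?_⟩
    -- The supremum need not be attained: `C` is reached as the limit of the achieved rates in `M`.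
    exact le_of_tendsto' (tendsto_fullRate ch) fun M => hu (hrates M).isSchemeRate
  · refine ⟨fun R hR => (IsStrongSchemeRate.isSchemeRate hR).le_mainCapacity, fun u hu => ?_⟩
    exact le_of_tendsto' (tendsto_fullRate ch) fun M => hu (hrates M)
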